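/- Let $G:\mathbb R\to\mathbb R$ be twice continuously differentiable, not a polynomial of degree at most two, with $E[G(N)]=0$ for $N\sim N(0,1)$ (the expectation existing); write $g=G'$. Let $\boldsymbol x_i=\boldsymbol\mu+\boldsymbol z_i$, $i=1,2,\dots$, be an i.i.d. sample of $p$-vectors, where the components $z_{i1},\dots,z_{ip}$ of $\boldsymbol z_i$ are mutually independent, at most one of them is Gaussian, and $E(z_{ij})=0$, $E(z_{ij}^2)=1$. Assume that $$\beta_j=E[z_{ij}^4],\quad \nu_j=E[G(z_{ij})],\quad \mu_j=E[g(z_{ij})],\quad \sigma_j^2=\mathrm{Var}[g(z_{ij})],$$ $$\lambda_j=E[g(z_{ij})z_{ij}],\quad \delta_j=E[g'(z_{ij})],\quad \tau_j=E[g'(z_{ij})z_{ij}]$$ exist and are finite, the last two locally uniformly: for every $j$ there is $\varepsilon>0$ such that $\sup_{|t|\le\varepsilon}|g'(z+t)|\le h(z)$ for all $z$, for some function $h$ with $E[h(z_{ij})(1+|z_{ij}|)]<\infty$. Put $s_j=\mathrm{sign}(\nu_j)$ and assume $\nu_j(\lambda_j-\delta_j)\ge 0$ for all $j$, with equality for at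 most one $j$. For the sample $\boldsymbol x_1,\dots,\boldsymbol x_n$ with mean $\bar{\boldsymbol x}$ and covariance matrix $\hat{\boldsymbol S}=\frac1n\sum_i(\boldsymbol x_i-\bar{\boldsymbol x})(\boldsymbol x_i-\bar{\boldsymbol x})^T$ put $$\hat G(\boldsymbol\gamma)=\tfrac1n\sum_i G(\boldsymbol\gamma^T(\boldsymbol x_i-\bar{\boldsymbol x})),\qquad \hat{\boldsymbol T}(\boldsymbol\gamma)=\tfrac1n\sum_i g(\boldsymbol\gamma^T(\boldsymbol x_i-\bar{\boldsymbol x}))(\boldsymbol x_i-\bar{\boldsymbol x}),\qquad \hat{\boldsymbol T}_2(\boldsymbol\gamma)=\hat G(\boldsymbol\gamma)\hat{\boldsymbol T}(\boldsymbol\gamma).$$ The deflation-based, symmetric and squared symmetric FastICA estimates are $p\times p$ matrices $\boldsymbol\Gamma=(\boldsymbol\gamma_1,\dots,\boldsymbol\gamma_p)^T$ with $\boldsymbol\gamma_l^T\hat{\boldsymbol S}\boldsymbol\gamma_j=\delta_{lj}$ (Kronecker delta) for all $j,l$ that solve, respectively, for all $j,l$, - $\hat{\boldsymbol T}(\boldsymbol\gamma_j)=\hat{\boldsymbol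 S}\big(\sum_{l\le j}\boldsymbol\gamma_l\boldsymbol\gamma_l^T\big)\hat{\boldsymbol T}(\boldsymbol\gamma_j)$; - $\boldsymbol\gamma_l^T\hat{\boldsymbol T}(\boldsymbol\gamma_j)\hat s_j=\boldsymbol\gamma_j^T\hat{\boldsymbol T}(\boldsymbol\gamma_l)\hat s_l$, where $\hat s_j=\mathrm{sign}\,\hat G(\boldsymbol\gamma_j)$; - $\boldsymbol\gamma_l^T\hat{\boldsymbol T}_2(\boldsymbol\gamma_j)=\boldsymbol\gamma_j^T\hat{\boldsymbol T}_2(\boldsymbol\gamma_l)$. For each of the three methods (in (i) if $\lambda_j\ne\delta_j$ for all $j<p$; in (ii) if $\nu_j=0$ at most for a Gaussian component) there is a sequence of estimators $\hat{\boldsymbol\Gamma}=\hat{\boldsymbol\Gamma}_n$, measurable functions of $\boldsymbol x_1,\dots,\boldsymbol x_n$, that solve the estimating equations with probability tending to one, converge in probability to $\boldsymbol I_p$, and whose rows $\hat{\boldsymbol\gamma}_j$, $j=1,\dots,p$, have a diagonal asymptotic covariance matrix, that is, $\sqrt n(\hat{\boldsymbol\gamma}_j-\boldsymbol e_j)$ converges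 in distribution to $N_p\big(\boldsymbol 0,\sum_{l}ASV(\hat\gamma_{jl})\boldsymbol e_l\boldsymbol e_l^T\big)$, where $ASV(\hat\gamma_{jj})=(\beta_j-1)/4$ in all cases and (i) (deflation-based) $$ASV(\hat\gamma_{jl})=\frac{\sigma_l^2-\lambda_l^2}{(\lambda_l-\delta_l)^2}+1\quad(l<j),\qquad ASV(\hat\gamma_{jl})=\frac{\sigma_j^2-\lambda_j^2}{(\lambda_j-\delta_j)^2}\quad(l>j);$$ (ii) (symmetric) $$ASV(\hat\gamma_{jl})=\frac{\sigma_j^2+\sigma_l^2-\lambda_j^2+\delta_l(\delta_l-2\lambda_l)}{\big((\lambda_j-\delta_j)s_j+(\lambda_l-\delta_l)s_l\big)^2}\quad(l\ne j);$$ (iii) (squared symmetric) $$ASV(\hat\gamma_{jl})=\frac{\nu_j^2(\sigma_j^2-\lambda_j^2)+\nu_l^2\big(\sigma_l^2+\delta_l(\delta_l-2\lambda_l)\big)}{\big(\nu_j(\lambda_j-\delta_j)+\nu_l(\lambda_l-\delta_l)\big)^2}\quad(l\ne j).$$ -/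

import Mathlib

open MeasureTheory ProbabilityTheory Filter Topology

noncomputable section

/-! ### The function `G` -/

/-- The requirements on `G`: twice continuously differentiable, not a polynomial of degree at most
two, and `E[G(N)] = 0` for a standard Gaussian variable `N`. -/
structure IsFastICAFunction (G : ℝ → ℝ) : Prop where
  contDiff : ContDiff ℝ 2 G
  not_quadratic : ¬ ∃ a b c : ℝ, ∀ x, G x = a * x ^ 2 + b * x + c
  integrable_gaussian : Integrable G (gaussianReal 0 1)
  integral_gaussian : ∫ x, G x ∂(gaussianReal 0 1) = 0

/-! ### Sample quantities

A sample of size `n` of `p`-vectors is a function `X : Fin n → Fin p → ℝ`. All quantities are those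
of the empirical distribution of the sample. -/

section Sample

variable {n p : ℕ}

/-- The sample mean. -/
def sampleMean (X : Fin n → Fin p → ℝ) : Fin p → ℝ := (n : ℝ)⁻¹ • ∑ i, X i

/-- The centred observations. -/
def centred (X : Fin n → Fin p → ℝ) (i : Fin n) : Fin p → ℝ := X i - sampleMean X

/-- The covariance matrix of the empirical distribution. -/
def sampleCov (X : Fin n → Fin p → ℝ) : Matrix (Fin p) (Fin p) ℝ :=
  (n : ℝ)⁻¹ • ∑ i, Matrix.vecMulVec (centred X i) (centred X i)

/-- The sample version of `E[G(γᵀ(x - E x))]`. -/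
def sampleG (G : ℝ → ℝ) (X : Fin n → Fin p → ℝ) (γ : Fin p → ℝ) : ℝ :=
  (n : ℝ)⁻¹ * ∑ i, G (γ ⬝ᵥ centred X i)

/-- The sample version of `T(γ) = E[g(γᵀ(x - E x)) (x - E x)]`, with `g = G'`. -/
def sampleT (G : ℝ → ℝ) (X : Fin n → Fin p → ℝ) (γ : Fin p → ℝ) : Fin p → ℝ :=
  (n : ℝ)⁻¹ • ∑ i, deriv G (γ ⬝ᵥ centred X i) • centred X i

/-- The sample version of `T₂(γ) = E[G(γᵀ(x - E x))] T(γ)`. -/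
def sampleT2 (G : ℝ → ℝ) (X : Fin n → Fin p → ℝ) (γ : Fin p → ℝ) : Fin p → ℝ :=
  sampleG G X γ • sampleT G X γ

/-- `Γ`, with rows `γ₁, …, γ_p`, solves the estimating equations
`T(γ_j) = S (∑_{l ≤ j} γ_l γ_lᵀ) T(γ_j)` of deflation-based FastICA for the sample `X`, under the
constraints `γ_lᵀ S γ_j = δ_{lj}` of the deflation-based method. -/
def IsDeflationSolution (G : ℝ → ℝ) (X : Fin n → Fin p → ℝ) (Γ : Matrix (Fin p) (Fin p) ℝ) :
    Prop :=
  (∀ j : Fin p, sampleT G X (Γ j) = Matrix.mulVec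
    (sampleCov X * ∑ l ∈ Finset.Iic j, Matrix.vecMulVec (Γ l) (Γ l)) (sampleT G X (Γ j))) ∧
  (∀ j l : Fin p, Γ l ⬝ᵥ Matrix.mulVec (sampleCov X) (Γ j) = if l = j then 1 else 0)

/-- `Γ` solves the estimating equations of symmetric FastICA for the sample `X`; here
`s_j = sign E[G(γ_jᵀ(x - E x))]` is computed from the sample too. -/
def IsSymmetricSolution (G : ℝ → ℝ) (X : Fin n → Fin p → ℝ) (Γ : Matrix (Fin p) (Fin p) ℝ) :
    Prop :=
  (∀ j l : Fin p, (Γ l ⬝ᵥ sampleT G X (Γ j)) * Real.sign (sampleG G X (Γ j)) =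
    (Γ j ⬝ᵥ sampleT G X (Γ l)) * Real.sign (sampleG G X (Γ l))) ∧
  (∀ j l : Fin p, Γ l ⬝ᵥ Matrix.mulVec (sampleCov X) (Γ j) = if l = j then 1 else 0)

/-- `Γ` solves the estimating equations of squared symmetric FastICA for the sample `X`. -/
def IsSquaredSymmetricSolution (G : ℝ → ℝ) (X : Fin n → Fin p → ℝ)
    (Γ : Matrix (Fin p) (Fin p) ℝ) : Prop :=
  (∀ j l : Fin p, Γ l ⬝ᵥ sampleT2 G X (Γ j) = Γ j ⬝ᵥ sampleT2 G X (Γ l)) ∧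
  (∀ j l : Fin p, Γ l ⬝ᵥ Matrix.mulVec (sampleCov X) (Γ j) = if l = j then 1 else 0)

end Sample

/-! ### Characteristics of one component -/

section Component

variable {Ω : Type*} [MeasurableSpace Ω]

/-- `β = E[Z⁴]`. -/
def icBeta (P : Measure Ω) (Z : Ω → ℝ) : ℝ := ∫ ω, Z ω ^ 4 ∂P

/-- `ν = E[G(Z)]`. -/
def icNu (G : ℝ → ℝ) (P : Measure Ω) (Z : Ω → ℝ) : ℝ := ∫ ω, G (Z ω) ∂P

/-- `σ² = Var[g(Z)]`. -/
def icSigmaSq (G : ℝ → ℝ) (P : Measure Ω) (Z : Ω → ℝ) : ℝ := variance (fun ω => deriv G (Z ω)) P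

/-- `λ = E[g(Z) Z]`. -/
def icLambda (G : ℝ → ℝ) (P : Measure Ω) (Z : Ω → ℝ) : ℝ := ∫ ω, deriv G (Z ω) * Z ω ∂P

/-- `δ = E[g'(Z)]`. -/
def icDelta (G : ℝ → ℝ) (P : Measure Ω) (Z : Ω → ℝ) : ℝ := ∫ ω, deriv (deriv G) (Z ω) ∂P

/-- All moments `E[Z⁴]`, `E[G(Z)]`, `E[g(Z)]`, `Var[g(Z)]`, `E[g(Z)Z]`, `E[g'(Z)]`, `E[g'(Z)Z]` of
the component `Z` exist. -/
structure HasICMoments (G : ℝ → ℝ) (P : Measure Ω) (Z : Ω → ℝ) : Prop where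
  beta : Integrable (fun ω => Z ω ^ 4) P
  nu : Integrable (fun ω => G (Z ω)) P
  sigma : MemLp (fun ω => deriv G (Z ω)) 2 P
  lam : Integrable (fun ω => deriv G (Z ω) * Z ω) P
  delta : Integrable (fun ω => deriv (deriv G) (Z ω)) P
  tau : Integrable (fun ω => deriv (deriv G) (Z ω) * Z ω) P

/-- The moments `E[g'(Z)]` and `E[g'(Z)Z]` exist locally uniformly in the argument of `g'`: for some
`ε > 0`, `E[sup_{|t| ≤ ε} |g'(Z + t)| (1 + |Z|)] < ∞`. -/
def HasLocalEnvelope (G : ℝ → ℝ) (P : Measure Ω) (Z : Ω → ℝ) : Prop :=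
  ∃ ε : ℝ, 0 < ε ∧ ∃ h : ℝ → ℝ,
    (∀ x t : ℝ, |t| ≤ ε → |deriv (deriv G) (x + t)| ≤ h x) ∧
    Integrable (fun ω => h (Z ω) * (1 + |Z ω|)) P

end Component

/-! ### The independent component model -/

section Model

variable {Ω : Type*} [MeasurableSpace Ω] {p : ℕ}

/-- `z 0, z 1, …` are independent copies of a random vector with mutually independent components
with mean zero and variance one, at most one of which is Gaussian. -/
structure IsICSourceSample (P : Measure Ω) (z : ℕ → Ω → Fin p → ℝ) : Prop where
  measurable : ∀ i, Measurable (z i)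
  iIndep : iIndepFun z P
  identDistrib : ∀ i, IdentDistrib (z i) (z 0) P P
  iIndep_components : iIndepFun (fun (j : Fin p) ω => z 0 ω j) P
  memLp : ∀ j, MemLp (fun ω => z 0 ω j) 2 P
  mean : ∀ j, ∫ ω, z 0 ω j ∂P = 0
  second_moment : ∀ j, ∫ ω, z 0 ω j ^ 2 ∂P = 1
  gaussian_unique : ∀ j k, P.map (fun ω => z 0 ω j) = gaussianReal 0 1 →
    P.map (fun ω => z 0 ω k) = gaussianReal 0 1 → j = k

/-- The matrix `V` is the asymptotic covariance matrix of the estimator `θ' n` of `θ`: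
`√n (θ' n - θ)` converges in distribution to the centred normal law with covariance matrix `V`. -/
def HasASV (P : Measure Ω) [IsProbabilityMeasure P] (θ' : ℕ → Ω → Fin p → ℝ) (θ : Fin p → ℝ)
    (V : Matrix (Fin p) (Fin p) ℝ) : Prop :=
  V.PosSemidef ∧
  TendstoInDistribution (fun (n : ℕ) ω => WithLp.toLp 2 (Real.sqrt (n : ℝ) • (θ' n ω - θ))) atTop
    (id : EuclideanSpace ℝ (Fin p) → EuclideanSpace ℝ (Fin p)) (fun _ => P)
    (multivariateGaussian 0 V)

/-- There is a sequence of estimators `Γ' n`, measurable functions of the first `n` observations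
of `x`, which solve the estimating equations `Sol` with probability tending to one, converge in
probability to the identity matrix, and whose `j`-th row has, for every `j`, a diagonal asymptotic
covariance matrix with diagonal entries `V j l`. -/
def HasSolutionsWithASV (P : Measure Ω) [IsProbabilityMeasure P] (x : ℕ → Ω → Fin p → ℝ)
    (Sol : ∀ n : ℕ, (Fin n → Fin p → ℝ) → Matrix (Fin p) (Fin p) ℝ → Prop)
    (V : Fin p → Fin p → ℝ) : Prop :=
  ∃ Γ' : ∀ n : ℕ, (Fin n → Fin p → ℝ) → Matrix (Fin p) (Fin p) ℝ,
    (∀ n j l, Measurable (fun X => Γ' n X j l)) ∧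
    Tendsto (fun n : ℕ => P {ω | Sol n (fun i => x i ω) (Γ' n (fun i => x i ω))}) atTop (𝓝 1) ∧
    (∀ j l, TendstoInMeasure P (fun (n : ℕ) ω => Γ' n (fun i => x i ω) j l) atTop
      (fun _ => (1 : Matrix (Fin p) (Fin p) ℝ) j l)) ∧
    ∀ j, HasASV P (fun (n : ℕ) ω => Γ' n (fun i => x i ω) j) ((1 : Matrix (Fin p) (Fin p) ℝ) j)
      (Matrix.diagonal (V j))

end Model

end

/-! All three methods solve one kind of system. For `j ≠ l` put E_jl = w_jl γ_lᵀT̂(γ_j) − w_lj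
γ_jᵀT̂(γ_l) with weights w_jl = κ_jl + θ Ĝ(γ_j), and require E_jl = 0 together with the constraints
on γ_lᵀŜγ_j. Deflation is κ_jl = 1 for j < l and 0 otherwise, θ = 0; the symmetric method is κ_jl =
s_j, θ = 0; the squared symmetric method is κ = 0, θ = 1.

Near the identity, γ_lᵀT̂(γ_j) has derivative δ_j γ_jl + λ_j γ_lj, and γ_lᵀŜγ_j has derivative γ_jl
+ γ_lj. A linear combination of E_jl and the constraint therefore has derivative γ_jl times the
slope w_jl(λ_j − δ_j) + w_lj(λ_l − δ_l). Dividing by the slope, which the hypotheses keep away from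
zero, gives a map Φ (`newtonMap`) whose derivative at the identity I tends to the identity
(`ICModel.strictDeriv_newtonMap`) and whose zeros solve the system (`of_newtonMap_eq_zero`). Since
Φ(I) = O_P(n^(-1/2)), the map Γ ↦ Γ − Φ(Γ) is a contraction of a ball of radius n^(-3/8), with
probability tending to one. The limit of its iterates from I is a measurable estimator with Γ̂ − I =
−Φ(I) + o_P(n^(-1/2)) (`exists_limit_newton`). The leading term is an average of influence
functions, so the central limit theorem applies (`IsIID.tendstoInDistribution_normSum`).
Independence makes the influence functions of one row uncorrelated, and their variances are the
stated ones.

The derivative of Φ has to be controlled uniformly on the ball. Fourth moments give max ‖z_i‖ =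
O_P(n^(1/4)), so the projections γ_jᵀ(x_i − x̄) differ from z_ij by O_P(n^(-1/8)) plus |z̄_j|,
uniformly in i and in the ball. Averages of a continuous function at slightly perturbed arguments
differ from the unperturbed ones by an average of oscillations, and this is small by dominated
convergence and the law of large numbers (`IsIID.uniform_avg`). The one entry that would need
E[g'(z)z²] carries a small factor, so a crude Lipschitz bound suffices
(`ICModel.strictDeriv_mul_T_diag`).

A separate argument is needed in the symmetric method for a Gaussian component k with ν_k = 0, since
the sign of Ĝ(γ_k) does not settle down. By Stein's identity λ_k = δ_k, so neither the slopes nor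
the variances depend on the sign put in for s_k, and there is one candidate solution for each sign.
For both, √n Ĝ(γ_k) is asymptotically the same nondegenerate normalized sum S; hence the candidate
whose assumed sign equals that of S is a true solution. The selection does not alter the limit law,
because the two candidates have the same covariances among themselves and with S
(`IsIID.tendsto_charFun_switch`). -/

/-! ### Convergence in probability as convergence along a filter -/

section ProbFilter

variable {Ω : Type*} [MeasurableSpace Ω]

/-- The filter on `ℕ × Ω` of the events whose `n`-th section has probability tending to one. -/
def probFilter (P : Measure Ω) : Filter (ℕ × Ω) where
  sets := {S | Tendsto (fun n => P {ω | (n, ω) ∉ S}) atTop (𝓝 0)}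
  univ_sets := by simp
  sets_of_superset := by
    intro S T hS hST
    refine tendsto_of_tendsto_of_tendsto_of_le_of_le tendsto_const_nhds hS (fun _ => zero_le) ?_
    exact fun n => measure_mono fun ω hω h => hω (hST h)
  inter_sets := by
    intro S T hS hT
    have h : Tendsto (fun n => P {ω | (n, ω) ∉ S} + P {ω | (n, ω) ∉ T}) atTop (𝓝 0) := by
      simpa using hS.add hT
    refine tendsto_of_tendsto_of_tendsto_of_le_of_le tendsto_const_nhds h (fun _ => zero_le) ?_
    refine fun n => (measure_mono fun ω hω => ?_).trans (measure_union_le _ _)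
    by_contra hc
    simp only [Set.mem_union, Set.mem_ofPred_eq, not_or, not_not] at hc
    exact hω hc

variable {P : Measure Ω}

theorem eventually_probFilter {p : ℕ × Ω → Prop} :
    (∀ᶠ q in probFilter P, p q) ↔ Tendsto (fun n => P {ω | ¬ p (n, ω)}) atTop (𝓝 0) := Iff.rfl

theorem tendsto_fst_probFilter : Tendsto Prod.fst (probFilter P) atTop := by
  rw [tendsto_atTop]
  intro N
  rw [eventually_probFilter]
  refine tendsto_const_nhds.congr' ?_
  filter_upwards [eventually_ge_atTop N] with n hn
  simp [hn]

/-- With this equivalence the calculus of o_P(1) terms becomes the ordinary calculus of limits along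
one filter, and "with probability tending to one" becomes "eventually". -/
theorem tendstoInMeasure_iff_probFilter {X : ℕ → Ω → ℝ} {c : ℝ} :
    TendstoInMeasure P X atTop (fun _ => c) ↔
      Tendsto (fun q : ℕ × Ω => X q.1 q.2) (probFilter P) (𝓝 c) := by
  rw [tendstoInMeasure_iff_norm, Metric.tendsto_nhds]
  refine forall₂_congr fun ε _ => ?_
  rw [eventually_probFilter]
  simp [Real.dist_eq]

theorem tendsto_measure_of_eventually [IsProbabilityMeasure P] {p : ℕ × Ω → Prop}
    (h : ∀ᶠ q in probFilter P, p q) : Tendsto (fun n => P {ω | p (n, ω)}) atTop (𝓝 1) := by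
  rw [eventually_probFilter] at h
  have h1 : Tendsto (fun n => 1 - P {ω | ¬ p (n, ω)}) atTop (𝓝 1) := by
    simpa using ENNReal.Tendsto.sub tendsto_const_nhds h (Or.inl ENNReal.one_ne_top)
  refine tendsto_of_tendsto_of_tendsto_of_le_of_le h1 tendsto_const_nhds (fun n => ?_)
    (fun n => prob_le_one)
  rw [tsub_le_iff_right]
  calc (1 : ENNReal) = P Set.univ := by simp
    _ ≤ P ({ω | p (n, ω)} ∪ {ω | ¬ p (n, ω)}) := measure_mono fun ω _ => by
      simpa using em _
    _ ≤ _ := measure_union_le _ _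

/-- `X` is bounded in probability: it is negligible after multiplication by any negligible
sequence. -/
def BddInProb (P : Measure Ω) (X : ℕ × Ω → ℝ) : Prop :=
  ∀ a : ℕ × Ω → ℝ, Tendsto a (probFilter P) (𝓝 0) →
    Tendsto (fun q => a q * X q) (probFilter P) (𝓝 0)

namespace BddInProb

variable {X Y : ℕ × Ω → ℝ}

theorem of_tendsto {c : ℝ} (h : Tendsto X (probFilter P) (𝓝 c)) : BddInProb P X := by
  intro a ha
  simpa using ha.mul h

theorem add (hX : BddInProb P X) (hY : BddInProb P Y) : BddInProb P (fun q => X q + Y q) := by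
  intro a ha
  simpa [mul_add] using (hX a ha).add (hY a ha)

theorem neg (hX : BddInProb P X) : BddInProb P (fun q => - X q) := by
  intro a ha
  simpa using (hX a ha).neg

theorem sub (hX : BddInProb P X) (hY : BddInProb P Y) : BddInProb P (fun q => X q - Y q) := by
  simpa [sub_eq_add_neg] using hX.add hY.neg

theorem sum {ι : Type*} (s : Finset ι) {X : ι → ℕ × Ω → ℝ} (h : ∀ i ∈ s, BddInProb P (X i)) :
    BddInProb P (fun q => ∑ i ∈ s, X i q) := by
  intro a ha
  simp only [Finset.mul_sum]
  simpa using tendsto_finsetSum s fun i hi => h i hi a ha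

theorem abs (hX : BddInProb P X) : BddInProb P (fun q => |X q|) := by
  intro a ha
  have h := (hX _ (by simpa using ha.abs)).abs
  rw [tendsto_zero_iff_abs_tendsto_zero]
  refine (by simpa using h : Tendsto (fun q => |a q| * |X q|) _ _).congr fun q => ?_
  simp [abs_mul]

theorem congr' (hX : BddInProb P X) (h : X =ᶠ[probFilter P] Y) : BddInProb P Y := by
  intro a ha
  refine (hX a ha).congr' ?_
  filter_upwards [h] with q hq
  rw [hq]

theorem mono (hX : BddInProb P X) (h : ∀ᶠ q in probFilter P, |Y q| ≤ |X q|) : BddInProb P Y := by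
  intro a ha
  refine squeeze_zero_norm' ?_ (by simpa using (hX a ha).abs)
  filter_upwards [h] with q hq
  rw [Real.norm_eq_abs, abs_mul]
  gcongr

/-- In the usual notation, o_P(O_P(1)) = o_P(1): write Y = (Y/X) X, where the hypothesis makes Y/X
negligible. -/
theorem tendsto_of_forall_le (hX : BddInProb P X)
    (h : ∀ η > 0, ∀ᶠ q in probFilter P, |Y q| ≤ η * |X q|) :
    Tendsto Y (probFilter P) (𝓝 0) := by
  have ha : Tendsto (fun q => Y q / X q) (probFilter P) (𝓝 0) := by
    rw [Metric.tendsto_nhds]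
    intro ε hε
    filter_upwards [h (ε / 2) (by positivity)] with q hq
    rw [Real.dist_eq, sub_zero, abs_div]
    rcases eq_or_ne (X q) 0 with h0 | h0
    · simpa [h0] using hε
    · rw [div_lt_iff₀ (abs_pos.mpr h0)]
      have := abs_pos.mpr h0
      nlinarith
  -- Where X = 0 the quotient is 0 by convention, and Y = 0 there by the case η = 1 of the
  -- hypothesis.
  refine (hX _ ha).congr' ?_
  filter_upwards [h 1 one_pos] with q hq
  rcases eq_or_ne (X q) 0 with h0 | h0
  · have : Y q = 0 := by simpa [h0] using hq
    simp [h0, this]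
  · field_simp

end BddInProb

end ProbFilter

/-! ### Averages along a sequence -/

section Averages

variable {Ω E : Type*}

/-- The average of `φ` over the first `n` terms of the sequence `z`. -/
noncomputable def avg (z : ℕ → Ω → E) (φ : E → ℝ) (q : ℕ × Ω) : ℝ :=
  (q.1 : ℝ)⁻¹ * ∑ i ∈ Finset.range q.1, φ (z i q.2)

/-- The normalized sum of `φ` over the first `n` terms of the sequence `z`. -/
noncomputable def normSum (z : ℕ → Ω → E) (φ : E → ℝ) (q : ℕ × Ω) : ℝ :=
  (√(q.1 : ℝ))⁻¹ * ∑ i ∈ Finset.range q.1, φ (z i q.2)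

variable {z : ℕ → Ω → E}

theorem sqrt_mul_avg (φ : E → ℝ) (q : ℕ × Ω) : √(q.1 : ℝ) * avg z φ q = normSum z φ q := by
  rw [avg, normSum, ← mul_assoc]
  congr 1
  rcases Nat.eq_zero_or_pos q.1 with h | h
  · simp [h]
  · have h' : (0 : ℝ) < q.1 := by exact_mod_cast h
    have := Real.mul_self_sqrt h'.le
    have := Real.sqrt_pos.mpr h'
    field_simp
    nlinarith

theorem avg_sub (φ ψ : E → ℝ) (q : ℕ × Ω) :
    avg z (fun v => φ v - ψ v) q = avg z φ q - avg z ψ q := by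
  simp [avg, Finset.sum_sub_distrib, mul_sub]

theorem avg_const_mul (c : ℝ) (φ : E → ℝ) (q : ℕ × Ω) :
    avg z (fun v => c * φ v) q = c * avg z φ q := by
  simp only [avg, ← Finset.mul_sum]; ring

theorem avg_const (c : ℝ) {q : ℕ × Ω} (hq : 0 < q.1) : avg z (fun _ => c) q = c := by
  have : (q.1 : ℝ) ≠ 0 := by positivity
  simp [avg]; field_simp

theorem normSum_finset_sum {ι : Type*} (s : Finset ι) (φ : ι → E → ℝ) (q : ℕ × Ω) :
    normSum z (fun v => ∑ i ∈ s, φ i v) q = ∑ i ∈ s, normSum z (φ i) q := by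
  simp only [normSum, ← Finset.mul_sum]
  rw [Finset.sum_comm]

theorem normSum_const_mul (c : ℝ) (φ : E → ℝ) (q : ℕ × Ω) :
    normSum z (fun v => c * φ v) q = c * normSum z φ q := by
  simp only [normSum, ← Finset.mul_sum]; ring

end Averages

/-! ### Averages of an i.i.d. sequence -/

section IID

variable {Ω : Type*} [MeasurableSpace Ω] {E : Type*} [MeasurableSpace E]

/-- `z` is a sequence of independent identically distributed random elements. -/
structure IsIID (P : Measure Ω) (z : ℕ → Ω → E) : Prop where
  measurable : ∀ i, Measurable (z i)
  iIndep : iIndepFun z P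
  identDistrib : ∀ i, IdentDistrib (z i) (z 0) P P

variable {P : Measure Ω} {z : ℕ → Ω → E} {φ ψ : E → ℝ}

namespace IsIID

theorem measurable_normSum (hz : IsIID P z) (hφ : Measurable φ) (n : ℕ) :
    Measurable fun ω => normSum z φ (n, ω) := by
  simp only [normSum]
  exact (Finset.measurable_sum _ fun i _ => hφ.comp (hz.measurable i)).const_mul _

variable [IsProbabilityMeasure P]

theorem tendsto_avg (hz : IsIID P z) (hφ : Measurable φ)
    (hint : Integrable (fun ω => φ (z 0 ω)) P) :
    Tendsto (avg z φ) (probFilter P) (𝓝 (∫ ω, φ (z 0 ω) ∂P)) := by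
  have h := strong_law_ae_real (fun i ω => φ (z i ω)) hint
    (fun i j hij => (hz.iIndep.indepFun hij).comp hφ hφ)
    (fun i => (hz.identDistrib i).comp hφ)
  have h2 := tendstoInMeasure_of_tendsto_ae (fun n => by
    have : Measurable fun ω => (∑ i ∈ Finset.range n, φ (z i ω)) / (n : ℝ) :=
      (Finset.measurable_sum _ fun i _ => hφ.comp (hz.measurable i)).div_const _
    exact this.aestronglyMeasurable) h
  rw [tendstoInMeasure_iff_probFilter] at h2
  refine h2.congr fun q => ?_
  rw [avg, div_eq_inv_mul]

theorem eventually_avg_le (hz : IsIID P z) (hφ : Measurable φ)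
    (hint : Integrable (fun ω => φ (z 0 ω)) P) {c : ℝ} (hc : ∫ ω, φ (z 0 ω) ∂P < c) :
    ∀ᶠ q in probFilter P, avg z φ q ≤ c :=
  ((hz.tendsto_avg hφ hint).eventually (gt_mem_nhds hc)).mono fun _ h => le_of_lt h

/-- The variance of the normalized sum is the same for all n > 0, so Chebyshev's inequality gives a
tail bound uniform in n. -/
theorem bddInProb_normSum (hz : IsIID P z) (hφ : Measurable φ)
    (hL2 : MemLp (fun ω => φ (z 0 ω)) 2 P) (hmean : ∫ ω, φ (z 0 ω) ∂P = 0) :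
    BddInProb P (normSum z φ) := by
  set V := Var[fun ω => φ (z 0 ω); P] with hV
  have hV0 : 0 ≤ V := variance_nonneg _ _
  have hid : ∀ i, IdentDistrib (fun ω => φ (z i ω)) (fun ω => φ (z 0 ω)) P P :=
    fun i => (hz.identDistrib i).comp hφ
  have hL : ∀ i, MemLp (fun ω => φ (z i ω)) 2 P := fun i => (hid i).memLp_iff.2 hL2
  have hcheb : ∀ c > 0, ∀ n : ℕ, 0 < n →
      P {ω | c ≤ |normSum z φ (n, ω)|} ≤ ENNReal.ofReal (V / c ^ 2) := by
    intro c hc n hn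
    have hn' : (0 : ℝ) < n := by exact_mod_cast hn
    have hsum : MemLp (∑ i ∈ Finset.range n, fun ω => φ (z i ω)) 2 P :=
      memLp_finsetSum' _ fun i _ => hL i
    have hM : MemLp (fun ω => normSum z φ (n, ω)) 2 P := by
      have := hsum.const_mul (√(n : ℝ))⁻¹
      refine this.congr_norm this.1 ?_ |>.ae_eq ?_ <;>
      exact ae_of_all _ fun ω => by simp [normSum]
    have hmean' : ∫ ω, normSum z φ (n, ω) ∂P = 0 := by
      simp only [normSum]
      rw [integral_const_mul, integral_finsetSum _ fun i _ => (hL i).integrable one_le_two]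
      rw [Finset.sum_eq_zero fun i _ => by rw [(hid i).integral_eq, hmean], mul_zero]
    have hvar : Var[fun ω => normSum z φ (n, ω); P] = V := by
      have h1 : (fun ω => normSum z φ (n, ω)) =
          fun ω => (√(n : ℝ))⁻¹ * (∑ i ∈ Finset.range n, fun ω => φ (z i ω)) ω := by
        ext ω; simp [normSum]
      rw [h1, variance_const_mul, IndepFun.variance_sum (fun i _ => hL i)
        (fun i _ j _ hij => (hz.iIndep.indepFun hij).comp hφ hφ)]
      rw [Finset.sum_congr rfl fun i _ => (hid i).variance_eq]
      simp only [Finset.sum_const, Finset.card_range, nsmul_eq_mul, inv_pow,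
        Real.sq_sqrt hn'.le]
      field_simp
      exact hV.symm
    have := meas_ge_le_variance_div_sq hM hc
    rw [hvar, hmean'] at this
    simpa using this
  intro a ha
  rw [Metric.tendsto_nhds]
  intro ε hε
  rw [eventually_probFilter, ENNReal.tendsto_nhds_zero]
  intro δ hδ
  obtain ⟨δ', hδ'0, hδ'⟩ : ∃ δ' : ℝ, 0 < δ' ∧ ENNReal.ofReal δ' ≤ δ := by
    rcases eq_or_ne δ ⊤ with h | h
    · exact ⟨1, one_pos, by simp [h]⟩
    · exact ⟨δ.toReal, ENNReal.toReal_pos hδ.ne' h, by rw [ENNReal.ofReal_toReal h]⟩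
  obtain ⟨c, hc0, hc⟩ : ∃ c : ℝ, 0 < c ∧ V / c ^ 2 ≤ δ' / 2 := by
    refine ⟨√(2 * V / δ') + 1, by positivity, ?_⟩
    rw [div_le_iff₀ (by positivity)]
    have h1 : √(2 * V / δ') ^ 2 = 2 * V / δ' := Real.sq_sqrt (by positivity)
    have h2 : 2 * V / δ' ≤ (√(2 * V / δ') + 1) ^ 2 := by
      nlinarith [Real.sqrt_nonneg (2 * V / δ')]
    calc V = δ' / 2 * (2 * V / δ') := by field_simp
      _ ≤ _ := by gcongr
  have hsmall := (Metric.tendsto_nhds.mp ha) (ε / c) (by positivity)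
  rw [eventually_probFilter, ENNReal.tendsto_nhds_zero] at hsmall
  filter_upwards [hsmall (ENNReal.ofReal (δ' / 2)) (by simpa using hδ'0), eventually_gt_atTop 0]
    with n hn hn0
  refine le_trans ?_ hδ'
  calc P {ω | ¬ dist (a (n, ω) * normSum z φ (n, ω)) 0 < ε}
      ≤ P ({ω | ¬ dist (a (n, ω)) 0 < ε / c} ∪ {ω | c ≤ |normSum z φ (n, ω)|}) := by
        refine measure_mono fun ω hω => ?_
        by_contra hcon
        simp only [Set.mem_union, Set.mem_ofPred_eq, not_or, not_not, not_le, Real.dist_eq,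
          sub_zero] at hcon hω
        refine hω ?_
        rw [abs_mul]
        calc _ ≤ |a (n, ω)| * c := by gcongr; exact hcon.2.le
          _ < ε / c * c := by gcongr; exact hcon.1
          _ = ε := by field_simp
    _ ≤ _ := measure_union_le _ _
    _ ≤ ENNReal.ofReal (δ' / 2) + ENNReal.ofReal (δ' / 2) :=
        add_le_add hn ((hcheb c hc0 n hn0).trans (ENNReal.ofReal_le_ofReal hc))
    _ = ENNReal.ofReal δ' := by
        rw [← ENNReal.ofReal_add (by positivity) (by positivity), add_halves]

/-- **Central limit theorem** for characteristic functions of normalized sums. -/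
theorem tendsto_charFun_normSum (hz : IsIID P z) (hφ : Measurable φ)
    (hL2 : MemLp (fun ω => φ (z 0 ω)) 2 P) (hmean : ∫ ω, φ (z 0 ω) ∂P = 0) :
    Tendsto (fun n : ℕ => ∫ ω, Complex.exp (normSum z φ (n, ω) * Complex.I) ∂P) atTop
      (𝓝 (Complex.exp (-((∫ ω, φ (z 0 ω) ^ 2 ∂P : ℝ) : ℂ) / 2))) := by
  have hvar : Var[fun ω => φ (z 0 ω); P] = ∫ ω, φ (z 0 ω) ^ 2 ∂P := by
    exact variance_of_integral_eq_zero (hφ.comp (hz.measurable 0)).aemeasurable hmean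
  have h := tendstoInDistribution_inv_sqrt_mul_sum_sub (P := P)
    (P' := gaussianReal 0 (Var[fun ω => φ (z 0 ω); P]).toNNReal) (Y := id)
    (X := fun i ω => φ (z i ω)) HasLaw.id hL2
    (hz.iIndep.comp (fun _ => φ) fun _ => hφ) (fun i => (hz.identDistrib i).comp hφ)
  have h1 := (ProbabilityMeasure.tendsto_iff_tendsto_charFun.1 h.tendsto) 1
  simp only [ProbabilityMeasure.coe_mk, Measure.map_id, charFun_gaussianReal, hvar, hmean] at h1
  convert h1 using 1
  · ext n
    rw [charFun_apply, integral_map]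
    · simp [normSum]
    · exact (by simpa [normSum] using (hz.measurable_normSum hφ n) :
        Measurable fun ω => (√(n : ℝ))⁻¹ * (∑ k ∈ Finset.range n, φ (z k ω) - n * 0)).aemeasurable
    · fun_prop
  · congr 2
    have : 0 ≤ ∫ ω, φ (z 0 ω) ^ 2 ∂P := integral_nonneg fun _ => sq_nonneg _
    simp [Real.coe_toNNReal _ this]
    ring

end IsIID

end IID

/-! ### Central limit theorems for normalized sums -/

section Gram

variable {Ω : Type*} [MeasurableSpace Ω] {P : Measure Ω}

theorem integral_sum_mul_sq {ι : Type*} [Fintype ι] {ψ : ι → Ω → ℝ}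
    (hL2 : ∀ a, MemLp (ψ a) 2 P) {V : Matrix ι ι ℝ} (hV : ∀ a b, V a b = ∫ ω, ψ a ω * ψ b ω ∂P)
    (u : ι → ℝ) : ∫ ω, (∑ a, u a * ψ a ω) ^ 2 ∂P = u ⬝ᵥ V.mulVec u := by
  have hi : ∀ a b, Integrable (fun ω => u a * (u b * (ψ a ω * ψ b ω))) P := fun a b =>
    (((hL2 a).integrable_mul (hL2 b)).const_mul _).const_mul _
  have : ∀ ω, (∑ a, u a * ψ a ω) ^ 2 = ∑ a, ∑ b, u a * (u b * (ψ a ω * ψ b ω)) := by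
    intro ω
    rw [sq, Finset.sum_mul_sum]
    exact Finset.sum_congr rfl fun a _ => Finset.sum_congr rfl fun b _ => by ring
  simp_rw [this]
  rw [integral_finsetSum _ fun a _ => integrable_finsetSum _ fun b _ => hi a b]
  simp only [dotProduct, Matrix.mulVec, Finset.mul_sum]
  refine Finset.sum_congr rfl fun a _ => ?_
  rw [integral_finsetSum _ fun b _ => hi a b]
  refine Finset.sum_congr rfl fun b _ => ?_
  rw [integral_const_mul, integral_const_mul, hV]
  ring

/-- The quadratic form at u is the second moment of the linear combination with coefficients u.
Positivity is what makes V admissible as the covariance matrix of `multivariateGaussian`. -/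
theorem posSemidef_of_integral {ι : Type*} [Fintype ι] {ψ : ι → Ω → ℝ}
    (hL2 : ∀ a, MemLp (ψ a) 2 P) {V : Matrix ι ι ℝ} (hV : ∀ a b, V a b = ∫ ω, ψ a ω * ψ b ω ∂P) :
    V.PosSemidef := by
  rw [Matrix.posSemidef_iff_dotProduct_mulVec]
  refine ⟨?_, fun u => ?_⟩
  · ext a b
    simp [hV, mul_comm]
  · rw [star_trivial, ← integral_sum_mul_sq hL2 hV]
    exact integral_nonneg fun _ => sq_nonneg _

end Gram

namespace IsIID

variable {Ω : Type*} [MeasurableSpace Ω] {E : Type*} [MeasurableSpace E]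
  {P : Measure Ω} [IsProbabilityMeasure P] {z : ℕ → Ω → E}

/-- **Multivariate central limit theorem.** -/
theorem tendstoInDistribution_normSum (hz : IsIID P z) {ι : Type*} [Fintype ι] [DecidableEq ι]
    {ψ : ι → E → ℝ} (hψ : ∀ a, Measurable (ψ a)) (hL2 : ∀ a, MemLp (fun ω => ψ a (z 0 ω)) 2 P)
    (hmean : ∀ a, ∫ ω, ψ a (z 0 ω) ∂P = 0) {V : Matrix ι ι ℝ}
    (hV : ∀ a b, V a b = ∫ ω, ψ a (z 0 ω) * ψ b (z 0 ω) ∂P) :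
    TendstoInDistribution (fun (n : ℕ) ω => WithLp.toLp 2 fun a => normSum z (ψ a) (n, ω)) atTop
      (id : EuclideanSpace ℝ ι → EuclideanSpace ℝ ι) (fun _ => P) (multivariateGaussian 0 V) := by
  have hm : ∀ n : ℕ, Measurable
      fun ω => (WithLp.toLp 2 fun a => normSum z (ψ a) (n, ω) : EuclideanSpace ℝ ι) := fun n =>
    (WithLp.measurable_toLp 2 _).comp (measurable_pi_lambda _ fun a =>
      hz.measurable_normSum (hψ a) n)
  refine ⟨fun n => (hm n).aemeasurable, aemeasurable_id, ?_⟩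
  refine ProbabilityMeasure.tendsto_iff_tendsto_charFun.2 fun u => ?_
  -- The Cramér–Wold device: the characteristic function at u is that of a scalar normalized sum,
  -- evaluated at 1.
  have hu : Measurable fun v => ∑ a, u a * ψ a v :=
    Finset.measurable_sum _ fun a _ => (hψ a).const_mul _
  have hu2 : MemLp (fun ω => ∑ a, u a * ψ a (z 0 ω)) 2 P :=
    memLp_finsetSum _ fun a _ => (hL2 a).const_mul _
  have hu0 : ∫ ω, ∑ a, u a * ψ a (z 0 ω) ∂P = 0 := by
    rw [integral_finsetSum _ fun a _ => ((hL2 a).const_mul _).integrable one_le_two]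
    simp [integral_const_mul, hmean]
  have h := hz.tendsto_charFun_normSum hu hu2 hu0
  rw [integral_sum_mul_sq hL2 hV] at h
  simp only [ProbabilityMeasure.coe_mk, Measure.map_id]
  rw [charFun_multivariateGaussian (posSemidef_of_integral hL2 hV)]
  convert h using 1
  · ext n
    rw [charFun_apply, integral_map (hm n).aemeasurable (by fun_prop)]
    refine integral_congr_ae (ae_of_all _ fun ω => ?_)
    simp only [PiLp.inner_apply]
    rw [normSum_finset_sum]
    simp [normSum_const_mul]
  · simp [neg_div]

variable {φ c c' : E → ℝ}

/-- The limit is a nondegenerate Gaussian law, which has no atom at 0, so small intervals around 0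
have small limiting probability; their boundary is a null set, which allows passing to the limit. -/
theorem eventually_measure_abs_normSum_le (hz : IsIID P z) (hφ : Measurable φ)
    (hL2 : MemLp (fun ω => φ (z 0 ω)) 2 P) (hmean : ∫ ω, φ (z 0 ω) ∂P = 0)
    (hpos : 0 < ∫ ω, φ (z 0 ω) ^ 2 ∂P) {ε : ENNReal} (hε : 0 < ε) :
    ∃ η > 0, ∀ᶠ n : ℕ in atTop, P {ω | |normSum z φ (n, ω)| ≤ η} ≤ ε := by
  have hvar : Var[fun ω => φ (z 0 ω); P] = ∫ ω, φ (z 0 ω) ^ 2 ∂P :=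
    variance_of_integral_eq_zero (hφ.comp (hz.measurable 0)).aemeasurable hmean
  set v := (Var[fun ω => φ (z 0 ω); P]).toNNReal with hv
  have hv0 : v ≠ 0 := by rw [hv, hvar]; exact (Real.toNNReal_pos.mpr hpos).ne'
  have h := tendstoInDistribution_inv_sqrt_mul_sum_sub (P := P)
    (P' := gaussianReal 0 v) (Y := id)
    (X := fun i ω => φ (z i ω)) HasLaw.id hL2
    (hz.iIndep.comp (fun _ => φ) fun _ => hφ) (fun i => (hz.identDistrib i).comp hφ)
  have := nullSingletonClass_gaussianReal (μ := 0) hv0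
  have h0 : Tendsto (fun δ => gaussianReal 0 v (Set.Icc (0 - δ) (0 + δ))) (𝓝[>] 0) (𝓝 0) := by
    simpa using (tendsto_measure_Icc (gaussianReal 0 v) 0).mono_left nhdsWithin_le_nhds
  obtain ⟨η, hη, hη0⟩ := ((h0.eventually (gt_mem_nhds hε)).and self_mem_nhdsWithin).exists
  refine ⟨η, hη0, ?_⟩
  have h1 := ProbabilityMeasure.tendsto_measure_of_null_frontier_of_tendsto' h.tendsto
    (E := Set.Icc (-η) η) (by
      simp only [ProbabilityMeasure.coe_mk, Measure.map_id]
      refine measure_mono_null (t := {-η, η}) ?_ (Set.Countable.measure_zero (by simp) _)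
      rw [frontier_Icc (by have : (0:ℝ) < η := hη0; linarith)])
  simp only [ProbabilityMeasure.coe_mk, Measure.map_id] at h1
  filter_upwards [h1.eventually (gt_mem_nhds (by simpa using hη))] with n hn
  have hm : Measurable fun ω => (√(n : ℝ))⁻¹ *
      (∑ k ∈ Finset.range n, φ (z k ω) - n * ∫ x, φ (z 0 x) ∂P) := by
    simpa [normSum, hmean] using hz.measurable_normSum hφ n
  rw [Measure.map_apply hm measurableSet_Icc] at hn
  refine le_trans (le_of_eq ?_) hn.le
  congr 1
  ext ω
  simp only [normSum, hmean, mul_zero, sub_zero, Set.mem_preimage, Set.mem_Icc,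
    Set.mem_ofPred_eq, abs_le]

/-- A nondegenerate normalized sum stays away from 0 with high probability, hence dominates every
negligible term. This lets a perturbed normalized sum keep its sign. -/
theorem eventually_abs_lt_abs_normSum (hz : IsIID P z) (hφ : Measurable φ)
    (hL2 : MemLp (fun ω => φ (z 0 ω)) 2 P) (hmean : ∫ ω, φ (z 0 ω) ∂P = 0)
    (hpos : 0 < ∫ ω, φ (z 0 ω) ^ 2 ∂P) {R : ℕ × Ω → ℝ} (hR : Tendsto R (probFilter P) (𝓝 0)) :
    ∀ᶠ q in probFilter P, |R q| < |normSum z φ q| := by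
  rw [eventually_probFilter, ENNReal.tendsto_nhds_zero]
  intro ε hε
  have hε2 : 0 < ε / 2 := ENNReal.half_pos hε.ne'
  obtain ⟨η, hη, h1⟩ := hz.eventually_measure_abs_normSum_le hφ hL2 hmean hpos hε2
  have h2 := Metric.tendsto_nhds.mp hR η hη
  rw [eventually_probFilter, ENNReal.tendsto_nhds_zero] at h2
  filter_upwards [h1, h2 _ hε2] with n hn1 hn2
  calc _ ≤ P ({ω | |normSum z φ (n, ω)| ≤ η} ∪ {ω | ¬ dist (R (n, ω)) 0 < η}) := by
        refine measure_mono fun ω hω => ?_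
        by_contra hcon
        simp only [Set.mem_union, Set.mem_ofPred_eq, not_or, not_le, Real.dist_eq,
          sub_zero, not_lt] at hcon hω
        linarith
    _ ≤ _ := measure_union_le _ _
    _ ≤ ε / 2 + ε / 2 := add_le_add hn1 hn2
    _ = ε := ENNReal.add_halves ε

/-- What matters is that the limit depends on φ and c only through the matrix V: two choices of c
with the same V have the same limit. -/
theorem tendsto_integral_mul_exp_normSum (hz : IsIID P z) (hφ : Measurable φ) (hc : Measurable c)
    (hφ2 : MemLp (fun ω => φ (z 0 ω)) 2 P) (hc2 : MemLp (fun ω => c (z 0 ω)) 2 P)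
    (hφ0 : ∫ ω, φ (z 0 ω) ∂P = 0) (hc0 : ∫ ω, c (z 0 ω) ∂P = 0)
    {V : Matrix (Fin 2) (Fin 2) ℝ}
    (hV : V = !![∫ ω, φ (z 0 ω) * φ (z 0 ω) ∂P, ∫ ω, φ (z 0 ω) * c (z 0 ω) ∂P;
      ∫ ω, φ (z 0 ω) * c (z 0 ω) ∂P, ∫ ω, c (z 0 ω) * c (z 0 ω) ∂P])
    {h : ℝ → ℝ} (hh : Continuous h) (hb : ∀ x, |h x| ≤ 1) :
    Tendsto (fun n : ℕ => ∫ ω, (h (normSum z φ (n, ω)) : ℂ) *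
      Complex.exp (normSum z c (n, ω) * Complex.I) ∂P) atTop
      (𝓝 (∫ x : EuclideanSpace ℝ (Fin 2), (h (x 0) : ℂ) * Complex.exp (x 1 * Complex.I)
        ∂(multivariateGaussian 0 V))) := by
  have hψ : ∀ a : Fin 2, Measurable ((![φ, c] : Fin 2 → E → ℝ) a) := by
    intro a; fin_cases a <;> simpa
  have hT := hz.tendstoInDistribution_normSum (ψ := ![φ, c]) hψ
    (by intro a; fin_cases a <;> simpa) (by intro a; fin_cases a <;> simpa) (V := V) (by
      intro a b
      rw [hV]
      fin_cases a <;> fin_cases b <;> simp [mul_comm])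
  have hcont : Continuous fun x : EuclideanSpace ℝ (Fin 2) =>
      (h (x 0) : ℂ) * Complex.exp (x 1 * Complex.I) := by fun_prop
  have hbd : ∀ x : EuclideanSpace ℝ (Fin 2),
      ‖(h (x 0) : ℂ) * Complex.exp (x 1 * Complex.I)‖ ≤ 1 := by
    intro x
    rw [norm_mul, Complex.norm_exp_ofReal_mul_I, mul_one, Complex.norm_real]
    exact hb _
  have h1 := (ProbabilityMeasure.tendsto_iff_forall_integral_rclike_tendsto ℂ).1 hT.tendsto
    (BoundedContinuousFunction.ofNormedAddCommGroup _ hcont 1 hbd)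
  simp only [ProbabilityMeasure.coe_mk, Measure.map_id,
    BoundedContinuousFunction.coe_ofNormedAddCommGroup] at h1
  convert h1 using 1
  ext n
  rw [integral_map (hT.forall_aemeasurable n) hcont.aestronglyMeasurable]
  simp

/-- Switching between two normalized sums according to the sign of a third does not change the
limit law, if the two have the same limit law jointly with the third. -/
theorem tendsto_charFun_switch (hz : IsIID P z) (hφ : Measurable φ) (hc : Measurable c)
    (hc' : Measurable c') (hφ2 : MemLp (fun ω => φ (z 0 ω)) 2 P)
    (hc2 : MemLp (fun ω => c (z 0 ω)) 2 P) (hc2' : MemLp (fun ω => c' (z 0 ω)) 2 P)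
    (hφ0 : ∫ ω, φ (z 0 ω) ∂P = 0) (hc0 : ∫ ω, c (z 0 ω) ∂P = 0) (hc0' : ∫ ω, c' (z 0 ω) ∂P = 0)
    (hpos : 0 < ∫ ω, φ (z 0 ω) ^ 2 ∂P)
    (hcc : ∫ ω, c' (z 0 ω) ^ 2 ∂P = ∫ ω, c (z 0 ω) ^ 2 ∂P)
    (hφc : ∫ ω, φ (z 0 ω) * c' (z 0 ω) ∂P = ∫ ω, φ (z 0 ω) * c (z 0 ω) ∂P) :
    Tendsto (fun n : ℕ => ∫ ω, Complex.exp (((if 0 < normSum z φ (n, ω) then normSum z c (n, ω)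
      else normSum z c' (n, ω) : ℝ) : ℂ) * Complex.I) ∂P) atTop
      (𝓝 (Complex.exp (-((∫ ω, c (z 0 ω) ^ 2 ∂P : ℝ) : ℂ) / 2))) := by
  have hlim := hz.tendsto_charFun_normSum hc' hc2' hc0'
  rw [hcc] at hlim
  have mφ := fun n => hz.measurable_normSum hφ n
  have mc := fun n => hz.measurable_normSum hc n
  have mc' := fun n => hz.measurable_normSum hc' n
  set e : ℝ → ℂ := fun x => Complex.exp (x * Complex.I) with he
  have hem : Measurable e := by fun_prop
  have hen : ∀ x, ‖e x‖ = 1 := fun x => Complex.norm_exp_ofReal_mul_I x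
  -- Since the limit with c' alone is known, it is enough that E[1{S > 0}(exp(i c) − exp(i c'))]
  -- tends to 0, where S, c and c' stand for the normalized sums. The indicator is replaced by a
  -- continuous function of S.
  have key : ∀ ε : ℝ, 0 < ε → ∀ᶠ n : ℕ in atTop,
      ‖∫ ω, (e (if 0 < normSum z φ (n, ω) then normSum z c (n, ω) else normSum z c' (n, ω))
        - e (normSum z c' (n, ω))) ∂P‖ < ε := by
    intro ε hε
    obtain ⟨η, hη, hsmall⟩ := hz.eventually_measure_abs_normSum_le hφ hφ2 hφ0 hpos
      (ε := ENNReal.ofReal (ε / 8)) (by simpa using hε)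
    -- A ramp that differs from the indicator of x > 0 only where |x| ≤ η. The replacement costs at
    -- most 2 P(|S| ≤ η), eventually at most ε/4.
    set h : ℝ → ℝ := fun x => max 0 (min 1 (x / η)) with hh
    have hcont : Continuous h := by fun_prop
    have h01 : ∀ x, 0 ≤ h x ∧ h x ≤ 1 := fun x =>
      ⟨le_max_left _ _, max_le zero_le_one (min_le_left _ _)⟩
    have hb : ∀ x, |h x| ≤ 1 := fun x => by rw [abs_of_nonneg (h01 x).1]; exact (h01 x).2
    have hind : ∀ x, |(if 0 < x then 1 else 0) - h x| ≤ if |x| ≤ η then 1 else 0 := by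
      intro x
      by_cases hx : |x| ≤ η
      · rw [if_pos hx, abs_le]
        have := h01 x
        split_ifs <;> constructor <;> linarith
      · rw [if_neg hx]
        push Not at hx
        rcases lt_abs.mp hx with h1 | h1
        · have h2 : 1 ≤ x / η := by rw [le_div_iff₀ hη]; linarith
          simp [hh, (hη.trans h1), min_eq_left h2]
        · have h2 : x / η ≤ 0 := div_nonpos_of_nonpos_of_nonneg (by linarith) hη.le
          have h3 : ¬ 0 < x := by linarith
          simp [hh, h3, min_eq_right (h2.trans zero_le_one), max_eq_left h2]
    have t1 := hz.tendsto_integral_mul_exp_normSum hφ hc hφ2 hc2 hφ0 hc0 rfl hcont hb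
    have t2 := hz.tendsto_integral_mul_exp_normSum hφ hc' hφ2 hc2' hφ0 hc0' rfl hcont hb
    rw [hφc] at t2
    simp only [sq] at hcc
    rw [hcc] at t2
    -- The two limits coincide because the covariance matrices of (φ, c) and (φ, c') do.
    have t3 := t1.sub t2
    rw [sub_self] at t3
    filter_upwards [hsmall, Metric.tendsto_nhds.mp t3 (ε / 2) (by positivity)] with n hn1 hn2
    rw [dist_zero_right] at hn2
    have i1 : Integrable (fun ω => (h (normSum z φ (n, ω)) : ℂ) * e (normSum z c (n, ω))) P := by
      refine Integrable.of_bound (C := 1) (by have := mφ n; have := mc n; fun_prop)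
        (ae_of_all _ fun ω => ?_)
      rw [norm_mul, hen, mul_one, Complex.norm_real]; exact hb _
    have i2 : Integrable (fun ω => (h (normSum z φ (n, ω)) : ℂ) * e (normSum z c' (n, ω))) P := by
      refine Integrable.of_bound (C := 1) (by have := mφ n; have := mc' n; fun_prop)
        (ae_of_all _ fun ω => ?_)
      rw [norm_mul, hen, mul_one, Complex.norm_real]; exact hb _
    have ms : Measurable fun ω =>
        if 0 < normSum z φ (n, ω) then normSum z c (n, ω) else normSum z c' (n, ω) :=
      Measurable.ite (measurableSet_lt measurable_const (mφ n)) (mc n) (mc' n)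
    have i3 : Integrable (fun ω => e (if 0 < normSum z φ (n, ω) then normSum z c (n, ω)
        else normSum z c' (n, ω)) - e (normSum z c' (n, ω))) P := by
      refine Integrable.sub ?_ ?_
      · exact Integrable.of_bound (C := 1) (hem.comp ms).aestronglyMeasurable
          (ae_of_all _ fun ω => (hen _).le)
      · exact Integrable.of_bound (C := 1) (hem.comp (mc' n)).aestronglyMeasurable
          (ae_of_all _ fun ω => (hen _).le)
    rw [← integral_sub i1 i2] at hn2
    have hdiff : ‖∫ ω, ((e (if 0 < normSum z φ (n, ω) then normSum z c (n, ω)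
        else normSum z c' (n, ω)) - e (normSum z c' (n, ω))) -
        ((h (normSum z φ (n, ω)) : ℂ) * e (normSum z c (n, ω)) -
          (h (normSum z φ (n, ω)) : ℂ) * e (normSum z c' (n, ω)))) ∂P‖ ≤ 2 * (ε / 8) := by
      have hms : MeasurableSet {ω | |normSum z φ (n, ω)| ≤ η} :=
        measurableSet_le (mφ n).abs measurable_const
      calc _ ≤ ∫ ω, Set.indicator {ω | |normSum z φ (n, ω)| ≤ η} (fun _ => (2 : ℝ)) ω ∂P := by
            refine norm_integral_le_of_norm_le ((integrable_const _).indicator hms)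
              (ae_of_all _ fun ω => ?_)
            have : (e (if 0 < normSum z φ (n, ω) then normSum z c (n, ω)
              else normSum z c' (n, ω)) - e (normSum z c' (n, ω))) -
              ((h (normSum z φ (n, ω)) : ℂ) * e (normSum z c (n, ω)) -
              (h (normSum z φ (n, ω)) : ℂ) * e (normSum z c' (n, ω))) =
              (((if 0 < normSum z φ (n, ω) then 1 else 0) - h (normSum z φ (n, ω)) : ℝ) : ℂ) *
                (e (normSum z c (n, ω)) - e (normSum z c' (n, ω))) := by
              split_ifs <;> push_cast <;> ring
            rw [this, norm_mul, Complex.norm_real, Real.norm_eq_abs]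
            have h2 : ‖e (normSum z c (n, ω)) - e (normSum z c' (n, ω))‖ ≤ 2 := by
              refine (norm_sub_le _ _).trans ?_
              rw [hen, hen]; norm_num
            calc _ ≤ (if |normSum z φ (n, ω)| ≤ η then 1 else 0) * 2 :=
                  mul_le_mul (hind _) h2 (norm_nonneg _) (by split_ifs <;> norm_num)
              _ = _ := by
                simp only [Set.indicator_apply, Set.mem_ofPred_eq]
                split_ifs <;> norm_num
        _ = 2 * (P {ω | |normSum z φ (n, ω)| ≤ η}).toReal := by
            rw [integral_indicator_const _ hms, smul_eq_mul, mul_comm]; rfl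
        _ ≤ 2 * (ε / 8) := by
            gcongr
            exact ENNReal.toReal_le_of_le_ofReal (by positivity) hn1
    have i12 : Integrable (fun ω => (h (normSum z φ (n, ω)) : ℂ) * e (normSum z c (n, ω)) -
        (h (normSum z φ (n, ω)) : ℂ) * e (normSum z c' (n, ω))) P := i1.sub i2
    rw [integral_sub i3 i12] at hdiff
    have := norm_sub_norm_le (∫ ω, (e (if 0 < normSum z φ (n, ω) then normSum z c (n, ω)
        else normSum z c' (n, ω)) - e (normSum z c' (n, ω))) ∂P)
      (∫ ω, ((h (normSum z φ (n, ω)) : ℂ) * e (normSum z c (n, ω)) -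
          (h (normSum z φ (n, ω)) : ℂ) * e (normSum z c' (n, ω))) ∂P)
    linarith
  have h0 : Tendsto (fun n : ℕ => ∫ ω, (e (if 0 < normSum z φ (n, ω) then normSum z c (n, ω)
      else normSum z c' (n, ω)) - e (normSum z c' (n, ω))) ∂P) atTop (𝓝 0) := by
    rw [Metric.tendsto_nhds]
    intro ε hε
    simpa using key ε hε
  have h1 := h0.add hlim
  rw [zero_add] at h1
  refine h1.congr fun n => ?_
  rw [integral_sub]
  · simp [he]
  · exact Integrable.of_bound (C := 1) (hem.comp (Measurable.ite
      (measurableSet_lt measurable_const (mφ n)) (mc n) (mc' n))).aestronglyMeasurable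
      (ae_of_all _ fun ω => (hen _).le)
  · exact Integrable.of_bound (C := 1) (hem.comp (mc' n)).aestronglyMeasurable
      (ae_of_all _ fun ω => (hen _).le)

end IsIID

/-! ### A uniform law of large numbers under small perturbations of the argument -/

section Oscillation

/-- The oscillation of `f` at distance at most `ρ` from a point. -/
noncomputable def osc (f : ℝ → ℝ) (ρ x : ℝ) : ℝ :=
  sSup ((fun t => |f (x + t) - f x|) '' Set.Icc (-ρ) ρ)

/-- The supremum of `|f|` at distance at most `ρ` from a point. -/
noncomputable def localSup (f : ℝ → ℝ) (ρ x : ℝ) : ℝ :=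
  sSup ((fun t => |f (x + t)|) '' Set.Icc (-ρ) ρ)

variable {f : ℝ → ℝ} {ρ : ℝ}

theorem continuous_osc (hf : Continuous f) (ρ : ℝ) : Continuous (osc f ρ) :=
  isCompact_Icc.continuous_sSup (by fun_prop)

theorem continuous_localSup (hf : Continuous f) (ρ : ℝ) : Continuous (localSup f ρ) :=
  isCompact_Icc.continuous_sSup (by fun_prop)

theorem abs_sub_le_osc (hf : Continuous f) (x : ℝ) {t : ℝ} (ht : |t| ≤ ρ) :
    |f (x + t) - f x| ≤ osc f ρ x :=
  le_csSup (isCompact_Icc.image (by fun_prop)).bddAbove ⟨t, abs_le.mp ht, rfl⟩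

theorem abs_le_localSup (hf : Continuous f) (x : ℝ) {t : ℝ} (ht : |t| ≤ ρ) :
    |f (x + t)| ≤ localSup f ρ x :=
  le_csSup (isCompact_Icc.image (by fun_prop)).bddAbove ⟨t, abs_le.mp ht, rfl⟩

theorem osc_le (hρ : 0 ≤ ρ) {x c : ℝ} (h : ∀ t, |t| ≤ ρ → |f (x + t) - f x| ≤ c) :
    osc f ρ x ≤ c := by
  refine csSup_le ((Set.nonempty_Icc.mpr (by linarith)).image _) ?_
  rintro _ ⟨t, ht, rfl⟩
  exact h t (abs_le.mpr ht)

theorem localSup_le (hρ : 0 ≤ ρ) {x c : ℝ} (h : ∀ t, |t| ≤ ρ → |f (x + t)| ≤ c) :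
    localSup f ρ x ≤ c := by
  refine csSup_le ((Set.nonempty_Icc.mpr (by linarith)).image _) ?_
  rintro _ ⟨t, ht, rfl⟩
  exact h t (abs_le.mpr ht)

theorem osc_nonneg (hf : Continuous f) (hρ : 0 ≤ ρ) (x : ℝ) : 0 ≤ osc f ρ x :=
  (abs_nonneg _).trans (abs_sub_le_osc hf x (t := 0) (by simpa))

theorem localSup_nonneg (hf : Continuous f) (hρ : 0 ≤ ρ) (x : ℝ) : 0 ≤ localSup f ρ x :=
  (abs_nonneg _).trans (abs_le_localSup hf x (t := 0) (by simpa))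

theorem tendsto_osc (hf : Continuous f) (x : ℝ) :
    Tendsto (fun ρ => osc f ρ x) (𝓝[>] 0) (𝓝 0) := by
  rw [Metric.tendsto_nhds]
  intro ε hε
  obtain ⟨δ, hδ, h⟩ := Metric.continuousAt_iff.mp (hf.continuousAt (x := x)) (ε / 2) (half_pos hε)
  filter_upwards [self_mem_nhdsWithin, nhdsWithin_le_nhds (gt_mem_nhds hδ)] with ρ h0 hρ
  have h0' : (0 : ℝ) < ρ := h0
  rw [Real.dist_eq, sub_zero, abs_of_nonneg (osc_nonneg hf h0'.le x)]
  refine (osc_le h0'.le fun t ht => ?_).trans_lt (half_lt_self hε)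
  have := @h (x + t) (by rw [Real.dist_eq]; simpa using ht.trans_lt hρ)
  exact le_of_lt (by simpa [Real.dist_eq] using this)

end Oscillation

section UniformLaw

variable {Ω : Type*} [MeasurableSpace Ω] {P : Measure Ω} {p : ℕ} {z : ℕ → Ω → Fin p → ℝ}

/-- Dominated convergence: the oscillation of a continuous function at a point tends to 0 with the
radius, and it is at most 2F. -/
theorem tendsto_integral_osc {f F : ℝ → ℝ} (hf : Continuous f) {ε : ℝ} (hε : 0 < ε)
    (hF : ∀ x t, |t| ≤ ε → |f (x + t)| ≤ F x) {Z M : Ω → ℝ} (hZ : Measurable Z)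
    (hM : Measurable M) (hint : Integrable (fun ω => F (Z ω) * |M ω|) P) :
    Tendsto (fun ρ => ∫ ω, osc f ρ (Z ω) * |M ω| ∂P) (𝓝[>] 0) (𝓝 0) := by
  suffices h : Tendsto (fun ρ => ∫ ω, osc f ρ (Z ω) * |M ω| ∂P) (𝓝[>] 0) (𝓝 (∫ _, (0 : ℝ) ∂P)) by
    simpa using h
  refine tendsto_integral_filter_of_dominated_convergence (fun ω => 2 * (F (Z ω) * |M ω|)) ?_ ?_
    (hint.const_mul 2) ?_
  · exact Eventually.of_forall fun ρ =>
      (((continuous_osc hf ρ).measurable.comp hZ).mul hM.abs).aestronglyMeasurable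
  · filter_upwards [self_mem_nhdsWithin, nhdsWithin_le_nhds (gt_mem_nhds hε)] with ρ hρ0 hρ
    have hρ0' : (0 : ℝ) < ρ := hρ0
    refine ae_of_all _ fun ω => ?_
    rw [Real.norm_eq_abs, abs_mul, abs_abs, abs_of_nonneg (osc_nonneg hf hρ0'.le _), ← mul_assoc]
    gcongr
    refine osc_le hρ0'.le fun t ht => (abs_sub _ _).trans ?_
    have h1 := hF (Z ω) t (ht.trans hρ.le)
    have h2 := hF (Z ω) 0 (by simpa using hε.le)
    rw [add_zero] at h2
    linarith
  · refine ae_of_all _ fun ω => ?_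
    simpa using (tendsto_osc hf (Z ω)).mul_const |M ω|

/-- The mean of the first `n` terms of a sequence of random vectors. -/
noncomputable def zbar (z : ℕ → Ω → Fin p → ℝ) (q : ℕ × Ω) : Fin p → ℝ :=
  fun a => avg z (fun v => v a) q

/-- Uniform law of large numbers for averages of `f (zⱼ + d) m (z - z̄)` over small `d`. -/
theorem IsIID.uniform_avg [IsProbabilityMeasure P] (hz : IsIID P z) (hbar : Tendsto (zbar z) (probFilter P) (𝓝 0))
    {f F : ℝ → ℝ} (hf : Continuous f) (hFm : Measurable F) {ε : ℝ} (hε : 0 < ε)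
    (hF : ∀ x t, |t| ≤ ε → |f (x + t)| ≤ F x) (j : Fin p)
    {m k : (Fin p → ℝ) → ℝ} (hm : Measurable m) (hk : Measurable k)
    (hmk : ∀ v c, ‖c‖ ≤ 1 → |m (v - c) - m v| ≤ ‖c‖ * k v)
    (hint : Integrable (fun ω => F (z 0 ω j) * |m (z 0 ω)|) P)
    (hintk : Integrable (fun ω => F (z 0 ω j) * k (z 0 ω)) P) {η : ℝ} (hη : 0 < η) :
    ∃ ρ > 0, ∀ᶠ q in probFilter P, ∀ d : ℕ → ℝ, (∀ i < q.1, |d i| ≤ ρ) →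
      |(q.1 : ℝ)⁻¹ * ∑ i ∈ Finset.range q.1, f (z i q.2 j + d i) * m (z i q.2 - zbar z q) -
        ∫ ω, f (z 0 ω j) * m (z 0 ω) ∂P| ≤ η := by
  have hZ : Measurable fun ω => z 0 ω j := (measurable_pi_apply j).comp (hz.measurable 0)
  have hM : Measurable fun ω => m (z 0 ω) := hm.comp (hz.measurable 0)
  have hj : Measurable fun v : Fin p → ℝ => v j := measurable_pi_apply j
  have hosc := tendsto_integral_osc hf hε hF hZ hM hint
  -- The three thirds of η pay for the oscillation of f, the law of large numbers for f(z_j) m(z),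
  -- and the centring by the sample mean.
  obtain ⟨ρ, ⟨h1, h2⟩, h3⟩ := (((hosc.eventually (gt_mem_nhds (by positivity : 0 < η / 3))).and
    (nhdsWithin_le_nhds (gt_mem_nhds hε))).and self_mem_nhdsWithin).exists
  have hρ0 : (0 : ℝ) < ρ := h3
  refine ⟨ρ, hρ0, ?_⟩
  have hF0 : ∀ x, |f x| ≤ F x := fun x => by simpa using hF x 0 (by simpa using hε.le)
  have hFnn : ∀ x, 0 ≤ F x := fun x => (abs_nonneg _).trans (hF0 x)
  have hoscm : Measurable (osc f ρ) := (continuous_osc hf ρ).measurable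
  have iosc : Integrable (fun ω => osc f ρ (z 0 ω j) * |m (z 0 ω)|) P := by
    refine (hint.const_mul 2).mono' ((hoscm.comp hZ).mul hM.abs).aestronglyMeasurable
      (ae_of_all _ fun ω => ?_)
    rw [Real.norm_eq_abs, abs_mul, abs_abs, abs_of_nonneg (osc_nonneg hf hρ0.le _), ← mul_assoc]
    gcongr
    refine osc_le hρ0.le fun t ht => (abs_sub _ _).trans ?_
    have h1 := hF (z 0 ω j) t (ht.trans h2.le)
    have h2 := hF0 (z 0 ω j)
    linarith
  have ifm : Integrable (fun ω => f (z 0 ω j) * m (z 0 ω)) P := by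
    refine hint.mono' ((hf.measurable.comp hZ).mul hM).aestronglyMeasurable (ae_of_all _ fun ω => ?_)
    rw [Real.norm_eq_abs, abs_mul]
    gcongr
    exact hF0 _
  have e1 := hz.eventually_avg_le (φ := fun v => osc f ρ (v j) * |m v|)
    ((hoscm.comp hj).mul hm.abs) iosc h1
  have e2 := Metric.tendsto_nhds.mp (hz.tendsto_avg (φ := fun v => f (v j) * m v)
    ((hf.measurable.comp hj).mul hm) ifm) (η / 3) (by positivity)
  have hnb : Tendsto (fun q => ‖zbar z q‖) (probFilter P) (𝓝 0) := by simpa using hbar.norm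
  have e3 : Tendsto (fun q => ‖zbar z q‖ * avg z (fun v => F (v j) * k v) q) (probFilter P)
      (𝓝 0) := by
    simpa using hnb.mul (hz.tendsto_avg (φ := fun v => F (v j) * k v)
      ((hFm.comp hj).mul hk) hintk)
  filter_upwards [e1, e2, e3.eventually (gt_mem_nhds (by positivity : 0 < η / 3)),
    hnb.eventually (gt_mem_nhds one_pos)] with q g1 g2 g3 g4 d hd
  rw [Real.dist_eq] at g2
  -- The bound does not involve d beyond |d i| ≤ ρ. The perturbation may therefore be chosen after
  -- the sample, which gives uniformity without an entropy argument.
  have key : |(q.1 : ℝ)⁻¹ * ∑ i ∈ Finset.range q.1, f (z i q.2 j + d i) * m (z i q.2 - zbar z q) -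
      avg z (fun v => f (v j) * m v) q| ≤ ‖zbar z q‖ * avg z (fun v => F (v j) * k v) q +
        avg z (fun v => osc f ρ (v j) * |m v|) q := by
    simp only [avg]
    rw [← mul_sub, ← Finset.sum_sub_distrib, mul_left_comm ‖zbar z q‖, ← mul_add,
      Finset.mul_sum (a := ‖zbar z q‖), ← Finset.sum_add_distrib, abs_mul,
      abs_of_nonneg (by positivity : (0 : ℝ) ≤ (q.1 : ℝ)⁻¹)]
    gcongr
    refine (Finset.abs_sum_le_sum_abs _ _).trans (Finset.sum_le_sum fun i hi => ?_)
    have hdi := hd i (Finset.mem_range.mp hi)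
    have a1 := hmk (z i q.2) (zbar z q) g4.le
    have a2 := abs_sub_le_osc hf (z i q.2 j) hdi
    have a3 := hF (z i q.2 j) (d i) (hdi.trans h2.le)
    calc _ = |f (z i q.2 j + d i) * (m (z i q.2 - zbar z q) - m (z i q.2)) +
          (f (z i q.2 j + d i) - f (z i q.2 j)) * m (z i q.2)| := by congr 1; ring
      _ ≤ |f (z i q.2 j + d i)| * |m (z i q.2 - zbar z q) - m (z i q.2)| +
          |f (z i q.2 j + d i) - f (z i q.2 j)| * |m (z i q.2)| := by
        refine (abs_add_le _ _).trans ?_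
        rw [abs_mul, abs_mul]
      _ ≤ F (z i q.2 j) * (‖zbar z q‖ * k (z i q.2)) + osc f ρ (z i q.2 j) * |m (z i q.2)| := by
        gcongr
        exact hFnn _
      _ = _ := by ring
  have := abs_sub_le ((q.1 : ℝ)⁻¹ * ∑ i ∈ Finset.range q.1,
    f (z i q.2 j + d i) * m (z i q.2 - zbar z q)) (avg z (fun v => f (v j) * m v) q)
    (∫ ω, f (z 0 ω j) * m (z 0 ω) ∂P)
  linarith

end UniformLaw

/-! ### Strict derivatives along a filter -/

section StrictDeriv

variable {α M : Type*} [NormedAddCommGroup M] [NormedSpace ℝ M]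

/-- Along the filter `l`, the functions `F a` have the value `v` at `x₀` and the strict derivative
`A` on the balls of radius `r a` around `x₀`, up to negligible terms. -/
structure StrictDerivAlong (l : Filter α) (r : α → ℝ) (x₀ : M) (F : α → M → ℝ) (A : M →L[ℝ] ℝ)
    (v : ℝ) : Prop where
  tendsto : Tendsto (fun a => F a x₀) l (𝓝 v)
  approx : ∀ η > 0, ∀ᶠ a in l, ∀ x ∈ Metric.closedBall x₀ (r a), ∀ y ∈ Metric.closedBall x₀ (r a),
    |F a x - F a y - A (x - y)| ≤ η * ‖x - y‖

namespace StrictDerivAlong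

variable {l : Filter α} {r : α → ℝ} {x₀ : M} {F F' : α → M → ℝ} {A A' : M →L[ℝ] ℝ} {v v' : ℝ}

theorem congr_clm (h : StrictDerivAlong l r x₀ F A v) (hA : ∀ x, A x = A' x) (hv : v = v') :
    StrictDerivAlong l r x₀ F A' v' := by
  have : A = A' := ContinuousLinearMap.ext hA
  rwa [← this, ← hv]

theorem of_const {c : α → ℝ} (hc : Tendsto c l (𝓝 v)) :
    StrictDerivAlong l r x₀ (fun a _ => c a) 0 v :=
  ⟨hc, fun η hη => Eventually.of_forall fun a x _ y _ => by simp; positivity⟩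

theorem of_clm (A : M →L[ℝ] ℝ) : StrictDerivAlong l r x₀ (fun _ x => A x) A (A x₀) :=
  ⟨tendsto_const_nhds, fun η hη => Eventually.of_forall fun a x _ y _ => by simp; positivity⟩

theorem add (h : StrictDerivAlong l r x₀ F A v) (h' : StrictDerivAlong l r x₀ F' A' v') :
    StrictDerivAlong l r x₀ (fun a x => F a x + F' a x) (A + A') (v + v') := by
  refine ⟨h.tendsto.add h'.tendsto, fun η hη => ?_⟩
  filter_upwards [h.approx (η / 2) (by positivity), h'.approx (η / 2) (by positivity)]
    with a h1 h2 x hx y hy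
  calc _ = |(F a x - F a y - A (x - y)) + (F' a x - F' a y - A' (x - y))| := by
        congr 1; simp only [add_apply]; ring
    _ ≤ η / 2 * ‖x - y‖ + η / 2 * ‖x - y‖ :=
        (abs_add_le _ _).trans (add_le_add (h1 x hx y hy) (h2 x hx y hy))
    _ = _ := by ring

theorem const_mul (c : ℝ) (h : StrictDerivAlong l r x₀ F A v) :
    StrictDerivAlong l r x₀ (fun a x => c * F a x) (c • A) (c * v) := by
  refine ⟨h.tendsto.const_mul c, fun η hη => ?_⟩
  filter_upwards [h.approx (η / (|c| + 1)) (by positivity)] with a h1 x hx y hy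
  calc _ = |c| * |F a x - F a y - A (x - y)| := by
        rw [← abs_mul]; congr 1; simp only [smul_apply, smul_eq_mul]; ring
    _ ≤ (|c| + 1) * (η / (|c| + 1) * ‖x - y‖) := by
        gcongr
        · linarith
        · exact h1 x hx y hy
    _ = _ := by field_simp

theorem sub (h : StrictDerivAlong l r x₀ F A v) (h' : StrictDerivAlong l r x₀ F' A' v') :
    StrictDerivAlong l r x₀ (fun a x => F a x - F' a x) (A - A') (v - v') := by
  have h2 := h.add (h'.const_mul (-1))
  simp only [neg_mul, one_mul, ← sub_eq_add_neg] at h2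
  exact h2.congr_clm (fun x => by simp [sub_eq_add_neg]) rfl

theorem sum {ι : Type*} (s : Finset ι) {F : ι → α → M → ℝ} {A : ι → M →L[ℝ] ℝ} {v : ι → ℝ}
    (h : ∀ i ∈ s, StrictDerivAlong l r x₀ (F i) (A i) (v i)) :
    StrictDerivAlong l r x₀ (fun a x => ∑ i ∈ s, F i a x) (∑ i ∈ s, A i) (∑ i ∈ s, v i) := by
  classical
  induction s using Finset.induction_on with
  | empty => simpa using of_const (tendsto_const_nhds (x := (0 : ℝ)))
  | insert i s hi ih =>
    simp only [Finset.sum_insert hi]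
    exact (h i (by simp)).add (ih fun k hk => h k (by simp [hk]))

theorem lipschitz (h : StrictDerivAlong l r x₀ F A v) :
    ∀ᶠ a in l, ∀ x ∈ Metric.closedBall x₀ (r a), ∀ y ∈ Metric.closedBall x₀ (r a),
      |F a x - F a y| ≤ (‖A‖ + 1) * ‖x - y‖ := by
  filter_upwards [h.approx 1 one_pos] with a h1 x hx y hy
  have h2 := A.le_opNorm (x - y)
  rw [Real.norm_eq_abs] at h2
  calc _ = |(F a x - F a y - A (x - y)) + A (x - y)| := by congr 1; ring
    _ ≤ 1 * ‖x - y‖ + ‖A‖ * ‖x - y‖ := (abs_add_le _ _).trans (add_le_add (h1 x hx y hy) h2)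
    _ = _ := by ring

/-- The oscillation over the ball is at most a constant times its radius, which tends to 0. -/
theorem uniform (h : StrictDerivAlong l r x₀ F A v) (hr : Tendsto r l (𝓝 0))
    (hr0 : ∀ a, 0 ≤ r a) {η : ℝ} (hη : 0 < η) :
    ∀ᶠ a in l, ∀ x ∈ Metric.closedBall x₀ (r a), |F a x - v| ≤ η := by
  have h1 : Tendsto (fun a => (‖A‖ + 1) * r a + |F a x₀ - v|) l (𝓝 0) := by
    have := (tendsto_iff_dist_tendsto_zero.mp h.tendsto)
    simpa [Real.dist_eq] using (hr.const_mul (‖A‖ + 1)).add this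
  filter_upwards [h.lipschitz, h1.eventually (gt_mem_nhds hη)] with a h2 h3 x hx
  have h4 := h2 x hx x₀ (Metric.mem_closedBall_self (hr0 a))
  have h5 : ‖x - x₀‖ ≤ r a := by simpa [dist_eq_norm] using hx
  calc |F a x - v| ≤ |F a x - F a x₀| + |F a x₀ - v| := abs_sub_le _ _ _
    _ ≤ (‖A‖ + 1) * r a + |F a x₀ - v| := by gcongr; exact h4.trans (by gcongr)
    _ ≤ η := h3.le

/-- The product rule. Besides v and v' times the two linearization errors, the remainder contains (F
x − v)(F' x − F' y) and (F' y − v')(F x − F y); in these the first factor is uniformly small and the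
second is Lipschitz. -/
theorem mul (h : StrictDerivAlong l r x₀ F A v) (h' : StrictDerivAlong l r x₀ F' A' v')
    (hr : Tendsto r l (𝓝 0)) (hr0 : ∀ a, 0 ≤ r a) :
    StrictDerivAlong l r x₀ (fun a x => F a x * F' a x) (v • A' + v' • A) (v * v') := by
  refine ⟨h.tendsto.mul h'.tendsto, fun η hη => ?_⟩
  set C := ‖A‖ + ‖A'‖ + |v| + |v'| + 4 with hC
  have hCpos : 0 < C := by positivity
  have hδ : 0 < min 1 (η / (4 * C)) := by positivity
  filter_upwards [h.approx _ hδ, h'.approx _ hδ, h.uniform hr hr0 hδ, h'.uniform hr hr0 hδ,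
    h.lipschitz, h'.lipschitz] with a a1 a2 u1 u2 l1 l2 x hx y hy
  have hδ1 : min 1 (η / (4 * C)) ≤ η / (4 * C) := min_le_right _ _
  have b1 := a1 x hx y hy
  have b2 := a2 x hx y hy
  have c1 := u1 x hx
  have c2 := u2 y hy
  have d1 := l1 x hx y hy
  have d2 := l2 x hx y hy
  set N := ‖x - y‖ with hN
  have hN0 : 0 ≤ N := norm_nonneg _
  have id : F a x * F' a x - F a y * F' a y - (v • A' + v' • A) (x - y) =
      (F a x - v) * (F' a x - F' a y) + (F' a y - v') * (F a x - F a y) +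
      v * (F' a x - F' a y - A' (x - y)) + v' * (F a x - F a y - A (x - y)) := by
    simp only [add_apply, smul_apply, smul_eq_mul]
    ring
  rw [id]
  have hA := norm_nonneg A
  have hA' := norm_nonneg A'
  have hv := abs_nonneg v
  have hv' := abs_nonneg v'
  have t1 : |(F a x - v) * (F' a x - F' a y)| ≤ η / (4 * C) * (C * N) := by
    rw [abs_mul]
    exact mul_le_mul (c1.trans hδ1) (d2.trans (by gcongr; linarith)) (abs_nonneg _) (by positivity)
  have t2 : |(F' a y - v') * (F a x - F a y)| ≤ η / (4 * C) * (C * N) := by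
    rw [abs_mul]
    exact mul_le_mul (c2.trans hδ1) (d1.trans (by gcongr; linarith)) (abs_nonneg _) (by positivity)
  have t3 : |v * (F' a x - F' a y - A' (x - y))| ≤ C * (η / (4 * C) * N) := by
    rw [abs_mul]
    exact mul_le_mul (by linarith) (b2.trans (by gcongr)) (abs_nonneg _) hCpos.le
  have t4 : |v' * (F a x - F a y - A (x - y))| ≤ C * (η / (4 * C) * N) := by
    rw [abs_mul]
    exact mul_le_mul (by linarith) (b1.trans (by gcongr)) (abs_nonneg _) hCpos.le
  calc _ ≤ _ := (abs_add_le _ _).trans (add_le_add ((abs_add_le _ _).trans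
        (add_le_add (abs_add_le _ _) le_rfl)) le_rfl)
    _ ≤ η / (4 * C) * (C * N) + η / (4 * C) * (C * N) + C * (η / (4 * C) * N) +
        C * (η / (4 * C) * N) := by linarith
    _ = η * N := by field_simp; ring

end StrictDerivAlong

end StrictDeriv

/-! ### The fixed point of a simplified Newton iteration -/

section Newton

variable {M : Type*} [NormedAddCommGroup M] [CompleteSpace M]

/-- The map y ↦ y − Φ y is η-Lipschitz on the ball and, by the bound on Φ x₀, maps the ball to
itself, so Banach's theorem applies. The solution is exhibited as the limit of the iterates from x₀
in order to obtain a measurable choice later. The last clause is the comparison of Φ at the fixed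
point and at x₀, with ‖x − x₀‖ ≤ 2‖Φ x₀‖. -/
theorem exists_limit_newton {Φ : M → M} {x₀ : M} {r η : ℝ} (hη0 : 0 < η) (hη : η ≤ 1 / 2)
    (hr : 0 ≤ r)
    (hΦ : ∀ x ∈ Metric.closedBall x₀ r, ∀ y ∈ Metric.closedBall x₀ r,
      ‖Φ x - Φ y - (x - y)‖ ≤ η * ‖x - y‖) (h0 : ‖Φ x₀‖ ≤ r / 2) :
    ∃ x ∈ Metric.closedBall x₀ r, Φ x = 0 ∧
      Tendsto (fun k => (fun y => y - Φ y)^[k] x₀) atTop (𝓝 x) ∧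
      ‖x - x₀ + Φ x₀‖ ≤ 2 * η * ‖Φ x₀‖ := by
  set N : M → M := fun y => y - Φ y with hN
  have hx0 : x₀ ∈ Metric.closedBall x₀ r := Metric.mem_closedBall_self hr
  have hlip : ∀ x ∈ Metric.closedBall x₀ r, ∀ y ∈ Metric.closedBall x₀ r,
      ‖N x - N y‖ ≤ η * ‖x - y‖ := by
    intro x hx y hy
    have : N x - N y = -(Φ x - Φ y - (x - y)) := by simp only [hN]; abel
    rw [this, norm_neg]
    exact hΦ x hx y hy
  have hmaps : Set.MapsTo N (Metric.closedBall x₀ r) (Metric.closedBall x₀ r) := by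
    intro x hx
    have h1 := hlip x hx x₀ hx0
    have h2 : ‖x - x₀‖ ≤ r := by simpa [dist_eq_norm] using hx
    rw [mem_closedBall_iff_norm]
    calc ‖N x - x₀‖ = ‖(N x - N x₀) + (-Φ x₀)‖ := by congr 1; simp only [hN]; abel
      _ ≤ η * ‖x - x₀‖ + ‖Φ x₀‖ := (norm_add_le _ _).trans (by rw [norm_neg]; gcongr)
      _ ≤ 1 / 2 * r + r / 2 := by gcongr
      _ = r := by ring
  have hcontr : ContractingWith ⟨η, hη0.le⟩ (hmaps.restrict N _ _) := by
    refine ⟨?_, LipschitzWith.of_dist_le_mul fun x y => ?_⟩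
    · change η < 1
      linarith
    · simp only [Subtype.dist_eq, dist_eq_norm]
      exact hlip x x.2 y y.2
  obtain ⟨x, hx, hfix, hlim, -⟩ := hcontr.exists_fixedPoint'
    (Metric.isClosed_closedBall.isComplete) hmaps hx0 (edist_ne_top _ _)
  have hΦx : Φ x = 0 := by
    have : x - Φ x = x := hfix
    simpa using this
  refine ⟨x, hx, hΦx, hlim, ?_⟩
  have h1 : ‖x - x₀ + Φ x₀‖ ≤ η * ‖x - x₀‖ := by
    have := hΦ x hx x₀ hx0
    rw [hΦx, zero_sub] at this
    rwa [← norm_neg, show -(x - x₀ + Φ x₀) = -Φ x₀ - (x - x₀) by abel]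
  have h2 : ‖x - x₀‖ ≤ 2 * ‖Φ x₀‖ := by
    have : ‖x - x₀‖ ≤ ‖x - x₀ + Φ x₀‖ + ‖Φ x₀‖ := by
      simpa using norm_sub_le (x - x₀ + Φ x₀) (Φ x₀)
    nlinarith [norm_nonneg (x - x₀)]
  calc _ ≤ _ := h1
    _ ≤ η * (2 * ‖Φ x₀‖) := by gcongr
    _ = _ := by ring

end Newton

/-! ### Mean value estimates -/

section MeanValue

/-- The location of ξ is recorded as membership in every closed interval that contains u and w,
which covers all orders of u and w at once. -/
theorem exists_mean_value {f f' : ℝ → ℝ} (hf : ∀ x, HasDerivAt f (f' x) x) (u w : ℝ) :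
    ∃ ξ, f u - f w = f' ξ * (u - w) ∧ ∀ c ρ, |u - c| ≤ ρ → |w - c| ≤ ρ → |ξ - c| ≤ ρ := by
  have hc : Continuous f := continuous_iff_continuousAt.mpr fun x => (hf x).continuousAt
  rcases lt_trichotomy u w with h | h | h
  · obtain ⟨ξ, ⟨h1, h2⟩, h3⟩ := exists_hasDerivAt_eq_slope f f' h hc.continuousOn fun x _ => hf x
    refine ⟨ξ, ?_, fun c ρ hu hw => ?_⟩
    · have : w - u ≠ 0 := (sub_pos.mpr h).ne'
      rw [h3]; field_simp; ring
    · rw [abs_le] at *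
      constructor <;> linarith
  · exact ⟨u, by simp [h], fun c ρ hu _ => hu⟩
  · obtain ⟨ξ, ⟨h1, h2⟩, h3⟩ := exists_hasDerivAt_eq_slope f f' h hc.continuousOn fun x _ => hf x
    refine ⟨ξ, ?_, fun c ρ hu hw => ?_⟩
    · have : u - w ≠ 0 := (sub_pos.mpr h).ne'
      rw [h3]; field_simp
    · rw [abs_le] at *
      constructor <;> linarith

/-- A local envelope of the derivative yields one of the function, by the mean value theorem.
Applied once it serves g, applied twice it serves G. -/
theorem abs_le_of_deriv_bound {f f' F : ℝ → ℝ} (hf : ∀ x, HasDerivAt f (f' x) x) {ε : ℝ}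
    (hF : ∀ x t, |t| ≤ ε → |f' (x + t)| ≤ F x) (x t : ℝ) (ht : |t| ≤ ε) :
    |f (x + t)| ≤ |f x| + ε * F x := by
  have hε : 0 ≤ ε := (abs_nonneg _).trans ht
  obtain ⟨ξ, h1, h2⟩ := exists_mean_value hf (x + t) x
  have h3 := hF x (ξ - x) (h2 x ε (by simpa using ht) (by simpa using hε))
  rw [add_sub_cancel] at h3
  have h4 : f (x + t) = f x + f' ξ * t := by
    rw [add_sub_cancel_left] at h1; linarith
  rw [h4]
  refine (abs_add_le _ _).trans ?_
  rw [abs_mul, mul_comm]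
  gcongr

end MeanValue

/-! ### The independent component model -/

/-- The assumptions on the sources, with the moments `E[G(z_j)]`, `E[g(z_j)]`, `E[g(z_j)z_j]` and
`E[g'(z_j)]` of the components. -/
structure ICModel {Ω : Type*} [MeasurableSpace Ω] {p : ℕ} (P : Measure Ω) (G : ℝ → ℝ)
    (z : ℕ → Ω → Fin p → ℝ) (ν μ lam δ : Fin p → ℝ) : Prop where
  contDiff : ContDiff ℝ 2 G
  source : IsICSourceSample P z
  moments : ∀ j, HasICMoments G P (fun ω => z 0 ω j)
  envelope : ∀ j, HasLocalEnvelope G P (fun ω => z 0 ω j)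
  nu_eq : ∀ j, ∫ ω, G (z 0 ω j) ∂P = ν j
  mu_eq : ∀ j, ∫ ω, deriv G (z 0 ω j) ∂P = μ j
  lam_eq : ∀ j, ∫ ω, deriv G (z 0 ω j) * z 0 ω j ∂P = lam j
  delta_eq : ∀ j, ∫ ω, deriv (deriv G) (z 0 ω j) ∂P = δ j

/-- The average of `f (zⱼ + dᵢ) m (z - z̄)`, where `dᵢ` is a perturbation of the argument. -/
noncomputable def perturbedAvg {Ω : Type*} {p : ℕ} (z : ℕ → Ω → Fin p → ℝ) (f : ℝ → ℝ)
    (m : (Fin p → ℝ) → ℝ) (j : Fin p) (d : ℕ → ℝ) (q : ℕ × Ω) : ℝ :=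
  (q.1 : ℝ)⁻¹ * ∑ i ∈ Finset.range q.1, f (z i q.2 j + d i) * m (z i q.2 - zbar z q)

/-- The averages of `f (zⱼ + d) m (z - z̄)` converge to `c`, uniformly in small perturbations `d`. -/
def UniformAvg {Ω : Type*} [MeasurableSpace Ω] {p : ℕ} (P : Measure Ω) (z : ℕ → Ω → Fin p → ℝ)
    (f : ℝ → ℝ) (m : (Fin p → ℝ) → ℝ) (j : Fin p) (c : ℝ) : Prop :=
  ∀ η > 0, ∃ ρ > 0, ∀ᶠ q in probFilter P, ∀ d : ℕ → ℝ, (∀ i < q.1, |d i| ≤ ρ) →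
    |perturbedAvg z f m j d q - c| ≤ η

namespace ICModel

variable {Ω : Type*} [MeasurableSpace Ω] {p : ℕ} {P : Measure Ω} {G : ℝ → ℝ}
  {z : ℕ → Ω → Fin p → ℝ} {ν μ lam δ : Fin p → ℝ}

theorem isIID (h : ICModel P G z ν μ lam δ) : IsIID P z :=
  ⟨h.source.measurable, h.source.iIndep, h.source.identDistrib⟩

theorem hasDerivAt (h : ICModel P G z ν μ lam δ) (x : ℝ) : HasDerivAt G (deriv G x) x :=
  (h.contDiff.differentiable (by norm_num) x).hasDerivAt

theorem contDiff_deriv (h : ICModel P G z ν μ lam δ) : ContDiff ℝ 1 (deriv G) :=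
  ((contDiff_succ_iff_deriv (n := 1)).mp (by simpa [one_add_one_eq_two] using h.contDiff)).2.2

theorem hasDerivAt_deriv (h : ICModel P G z ν μ lam δ) (x : ℝ) :
    HasDerivAt (deriv G) (deriv (deriv G) x) x :=
  (h.contDiff_deriv.differentiable (by norm_num) x).hasDerivAt

theorem continuous (h : ICModel P G z ν μ lam δ) : Continuous G := h.contDiff.continuous

theorem continuous_deriv (h : ICModel P G z ν μ lam δ) : Continuous (deriv G) :=
  h.contDiff_deriv.continuous

theorem continuous_deriv2 (h : ICModel P G z ν μ lam δ) : Continuous (deriv (deriv G)) :=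
  h.contDiff_deriv.continuous_deriv (by norm_num)

theorem measurable_coord (h : ICModel P G z ν μ lam δ) (j : Fin p) :
    Measurable fun ω => z 0 ω j := (measurable_pi_apply j).comp (h.source.measurable 0)

theorem integral_coord_mul (h : ICModel P G z ν μ lam δ) {j a : Fin p} (hja : j ≠ a)
    {f u : ℝ → ℝ} (hf : Measurable f) (hu : Measurable u) :
    ∫ ω, f (z 0 ω j) * u (z 0 ω a) ∂P = (∫ ω, f (z 0 ω j) ∂P) * ∫ ω, u (z 0 ω a) ∂P :=
  ((h.source.iIndep_components.indepFun hja).comp hf hu).integral_fun_mul_eq_mul_integral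
    (hf.comp (h.measurable_coord j)).aestronglyMeasurable
    (hu.comp (h.measurable_coord a)).aestronglyMeasurable

theorem integrable_coord_mul (h : ICModel P G z ν μ lam δ) {j a : Fin p} (hja : j ≠ a)
    {f u : ℝ → ℝ} (hf : Measurable f) (hu : Measurable u)
    (hfi : Integrable (fun ω => f (z 0 ω j)) P) (hui : Integrable (fun ω => u (z 0 ω a)) P) :
    Integrable (fun ω => f (z 0 ω j) * u (z 0 ω a)) P :=
  ((h.source.iIndep_components.indepFun hja).comp hf hu).integrable_mul hfi hui

theorem indepFun_pair (h : ICModel P G z ν μ lam δ) {j a b : Fin p} (hja : j ≠ a) (hjb : j ≠ b) :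
    IndepFun (fun ω => z 0 ω j) (fun ω => (z 0 ω a, z 0 ω b)) P :=
  (h.source.iIndep_components.indepFun_prodMk h.measurable_coord a b j hja.symm hjb.symm).symm

theorem integral_coord_mul_pair (h : ICModel P G z ν μ lam δ) {j a b : Fin p} (hja : j ≠ a)
    (hjb : j ≠ b) {f : ℝ → ℝ} {u : ℝ × ℝ → ℝ} (hf : Measurable f) (hu : Measurable u) :
    ∫ ω, f (z 0 ω j) * u (z 0 ω a, z 0 ω b) ∂P =
      (∫ ω, f (z 0 ω j) ∂P) * ∫ ω, u (z 0 ω a, z 0 ω b) ∂P :=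
  ((h.indepFun_pair hja hjb).comp hf hu).integral_fun_mul_eq_mul_integral
    (hf.comp (h.measurable_coord j)).aestronglyMeasurable
    (hu.comp ((h.measurable_coord a).prodMk (h.measurable_coord b))).aestronglyMeasurable

theorem integrable_coord_mul_pair (h : ICModel P G z ν μ lam δ) {j a b : Fin p} (hja : j ≠ a)
    (hjb : j ≠ b) {f : ℝ → ℝ} {u : ℝ × ℝ → ℝ} (hf : Measurable f) (hu : Measurable u)
    (hfi : Integrable (fun ω => f (z 0 ω j)) P)
    (hui : Integrable (fun ω => u (z 0 ω a, z 0 ω b)) P) :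
    Integrable (fun ω => f (z 0 ω j) * u (z 0 ω a, z 0 ω b)) P :=
  ((h.indepFun_pair hja hjb).comp hf hu).integrable_mul hfi hui

theorem integrable_coord_mul_coord (h : ICModel P G z ν μ lam δ) (a b : Fin p) :
    Integrable (fun ω => z 0 ω a * z 0 ω b) P :=
  (h.source.memLp a).integrable_mul (h.source.memLp b)

theorem integral_coord_mul_coord (h : ICModel P G z ν μ lam δ) (a b : Fin p) :
    ∫ ω, z 0 ω a * z 0 ω b ∂P = if a = b then 1 else 0 := by
  split_ifs with hab
  · subst hab
    simpa [sq] using h.source.second_moment a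
  · simpa [h.source.mean] using h.integral_coord_mul hab measurable_id measurable_id

/-- An integrable local bound of the second derivative of `G`. -/
theorem exists_envelope (h : ICModel P G z ν μ lam δ) (j : Fin p) :
    ∃ ε > 0, ∃ H : ℝ → ℝ, Measurable H ∧
      (∀ x t, |t| ≤ ε → |deriv (deriv G) (x + t)| ≤ H x) ∧
      Integrable (fun ω => H (z 0 ω j)) P ∧ Integrable (fun ω => H (z 0 ω j) * |z 0 ω j|) P := by
  obtain ⟨ε, hε, b, hb, hint⟩ := h.envelope j
  have hc := h.continuous_deriv2
  -- The given bound b need not be measurable; the local supremum of |g'| is continuous and lies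
  -- below b.
  set H := localSup (deriv (deriv G)) ε with hH
  have hHm : Measurable H := (continuous_localSup hc ε).measurable
  have hH0 : ∀ x, 0 ≤ H x := localSup_nonneg hc hε.le
  have hHb : ∀ x, H x ≤ b x := fun x => localSup_le hε.le (hb x)
  have hZ := h.measurable_coord j
  refine ⟨ε, hε, H, hHm, fun x t ht => abs_le_localSup hc x ht, ?_, ?_⟩
  · refine hint.mono' (hHm.comp hZ).aestronglyMeasurable (ae_of_all _ fun ω => ?_)
    rw [Real.norm_eq_abs, abs_of_nonneg (hH0 _)]
    nlinarith [hH0 (z 0 ω j), hHb (z 0 ω j), abs_nonneg (z 0 ω j),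
      mul_nonneg ((hH0 _).trans (hHb (z 0 ω j))) (abs_nonneg (z 0 ω j))]
  · refine hint.mono' ((hHm.comp hZ).mul hZ.abs).aestronglyMeasurable (ae_of_all _ fun ω => ?_)
    rw [Real.norm_eq_abs, abs_mul, abs_abs, abs_of_nonneg (hH0 _)]
    nlinarith [hH0 (z 0 ω j), hHb (z 0 ω j), abs_nonneg (z 0 ω j),
      mul_le_mul_of_nonneg_right (hHb (z 0 ω j)) (abs_nonneg (z 0 ω j))]

variable [IsProbabilityMeasure P]

theorem integrable_coord (h : ICModel P G z ν μ lam δ) (j : Fin p) :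
    Integrable (fun ω => z 0 ω j) P := (h.source.memLp j).integrable one_le_two

theorem integrable_deriv (h : ICModel P G z ν μ lam δ) (j : Fin p) :
    Integrable (fun ω => deriv G (z 0 ω j)) P := (h.moments j).sigma.integrable one_le_two

theorem tendsto_zbar (h : ICModel P G z ν μ lam δ) : Tendsto (zbar z) (probFilter P) (𝓝 0) := by
  rw [tendsto_pi_nhds]
  intro a
  have := h.isIID.tendsto_avg (φ := fun v => v a) (measurable_pi_apply a) (h.integrable_coord a)
  rw [h.source.mean] at this
  exact this

theorem uniformAvg_of (h : ICModel P G z ν μ lam δ) {f F : ℝ → ℝ} (hf : Continuous f)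
    (hFm : Measurable F) {ε : ℝ} (hε : 0 < ε) (hF : ∀ x t, |t| ≤ ε → |f (x + t)| ≤ F x)
    (j : Fin p) {m k : (Fin p → ℝ) → ℝ} (hm : Measurable m) (hk : Measurable k)
    (hmk : ∀ v c, ‖c‖ ≤ 1 → |m (v - c) - m v| ≤ ‖c‖ * k v)
    (hint : Integrable (fun ω => F (z 0 ω j) * |m (z 0 ω)|) P)
    (hintk : Integrable (fun ω => F (z 0 ω j) * k (z 0 ω)) P) {c : ℝ}
    (hc : ∫ ω, f (z 0 ω j) * m (z 0 ω) ∂P = c) : UniformAvg P z f m j c := by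
  intro η hη
  rw [← hc]
  exact h.isIID.uniform_avg h.tendsto_zbar hf hFm hε hF j hm hk hmk hint hintk hη

theorem uniformAvg_one (h : ICModel P G z ν μ lam δ) {f F : ℝ → ℝ} (hf : Continuous f)
    (hFm : Measurable F) {ε : ℝ} (hε : 0 < ε) (hF : ∀ x t, |t| ≤ ε → |f (x + t)| ≤ F x)
    (j : Fin p) (hint : Integrable (fun ω => F (z 0 ω j)) P) :
    UniformAvg P z f (fun _ => 1) j (∫ ω, f (z 0 ω j) ∂P) :=
  h.uniformAvg_of hf hFm hε hF j (k := fun _ => 0) measurable_const measurable_const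
    (fun v c _ => by simp) (by simpa using hint) (by simp) (by simp)

/-- For a ≠ j independence splits the product, so integrability of F(z_j) is enough and the limit
vanishes with E[z_a]. Only a = j needs the additional moment. -/
theorem uniformAvg_coord (h : ICModel P G z ν μ lam δ) {f F : ℝ → ℝ} (hf : Continuous f)
    (hFm : Measurable F) {ε : ℝ} (hε : 0 < ε) (hF : ∀ x t, |t| ≤ ε → |f (x + t)| ≤ F x)
    (j a : Fin p) (hint : Integrable (fun ω => F (z 0 ω j)) P)
    (hint' : a = j → Integrable (fun ω => F (z 0 ω j) * |z 0 ω j|) P) :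
    UniformAvg P z f (fun v => v a) j (if a = j then ∫ ω, f (z 0 ω j) * z 0 ω j ∂P else 0) := by
  refine h.uniformAvg_of hf hFm hε hF j (k := fun _ => 1) (measurable_pi_apply a)
    measurable_const (fun v c _ => ?_) ?_ (by simpa using hint) ?_
  · simpa using norm_le_pi_norm c a
  · by_cases ha : a = j
    · subst ha; exact hint' rfl
    · exact h.integrable_coord_mul (Ne.symm ha) hFm measurable_norm hint
        (h.integrable_coord a).norm
  · split_ifs with ha
    · rw [ha]
    · have := h.integral_coord_mul (Ne.symm ha) hf.measurable measurable_id
      simpa [h.source.mean] using this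

theorem uniformAvg_G (h : ICModel P G z ν μ lam δ) (j : Fin p) :
    UniformAvg P z G (fun _ => 1) j (ν j) := by
  obtain ⟨ε, hε, H, hHm, hH, i1, i2⟩ := h.exists_envelope j
  rw [← h.nu_eq]
  refine h.uniformAvg_one h.continuous (F := fun x => |G x| + ε * (|deriv G x| + ε * H x)) ?_ hε
    (abs_le_of_deriv_bound h.hasDerivAt (abs_le_of_deriv_bound h.hasDerivAt_deriv hH)) j ?_
  · have := h.continuous.measurable
    have := h.continuous_deriv.measurable
    fun_prop
  · exact (h.moments j).nu.abs.add (((h.integrable_deriv j).abs.add (i1.const_mul _)).const_mul _)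

theorem uniformAvg_deriv (h : ICModel P G z ν μ lam δ) (j : Fin p) :
    UniformAvg P z (deriv G) (fun _ => 1) j (μ j) := by
  obtain ⟨ε, hε, H, hHm, hH, i1, i2⟩ := h.exists_envelope j
  rw [← h.mu_eq]
  refine h.uniformAvg_one h.continuous_deriv (F := fun x => |deriv G x| + ε * H x) ?_ hε
    (abs_le_of_deriv_bound h.hasDerivAt_deriv hH) j ?_
  · have := h.continuous_deriv.measurable
    fun_prop
  · exact (h.integrable_deriv j).abs.add (i1.const_mul _)

theorem uniformAvg_deriv_coord (h : ICModel P G z ν μ lam δ) (j a : Fin p) :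
    UniformAvg P z (deriv G) (fun v => v a) j (if a = j then lam j else 0) := by
  obtain ⟨ε, hε, H, hHm, hH, i1, i2⟩ := h.exists_envelope j
  rw [← h.lam_eq]
  refine h.uniformAvg_coord h.continuous_deriv (F := fun x => |deriv G x| + ε * H x) ?_ hε
    (abs_le_of_deriv_bound h.hasDerivAt_deriv hH) j a ?_ fun _ => ?_
  · have := h.continuous_deriv.measurable
    fun_prop
  · exact (h.integrable_deriv j).abs.add (i1.const_mul _)
  · have := (h.moments j).lam.abs.add (i2.const_mul ε)
    refine this.congr (ae_of_all _ fun ω => ?_)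
    simp only [Pi.add_apply, abs_mul]
    ring

theorem uniformAvg_deriv2_coord (h : ICModel P G z ν μ lam δ) {j a : Fin p} (ha : a ≠ j) :
    UniformAvg P z (deriv (deriv G)) (fun v => v a) j 0 := by
  obtain ⟨ε, hε, H, hHm, hH, i1, i2⟩ := h.exists_envelope j
  have := h.uniformAvg_coord h.continuous_deriv2 hHm hε hH j a i1 fun h => absurd h ha
  rwa [if_neg ha] at this

/-- The restriction a ≠ j excludes a = b = j, where the limit would be E[g'(z_j) z_j²], a moment
that is not assumed to exist. For b = j the moment E[g'(z_j) z_j] is multiplied by E[z_a] = 0; for b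
≠ j the limit factors as δ_j E[z_a z_b]. -/
theorem uniformAvg_deriv2_coord_mul (h : ICModel P G z ν μ lam δ) {j a : Fin p} (ha : a ≠ j)
    (b : Fin p) :
    UniformAvg P z (deriv (deriv G)) (fun v => v a * v b) j (if a = b then δ j else 0) := by
  obtain ⟨ε, hε, H, hHm, hH, i1, i2⟩ := h.exists_envelope j
  have g2m := h.continuous_deriv2.measurable
  have hHa : Integrable (fun ω => H (z 0 ω j) * |z 0 ω a|) P :=
    h.integrable_coord_mul (Ne.symm ha) hHm measurable_norm i1 (h.integrable_coord a).norm
  have hHb : Integrable (fun ω => H (z 0 ω j) * |z 0 ω b|) P := by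
    by_cases hb : b = j
    · rw [hb]; exact i2
    · exact h.integrable_coord_mul (Ne.symm hb) hHm measurable_norm i1 (h.integrable_coord b).norm
  refine h.uniformAvg_of h.continuous_deriv2 hHm hε hH j (k := fun v => |v a| + |v b| + 1)
    (by fun_prop) (by fun_prop) (fun v c hc => ?_) ?_ ?_ ?_
  · have h1 : |c a| ≤ ‖c‖ := norm_le_pi_norm c a
    have h2 : |c b| ≤ ‖c‖ := norm_le_pi_norm c b
    calc |(v - c) a * (v - c) b - v a * v b| = |-(v a * c b) + -(c a * v b) + c a * c b| := by
          congr 1; simp only [Pi.sub_apply]; ring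
      _ ≤ |v a| * |c b| + |c a| * |v b| + |c a| * |c b| := by
          refine (abs_add_le _ _).trans (add_le_add ((abs_add_le _ _).trans ?_) ?_)
          · rw [abs_neg, abs_neg, abs_mul, abs_mul]
          · rw [abs_mul]
      _ ≤ |v a| * ‖c‖ + ‖c‖ * |v b| + ‖c‖ * 1 := by
          gcongr
          exact h2.trans hc
      _ = _ := by ring
  · by_cases hb : b = j
    · subst hb
      have hu : Measurable fun x => H x * |x| := by fun_prop
      have := h.integrable_coord_mul (Ne.symm ha) hu measurable_norm i2 (h.integrable_coord a).norm
      refine this.congr (ae_of_all _ fun ω => ?_)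
      simp only [Real.norm_eq_abs, abs_mul]
      ring
    · exact h.integrable_coord_mul_pair (Ne.symm ha) (Ne.symm hb) (u := fun x => |x.1 * x.2|) hHm
        (by fun_prop) i1 (h.integrable_coord_mul_coord a b).abs
  · have := (hHa.add hHb).add i1
    refine this.congr (ae_of_all _ fun ω => ?_)
    simp only [Pi.add_apply]
    ring
  · by_cases hb : b = j
    · subst hb
      have hu : Measurable fun x => deriv (deriv G) x * x := by fun_prop
      have := h.integral_coord_mul (Ne.symm ha) hu measurable_id
      simp only [id, h.source.mean, mul_zero] at this
      rw [if_neg ha, ← this]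
      congr 1; ext ω; ring
    · rw [h.integral_coord_mul_pair (Ne.symm ha) (Ne.symm hb) (u := fun x => x.1 * x.2) g2m
        (by fun_prop), h.integral_coord_mul_coord, h.delta_eq]
      split_ifs <;> simp

end ICModel

/-! ### The local scale -/

section Scale

/-- The eighth root of the sample size. -/
noncomputable def scale (n : ℕ) : ℝ := (n : ℝ) ^ (1 / 8 : ℝ)

theorem scale_nonneg (n : ℕ) : 0 ≤ scale n := Real.rpow_nonneg n.cast_nonneg _

theorem scale_pow_eight (n : ℕ) : scale n ^ 8 = n := by
  rw [scale, ← Real.rpow_natCast, ← Real.rpow_mul n.cast_nonneg]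
  norm_num

/-- In powers of s = n^(1/8): √n is s⁴, the largest observation is of order s², and the working
radius is s⁻³. The radius is thus large against the estimation error s⁻⁴ and small against the
reciprocal s⁻² of the largest observation. -/
theorem sqrt_eq_scale_pow (n : ℕ) : √(n : ℝ) = scale n ^ 4 := by
  rw [Real.sqrt_eq_iff_mul_self_eq n.cast_nonneg (by positivity [scale_nonneg n]),
    ← scale_pow_eight]
  ring

theorem tendsto_scale : Tendsto scale atTop atTop :=
  (tendsto_rpow_atTop (by norm_num)).comp tendsto_natCast_atTop_atTop

/-- The radius of the neighbourhood of the identity in which the equations are solved. -/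
noncomputable def radius {Ω : Type*} (q : ℕ × Ω) : ℝ := (scale q.1 ^ 3)⁻¹

theorem radius_nonneg {Ω : Type*} (q : ℕ × Ω) : 0 ≤ radius q :=
  inv_nonneg.mpr (pow_nonneg (scale_nonneg _) _)

variable {Ω : Type*} [MeasurableSpace Ω] {P : Measure Ω}

theorem tendsto_scale_fst : Tendsto (fun q : ℕ × Ω => scale q.1) (probFilter P) atTop :=
  tendsto_scale.comp tendsto_fst_probFilter

theorem tendsto_inv_scale : Tendsto (fun q : ℕ × Ω => (scale q.1)⁻¹) (probFilter P) (𝓝 0) :=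
  tendsto_inv_atTop_zero.comp tendsto_scale_fst

theorem eventually_one_le_scale : ∀ᶠ q : ℕ × Ω in probFilter P, 1 ≤ scale q.1 :=
  tendsto_scale_fst.eventually_ge_atTop 1

theorem tendsto_radius : Tendsto (radius (Ω := Ω)) (probFilter P) (𝓝 0) := by
  have := (tendsto_inv_scale (P := P)).pow 3
  simp only [ne_eq, OfNat.ofNat_ne_zero, not_false_eq_true, zero_pow] at this
  exact this.congr fun q => by rw [radius, inv_pow]

end Scale

/-! ### Strict derivatives of the sample functionals -/

section Functionals

variable {Ω : Type*} {p : ℕ}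

/-- The identity matrix as a family of rows. -/
def unitRows (p : ℕ) : Fin p → Fin p → ℝ := fun j l => if j = l then 1 else 0

/-- The entry in row `j` and column `l`, as a linear functional. -/
noncomputable def entry (j l : Fin p) : (Fin p → Fin p → ℝ) →L[ℝ] ℝ :=
  (ContinuousLinearMap.proj (R := ℝ) (φ := fun _ : Fin p => ℝ) l).comp
    (ContinuousLinearMap.proj (R := ℝ) (φ := fun _ : Fin p => Fin p → ℝ) j)

@[simp] theorem entry_apply (j l : Fin p) (x : Fin p → Fin p → ℝ) : entry j l x = x j l := rfl

theorem abs_entry_le (x : Fin p → Fin p → ℝ) (j l : Fin p) : |x j l| ≤ ‖x‖ :=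
  (norm_le_pi_norm (x j) l).trans (norm_le_pi_norm x j)

theorem abs_dotProduct_le (u v : Fin p → ℝ) : |u ⬝ᵥ v| ≤ p * (‖u‖ * ‖v‖) := by
  calc |u ⬝ᵥ v| ≤ ∑ b, |u b * v b| := Finset.abs_sum_le_sum_abs _ _
    _ ≤ ∑ _b : Fin p, ‖u‖ * ‖v‖ := by
        refine Finset.sum_le_sum fun b _ => ?_
        rw [abs_mul]
        exact mul_le_mul (norm_le_pi_norm u b) (norm_le_pi_norm v b) (abs_nonneg _) (norm_nonneg _)
    _ = _ := by simp

/-- The average of `f (γⱼᵀ y) m y` over the centred vectors `y = z - z̄`. -/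
noncomputable def rowAvg (z : ℕ → Ω → Fin p → ℝ) (f : ℝ → ℝ) (m : (Fin p → ℝ) → ℝ) (j : Fin p)
    (q : ℕ × Ω) (x : Fin p → Fin p → ℝ) : ℝ :=
  (q.1 : ℝ)⁻¹ * ∑ i ∈ Finset.range q.1,
    f (x j ⬝ᵥ (z i q.2 - zbar z q)) * m (z i q.2 - zbar z q)

theorem rowAvg_eq_perturbedAvg (z : ℕ → Ω → Fin p → ℝ) (f : ℝ → ℝ) (m : (Fin p → ℝ) → ℝ)
    (j : Fin p) (q : ℕ × Ω) (x : Fin p → Fin p → ℝ) :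
    rowAvg z f m j q x =
      perturbedAvg z f m j (fun i => x j ⬝ᵥ (z i q.2 - zbar z q) - z i q.2 j) q := by
  simp [rowAvg, perturbedAvg]

/-- Increments of `rowAvg` are governed by perturbed averages of the derivative. -/
theorem exists_rowAvg_sub (z : ℕ → Ω → Fin p → ℝ) {f f' : ℝ → ℝ}
    (hf : ∀ x, HasDerivAt f (f' x) x) (m : (Fin p → ℝ) → ℝ) (j : Fin p) (q : ℕ × Ω) (c w : ℕ → ℝ)
    (x : Fin p → Fin p → ℝ) (hw : ∀ i < q.1, x j ⬝ᵥ (z i q.2 - zbar z q) - w i = c i) :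
    ∃ d : ℕ → ℝ, (q.1 : ℝ)⁻¹ * ∑ i ∈ Finset.range q.1,
      (f (x j ⬝ᵥ (z i q.2 - zbar z q)) - f (w i)) * m (z i q.2 - zbar z q) =
      (q.1 : ℝ)⁻¹ * ∑ i ∈ Finset.range q.1,
        f' (z i q.2 j + d i) * (c i * m (z i q.2 - zbar z q)) ∧
      ∀ ρ i, |x j ⬝ᵥ (z i q.2 - zbar z q) - z i q.2 j| ≤ ρ → |w i - z i q.2 j| ≤ ρ →
        |d i| ≤ ρ := by
  choose ξ h1 h2 using fun i => exists_mean_value hf (x j ⬝ᵥ (z i q.2 - zbar z q)) (w i)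
  refine ⟨fun i => ξ i - z i q.2 j, ?_, fun ρ i hu hw => h2 i _ ρ hu hw⟩
  congr 1
  refine Finset.sum_congr rfl fun i hi => ?_
  rw [h1, hw i (Finset.mem_range.mp hi)]
  simp only [add_sub_cancel]
  ring

theorem exists_rowAvg_sub_rowAvg (z : ℕ → Ω → Fin p → ℝ) {f f' : ℝ → ℝ}
    (hf : ∀ x, HasDerivAt f (f' x) x) (m : (Fin p → ℝ) → ℝ) (j : Fin p) (q : ℕ × Ω)
    (x y : Fin p → Fin p → ℝ) :
    ∃ d : ℕ → ℝ, rowAvg z f m j q x - rowAvg z f m j q y =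
      ∑ b, (x - y) j b * perturbedAvg z f' (fun v => m v * v b) j d q ∧
      ∀ ρ i, |x j ⬝ᵥ (z i q.2 - zbar z q) - z i q.2 j| ≤ ρ →
        |y j ⬝ᵥ (z i q.2 - zbar z q) - z i q.2 j| ≤ ρ → |d i| ≤ ρ := by
  obtain ⟨d, h1, h2⟩ := exists_rowAvg_sub z hf m j q
    (fun i => (x - y) j ⬝ᵥ (z i q.2 - zbar z q)) (fun i => y j ⬝ᵥ (z i q.2 - zbar z q)) x
    (fun i _ => by rw [Pi.sub_apply, sub_dotProduct])
  refine ⟨d, ?_, h2⟩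
  have : rowAvg z f m j q x - rowAvg z f m j q y = (q.1 : ℝ)⁻¹ * ∑ i ∈ Finset.range q.1,
      (f (x j ⬝ᵥ (z i q.2 - zbar z q)) - f (y j ⬝ᵥ (z i q.2 - zbar z q))) *
        m (z i q.2 - zbar z q) := by
    simp only [rowAvg, ← mul_sub, ← Finset.sum_sub_distrib, sub_mul]
  rw [this, h1]
  simp only [perturbedAvg, dotProduct, Finset.mul_sum, Finset.sum_mul]
  rw [Finset.sum_comm]
  refine Finset.sum_congr rfl fun b _ => Finset.sum_congr rfl fun i _ => ?_
  ring

end Functionals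

namespace ICModel

variable {Ω : Type*} [MeasurableSpace Ω] {p : ℕ} {P : Measure Ω} {G : ℝ → ℝ}
  {z : ℕ → Ω → Fin p → ℝ} {ν μ lam δ : Fin p → ℝ} [IsProbabilityMeasure P]

/-- By the law of large numbers the sum of all fourth powers is at most Cn, and every single fourth
power is bounded by that sum. So the maximum over the sample is of order n^(1/4). -/
theorem exists_norm_centred_le (h : ICModel P G z ν μ lam δ) :
    ∃ K > 0, ∀ᶠ q in probFilter P, ∀ i < q.1, ‖z i q.2 - zbar z q‖ ≤ K * scale q.1 ^ 2 := by
  set C := max 1 ((∫ ω, ∑ a, z 0 ω a ^ 4 ∂P) + 1) with hC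
  have hC1 : 1 ≤ C := le_max_left _ _
  have hm : Measurable fun v : Fin p → ℝ => ∑ a, v a ^ 4 := by fun_prop
  have e1 := h.isIID.eventually_avg_le hm (integrable_finsetSum _ fun a _ => (h.moments a).beta)
    ((lt_add_one _).trans_le (le_max_right 1 _))
  have hn : Tendsto (fun q => ‖zbar z q‖) (probFilter P) (𝓝 0) := by
    simpa using h.tendsto_zbar.norm
  refine ⟨C + 1, by positivity, ?_⟩
  filter_upwards [e1, hn.eventually (gt_mem_nhds one_pos), eventually_one_le_scale (P := P)]
    with q h1 h2 h3 i hi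
  have hq : (0 : ℝ) < q.1 := by exact_mod_cast (Nat.zero_le i).trans_lt hi
  have h4 : ∑ i ∈ Finset.range q.1, ∑ a, z i q.2 a ^ 4 ≤ C * scale q.1 ^ 8 := by
    rw [avg, inv_mul_le_iff₀ hq] at h1
    rw [scale_pow_eight, mul_comm]
    exact h1
  have h5 : ‖z i q.2‖ ≤ C * scale q.1 ^ 2 := by
    rw [pi_norm_le_iff_of_nonneg (by positivity)]
    intro a
    rw [Real.norm_eq_abs]
    refine (pow_le_pow_iff_left₀ (abs_nonneg _) (by positivity) (four_ne_zero)).mp ?_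
    have h6 : z i q.2 a ^ 4 ≤ ∑ i ∈ Finset.range q.1, ∑ a, z i q.2 a ^ 4 :=
      (Finset.single_le_sum (f := fun a => z i q.2 a ^ 4) (fun a _ => by positivity)
        (Finset.mem_univ a)).trans
        (Finset.single_le_sum (f := fun i => ∑ a, z i q.2 a ^ 4)
          (fun i _ => by positivity) (Finset.mem_range.mpr hi))
    calc |z i q.2 a| ^ 4 = z i q.2 a ^ 4 := by rw [← abs_pow, abs_of_nonneg (by positivity)]
      _ ≤ C * scale q.1 ^ 8 := h6.trans h4
      _ ≤ C ^ 4 * scale q.1 ^ 8 := by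
        gcongr
        exact le_self_pow₀ hC1 four_ne_zero
      _ = _ := by ring
  have h7 : 1 ≤ scale q.1 ^ 2 := one_le_pow₀ h3
  calc _ ≤ ‖z i q.2‖ + ‖zbar z q‖ := norm_sub_le _ _
    _ ≤ C * scale q.1 ^ 2 + 1 * scale q.1 ^ 2 := by linarith
    _ = _ := by ring

/-- The radius n^(-3/8) times the maximal norm of order n^(1/4) is of order n^(-1/8). Hence for rows
in the ball all projections are uniformly small perturbations of z_j, as `UniformAvg` requires. -/
theorem eventually_abs_projection_sub_le (h : ICModel P G z ν μ lam δ) {ρ : ℝ} (hρ : 0 < ρ) :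
    ∀ᶠ q in probFilter P, ∀ x ∈ Metric.closedBall (unitRows p) (radius q), ∀ i < q.1, ∀ j,
      |x j ⬝ᵥ (z i q.2 - zbar z q) - z i q.2 j| ≤ ρ := by
  obtain ⟨K, hK, e1⟩ := h.exists_norm_centred_le
  have hn : Tendsto (fun q => ‖zbar z q‖) (probFilter P) (𝓝 0) := by
    simpa using h.tendsto_zbar.norm
  have e2 : Tendsto (fun q : ℕ × Ω => p * (K * (scale q.1)⁻¹) + ‖zbar z q‖) (probFilter P)
      (𝓝 0) := by
    simpa using (((tendsto_inv_scale (P := P)).const_mul K).const_mul (p : ℝ)).add hn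
  filter_upwards [e1, e2.eventually (gt_mem_nhds hρ), eventually_one_le_scale (P := P)]
    with q h1 h2 h3 x hx i hi j
  have hx' : ‖x - unitRows p‖ ≤ radius q := by simpa [dist_eq_norm] using hx
  have hs : 0 < scale q.1 := by linarith
  have e : x j ⬝ᵥ (z i q.2 - zbar z q) - z i q.2 j =
      (x - unitRows p) j ⬝ᵥ (z i q.2 - zbar z q) - zbar z q j := by
    have : unitRows p j ⬝ᵥ (z i q.2 - zbar z q) = z i q.2 j - zbar z q j := by
      simp [unitRows, dotProduct]
    rw [Pi.sub_apply, sub_dotProduct, this]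
    ring
  rw [e]
  have h4 : |zbar z q j| ≤ ‖zbar z q‖ := norm_le_pi_norm (zbar z q) j
  calc _ ≤ |(x - unitRows p) j ⬝ᵥ (z i q.2 - zbar z q)| + |zbar z q j| := abs_sub _ _
    _ ≤ p * (radius q * (K * scale q.1 ^ 2)) + ‖zbar z q‖ := by
        gcongr
        refine (abs_dotProduct_le _ _).trans ?_
        gcongr
        · exact radius_nonneg q
        · exact (norm_le_pi_norm _ j).trans hx'
        · exact h1 i hi
    _ = p * (K * (scale q.1)⁻¹) + ‖zbar z q‖ := by
        rw [radius]; field_simp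
    _ ≤ ρ := h2.le

theorem eventually_rowAvg_le (h : ICModel P G z ν μ lam δ) {f : ℝ → ℝ} {m : (Fin p → ℝ) → ℝ}
    {j : Fin p} {c : ℝ} (hU : UniformAvg P z f m j c) {η : ℝ} (hη : 0 < η) :
    ∀ᶠ q in probFilter P, ∀ x ∈ Metric.closedBall (unitRows p) (radius q),
      |rowAvg z f m j q x - c| ≤ η := by
  obtain ⟨ρ, hρ, e1⟩ := hU η hη
  filter_upwards [e1, h.eventually_abs_projection_sub_le hρ] with q h1 h2 x hx
  rw [rowAvg_eq_perturbedAvg]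
  exact h1 _ fun i hi => h2 x hx i hi j

theorem tendsto_rowAvg_unitRows (h : ICModel P G z ν μ lam δ) {f : ℝ → ℝ}
    {m : (Fin p → ℝ) → ℝ} {j : Fin p} {c : ℝ} (hU : UniformAvg P z f m j c) :
    Tendsto (fun q => rowAvg z f m j q (unitRows p)) (probFilter P) (𝓝 c) := by
  rw [Metric.tendsto_nhds]
  intro ε hε
  filter_upwards [h.eventually_rowAvg_le hU (half_pos hε)] with q hq
  exact (hq _ (Metric.mem_closedBall_self (radius_nonneg q))).trans_lt (half_lt_self hε)

/-- By the mean value theorem an increment in row j is a combination of the entries of x − y, with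
coefficients the averages of f'(z_j + d) m(y) y_b over the centred vectors y. These are uniformly
close to their limits c b. -/
theorem strictDeriv_rowAvg (h : ICModel P G z ν μ lam δ) {f f' : ℝ → ℝ}
    (hf : ∀ x, HasDerivAt f (f' x) x) {m : (Fin p → ℝ) → ℝ} {j : Fin p} {v : ℝ} {c : Fin p → ℝ}
    (hU : UniformAvg P z f m j v) (hU' : ∀ b, UniformAvg P z f' (fun v => m v * v b) j (c b)) :
    StrictDerivAlong (probFilter P) radius (unitRows p) (rowAvg z f m j)
      (∑ b, c b • entry j b) v := by
  refine ⟨h.tendsto_rowAvg_unitRows hU, fun η hη => ?_⟩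
  have hη' : 0 < η / (p + 1) := by positivity
  choose ρ hρ e1 using fun b => hU' b _ hη'
  have e2 : ∀ᶠ q in probFilter P, ∀ b, ∀ x ∈ Metric.closedBall (unitRows p) (radius q),
      ∀ i < q.1, ∀ j, |x j ⬝ᵥ (z i q.2 - zbar z q) - z i q.2 j| ≤ ρ b :=
    eventually_all.mpr fun b => h.eventually_abs_projection_sub_le (hρ b)
  filter_upwards [eventually_all.mpr e1, e2] with q h1 h2 x hx y hy
  obtain ⟨d, h3, h4⟩ := exists_rowAvg_sub_rowAvg z hf m j q x y
  have h5 : ∀ b, |perturbedAvg z f' (fun v => m v * v b) j d q - c b| ≤ η / (p + 1) := fun b =>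
    h1 b d fun i hi => h4 _ i (h2 b x hx i hi j) (h2 b y hy i hi j)
  have h6 : rowAvg z f m j q x - rowAvg z f m j q y - (∑ b, c b • entry j b) (x - y) =
      ∑ b, (x - y) j b * (perturbedAvg z f' (fun v => m v * v b) j d q - c b) := by
    rw [h3]
    simp only [sum_apply, smul_apply, entry_apply,
      smul_eq_mul, mul_sub, Finset.sum_sub_distrib]
    congr 1
    exact Finset.sum_congr rfl fun b _ => mul_comm _ _
  rw [h6]
  calc _ ≤ ∑ b, |(x - y) j b * (perturbedAvg z f' (fun v => m v * v b) j d q - c b)| :=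
        Finset.abs_sum_le_sum_abs _ _
    _ ≤ ∑ _b : Fin p, ‖x - y‖ * (η / (p + 1)) := by
        refine Finset.sum_le_sum fun b _ => ?_
        rw [abs_mul]
        exact mul_le_mul (abs_entry_le _ _ _) (h5 b) (abs_nonneg _) (norm_nonneg _)
    _ = p / (p + 1) * (η * ‖x - y‖) := by
        simp only [Finset.sum_const, Finset.card_univ, Fintype.card_fin, nsmul_eq_mul]
        field_simp
    _ ≤ 1 * (η * ‖x - y‖) := by
        gcongr
        rw [div_le_one (by positivity)]
        linarith
    _ = _ := one_mul _

theorem strictDeriv_G (h : ICModel P G z ν μ lam δ) (j : Fin p) :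
    StrictDerivAlong (probFilter P) radius (unitRows p) (rowAvg z G (fun _ => 1) j)
      (lam j • entry j j) (ν j) := by
  refine (h.strictDeriv_rowAvg h.hasDerivAt (h.uniformAvg_G j)
    (c := fun b => if b = j then lam j else 0) fun b => ?_).congr_clm (fun x => ?_) rfl
  · simpa using h.uniformAvg_deriv_coord j b
  · simp

theorem strictDeriv_T (h : ICModel P G z ν μ lam δ) {j a : Fin p} (ha : a ≠ j) :
    StrictDerivAlong (probFilter P) radius (unitRows p) (rowAvg z (deriv G) (fun v => v a) j)
      (δ j • entry j a) 0 := by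
  refine (h.strictDeriv_rowAvg h.hasDerivAt_deriv (v := 0) ?_
    (c := fun b => if a = b then δ j else 0) fun b => ?_).congr_clm (fun x => ?_) rfl
  · simpa [ha] using h.uniformAvg_deriv_coord j a
  · exact h.uniformAvg_deriv2_coord_mul ha b
  · simp

/-- Differentiating gives an average of g' times the squared coordinate, whose expectation may be
infinite. One factor is bounded by the maximal norm instead, at the price of a Lipschitz constant of
order n^(1/4). -/
theorem exists_lipschitz_T_diag (h : ICModel P G z ν μ lam δ) (j : Fin p) :
    ∃ C > 0, ∀ᶠ q in probFilter P, ∀ x ∈ Metric.closedBall (unitRows p) (radius q),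
      ∀ y ∈ Metric.closedBall (unitRows p) (radius q),
      |rowAvg z (deriv G) (fun v => v j) j q x - rowAvg z (deriv G) (fun v => v j) j q y| ≤
        C * scale q.1 ^ 2 * ‖x - y‖ := by
  obtain ⟨ε, hε, H, hHm, hH, i1, i2⟩ := h.exists_envelope j
  obtain ⟨K, hK, e1⟩ := h.exists_norm_centred_le
  have hH0 : ∀ x, 0 ≤ H x := fun x => (abs_nonneg _).trans (hH x 0 (by simpa using hε.le))
  set B := (∫ ω, H (z 0 ω j) * (|z 0 ω j| + 1) ∂P) + 1 with hB
  have hint : Integrable (fun ω => H (z 0 ω j) * (|z 0 ω j| + 1)) P := by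
    refine (i2.add i1).congr (ae_of_all _ fun ω => ?_)
    simp only [Pi.add_apply]; ring
  have hB0 : 0 < B := by
    have : 0 ≤ ∫ ω, H (z 0 ω j) * (|z 0 ω j| + 1) ∂P :=
      integral_nonneg fun ω => mul_nonneg (hH0 _) (by positivity)
    linarith
  have e2 := h.isIID.eventually_avg_le (φ := fun v => H (v j) * (|v j| + 1)) (by fun_prop) hint
    (lt_add_one _)
  have hn : Tendsto (fun q => ‖zbar z q‖) (probFilter P) (𝓝 0) := by
    simpa using h.tendsto_zbar.norm
  refine ⟨p * K * B + 1, by positivity, ?_⟩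
  filter_upwards [e1, e2, h.eventually_abs_projection_sub_le hε,
    hn.eventually (gt_mem_nhds one_pos)] with q h1 h2 h3 h4 x hx y hy
  obtain ⟨d, h5, h6⟩ := exists_rowAvg_sub z h.hasDerivAt_deriv (fun v => v j) j q
    (fun i => (x - y) j ⬝ᵥ (z i q.2 - zbar z q)) (fun i => y j ⬝ᵥ (z i q.2 - zbar z q)) x
    (fun i _ => by rw [Pi.sub_apply, sub_dotProduct])
  have h7 : rowAvg z (deriv G) (fun v => v j) j q x - rowAvg z (deriv G) (fun v => v j) j q y =
      (q.1 : ℝ)⁻¹ * ∑ i ∈ Finset.range q.1,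
      (deriv G (x j ⬝ᵥ (z i q.2 - zbar z q)) - deriv G (y j ⬝ᵥ (z i q.2 - zbar z q))) *
        (z i q.2 - zbar z q) j := by
    simp only [rowAvg, ← mul_sub, ← Finset.sum_sub_distrib, sub_mul]
  rw [h7, h5, abs_mul, abs_of_nonneg (by positivity : (0 : ℝ) ≤ (q.1 : ℝ)⁻¹)]
  calc _ ≤ (q.1 : ℝ)⁻¹ * ∑ i ∈ Finset.range q.1,
        p * (‖x - y‖ * (K * scale q.1 ^ 2)) * (H (z i q.2 j) * (|z i q.2 j| + 1)) := by
        gcongr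
        refine (Finset.abs_sum_le_sum_abs _ _).trans (Finset.sum_le_sum fun i hi => ?_)
        have hi' := Finset.mem_range.mp hi
        have a1 := hH (z i q.2 j) (d i) (h6 ε i (h3 x hx i hi' j) (h3 y hy i hi' j))
        have a2 : |(x - y) j ⬝ᵥ (z i q.2 - zbar z q)| ≤ p * (‖x - y‖ * (K * scale q.1 ^ 2)) := by
          refine (abs_dotProduct_le _ _).trans ?_
          gcongr
          · exact norm_le_pi_norm _ j
          · exact h1 i hi'
        have a3 : |(z i q.2 - zbar z q) j| ≤ |z i q.2 j| + 1 := by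
          refine (abs_sub _ _).trans ?_
          gcongr
          exact (norm_le_pi_norm (zbar z q) j).trans h4.le
        rw [abs_mul, abs_mul]
        calc _ ≤ H (z i q.2 j) * (p * (‖x - y‖ * (K * scale q.1 ^ 2)) * (|z i q.2 j| + 1)) := by
              gcongr
              exact hH0 _
          _ = _ := by ring
    _ = p * (‖x - y‖ * (K * scale q.1 ^ 2)) * avg z (fun v => H (v j) * (|v j| + 1)) q := by
        rw [avg, ← Finset.mul_sum]; ring
    _ ≤ p * (‖x - y‖ * (K * scale q.1 ^ 2)) * B := by
        gcongr
    _ = (p * K * B) * scale q.1 ^ 2 * ‖x - y‖ := by ring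
    _ ≤ _ := by
        have := sq_nonneg (scale q.1)
        gcongr
        linarith

/-- The factor γ_lj is at most n^(-3/8) in the ball, which outweighs the Lipschitz constant of order
n^(1/4) of the other factor. So that factor acts like the constant λ_j, although it has no
controlled derivative of its own. -/
theorem strictDeriv_mul_T_diag (h : ICModel P G z ν μ lam δ) {j l : Fin p} (hl : l ≠ j) :
    StrictDerivAlong (probFilter P) radius (unitRows p)
      (fun q x => x l j * rowAvg z (deriv G) (fun v => v j) j q x) (lam j • entry l j) 0 := by
  have hU : UniformAvg P z (deriv G) (fun v => v j) j (lam j) := by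
    simpa using h.uniformAvg_deriv_coord j j
  refine ⟨?_, fun η hη => ?_⟩
  · simpa [unitRows, hl] using tendsto_const_nhds
  obtain ⟨C, hC, e1⟩ := h.exists_lipschitz_T_diag j
  have e2 : Tendsto (fun q : ℕ × Ω => C * (scale q.1)⁻¹) (probFilter P) (𝓝 0) := by
    simpa using (tendsto_inv_scale (P := P)).const_mul C
  filter_upwards [e1, h.eventually_rowAvg_le hU (half_pos hη),
    e2.eventually (gt_mem_nhds (half_pos hη)), eventually_one_le_scale (P := P)]
    with q h1 h2 h3 h4 x hx y hy
  have hs : 0 < scale q.1 := by linarith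
  have hy' : |y l j| ≤ radius q := by
    have : y l j = (y - unitRows p) l j := by simp [unitRows, hl]
    rw [this]
    exact (abs_entry_le _ l j).trans (by simpa [dist_eq_norm] using hy)
  set T := rowAvg z (deriv G) (fun v => v j) j q with hT
  have e : x l j * T x - y l j * T y - (lam j • entry l j) (x - y) =
      (x - y) l j * (T x - lam j) + y l j * (T x - T y) := by
    simp only [smul_apply, entry_apply, smul_eq_mul, Pi.sub_apply]
    ring
  rw [e]
  calc _ ≤ ‖x - y‖ * (η / 2) + radius q * (C * scale q.1 ^ 2 * ‖x - y‖) := by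
        refine (abs_add_le _ _).trans ?_
        rw [abs_mul, abs_mul]
        gcongr
        · exact abs_entry_le _ l j
        · exact h2 x hx
        · exact radius_nonneg q
        · exact h1 x hx y hy
    _ = (η / 2 + C * (scale q.1)⁻¹) * ‖x - y‖ := by
        rw [radius]; field_simp
    _ ≤ _ := by
        gcongr
        linarith

end ICModel

/-! ### A common form of the estimating equations -/

section Equations

variable {n p : ℕ}

/-- The limit of the weight of `γₗᵀ T(γⱼ)` in the estimating equations. -/
def limitWeight (κ : Fin p → Fin p → ℝ) (θ : ℝ) (ν : Fin p → ℝ) (j l : Fin p) : ℝ :=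
  κ j l + θ * ν j

/-- The derivative of the estimating equation of the pair `j, l` along the rotations of the plane
of `eⱼ` and `eₗ`, up to sign. -/
def pairSlope (κ : Fin p → Fin p → ℝ) (θ : ℝ) (ν lam δ : Fin p → ℝ) (j l : Fin p) : ℝ :=
  limitWeight κ θ ν j l * (lam j - δ j) + limitWeight κ θ ν l j * (lam l - δ l)

/-- The estimating equation of the pair `j, l`, with weights that are affine in the sample version
of `E[G(γᵀ(x - E x))]`. -/
noncomputable def estEq (G : ℝ → ℝ) (κ : Fin p → Fin p → ℝ) (θ : ℝ) (X : Fin n → Fin p → ℝ)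
    (Γ : Fin p → Fin p → ℝ) (j l : Fin p) : ℝ :=
  (κ j l + θ * sampleG G X (Γ j)) * (Γ l ⬝ᵥ sampleT G X (Γ j)) -
    (κ l j + θ * sampleG G X (Γ l)) * (Γ j ⬝ᵥ sampleT G X (Γ l))

/-- The sample covariance of the projections on two rows. -/
noncomputable def covForm (X : Fin n → Fin p → ℝ) (Γ : Fin p → Fin p → ℝ) (j l : Fin p) : ℝ :=
  Γ l ⬝ᵥ Matrix.mulVec (sampleCov X) (Γ j)

/-- The constraints and the estimating equations, combined so that the derivative at the identity
is close to the identity. -/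
noncomputable def newtonMap (G : ℝ → ℝ) (κ : Fin p → Fin p → ℝ) (θ : ℝ) (ν lam δ : Fin p → ℝ)
    (X : Fin n → Fin p → ℝ) (Γ : Fin p → Fin p → ℝ) : Fin p → Fin p → ℝ := fun j l =>
  if j = l then (covForm X Γ j j - 1) / 2
  else ((limitWeight κ θ ν j l * lam j - limitWeight κ θ ν l j * δ l) * covForm X Γ j l -
    estEq G κ θ X Γ j l) / pairSlope κ θ ν lam δ j l

/-- The limit of the simplified Newton iterations that start at the identity. -/
noncomputable def newtonLimit (G : ℝ → ℝ) (κ : Fin p → Fin p → ℝ) (θ : ℝ) (ν lam δ : Fin p → ℝ)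
    (n : ℕ) (X : Fin n → Fin p → ℝ) : Fin p → Fin p → ℝ := fun j l =>
  limsup (fun k : ℕ => (fun Γ => Γ - newtonMap G κ θ ν lam δ X Γ)^[k] (unitRows p) j l) atTop

/-- The influence functions of the solution. -/
noncomputable def influence (G : ℝ → ℝ) (κ : Fin p → Fin p → ℝ) (θ : ℝ) (ν μ lam δ : Fin p → ℝ)
    (j l : Fin p) (v : Fin p → ℝ) : ℝ :=
  if j = l then -(v j ^ 2 - 1) / 2
  else (limitWeight κ θ ν j l * ((deriv G (v j) - μ j - lam j * v j) * v l) -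
    limitWeight κ θ ν l j * ((deriv G (v l) - μ l - δ l * v l) * v j)) / pairSlope κ θ ν lam δ j l

variable {G : ℝ → ℝ} {κ : Fin p → Fin p → ℝ} {θ : ℝ} {ν lam δ : Fin p → ℝ}

theorem covForm_eq_sum (X : Fin n → Fin p → ℝ) (Γ : Fin p → Fin p → ℝ) (j l : Fin p) :
    covForm X Γ j l = ∑ a, ∑ b, Γ l a * (Γ j b * sampleCov X a b) := by
  simp only [covForm, dotProduct, Matrix.mulVec, Finset.mul_sum]
  exact Finset.sum_congr rfl fun a _ => Finset.sum_congr rfl fun b _ => by ring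

theorem sampleCov_apply (X : Fin n → Fin p → ℝ) (a b : Fin p) :
    sampleCov X a b = (n : ℝ)⁻¹ * ∑ i, centred X i a * centred X i b := by
  simp [sampleCov, Matrix.sum_apply, Matrix.vecMulVec_apply]

theorem covForm_comm (X : Fin n → Fin p → ℝ) (Γ : Fin p → Fin p → ℝ) (j l : Fin p) :
    covForm X Γ j l = covForm X Γ l j := by
  rw [covForm_eq_sum, covForm_eq_sum, Finset.sum_comm]
  refine Finset.sum_congr rfl fun a _ => Finset.sum_congr rfl fun b _ => ?_
  have : sampleCov X a b = sampleCov X b a := by simp only [sampleCov_apply, mul_comm]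
  rw [this]; ring

theorem estEq_comm (X : Fin n → Fin p → ℝ) (Γ : Fin p → Fin p → ℝ) (j l : Fin p) :
    estEq G κ θ X Γ l j = - estEq G κ θ X Γ j l := by
  rw [estEq, estEq]; ring

/-- Adding the equations of (j, l) and (l, j) removes the antisymmetric `estEq`, and the
coefficients of the symmetric `covForm` add up to the slope. So the covariance vanishes first, and
then the estimating equation. -/
theorem of_newtonMap_eq_zero (hD : ∀ j l, j ≠ l → pairSlope κ θ ν lam δ j l ≠ 0)
    {X : Fin n → Fin p → ℝ} {Γ : Fin p → Fin p → ℝ} (h : newtonMap G κ θ ν lam δ X Γ = 0) :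
    (∀ j l, covForm X Γ j l = if l = j then 1 else 0) ∧ ∀ j l, j ≠ l → estEq G κ θ X Γ j l = 0 := by
  have h1 : ∀ j l, newtonMap G κ θ ν lam δ X Γ j l = 0 := fun j l => by rw [h]; rfl
  have h2 : ∀ j l, j ≠ l →
      (limitWeight κ θ ν j l * lam j - limitWeight κ θ ν l j * δ l) * covForm X Γ j l -
        estEq G κ θ X Γ j l = 0 := by
    intro j l hjl
    have := h1 j l
    rw [newtonMap, if_neg hjl, div_eq_zero_iff] at this
    exact this.resolve_right (hD j l hjl)
  have h3 : ∀ j l, j ≠ l → covForm X Γ j l = 0 := by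
    intro j l hjl
    have e1 := h2 j l hjl
    have e2 := h2 l j hjl.symm
    rw [covForm_comm, estEq_comm] at e2
    have : pairSlope κ θ ν lam δ j l * covForm X Γ j l = 0 := by
      rw [pairSlope]; linarith
    exact (mul_eq_zero.mp this).resolve_left (hD j l hjl)
  refine ⟨fun j l => ?_, fun j l hjl => ?_⟩
  · split_ifs with hjl
    · subst hjl
      have := h1 l l
      rw [newtonMap, if_pos rfl] at this
      linarith
    · exact h3 j l (Ne.symm hjl)
  · have := h2 j l hjl
    rw [h3 j l hjl] at this
    linarith

/-! ### Measurability -/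

theorem continuous_centred (i : Fin n) :
    Continuous fun X : Fin n → Fin p → ℝ => centred X i := by
  unfold centred sampleMean
  fun_prop

theorem continuous_centred_apply (i : Fin n) (a : Fin p) :
    Continuous fun X : Fin n → Fin p → ℝ => centred X i a :=
  (continuous_apply a).comp (continuous_centred i)

theorem continuous_sampleG (hG : Continuous G) :
    Continuous fun q : (Fin n → Fin p → ℝ) × (Fin p → ℝ) => sampleG G q.1 q.2 := by
  have h : ∀ i : Fin n, Continuous fun q : (Fin n → Fin p → ℝ) × (Fin p → ℝ) =>
      q.2 ⬝ᵥ centred q.1 i := fun i =>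
    continuous_snd.dotProduct ((continuous_centred i).comp continuous_fst)
  unfold sampleG
  fun_prop

theorem continuous_sampleT (hg : Continuous (deriv G)) :
    Continuous fun q : (Fin n → Fin p → ℝ) × (Fin p → ℝ) => sampleT G q.1 q.2 := by
  have h : ∀ i : Fin n, Continuous fun q : (Fin n → Fin p → ℝ) × (Fin p → ℝ) =>
      q.2 ⬝ᵥ centred q.1 i := fun i =>
    continuous_snd.dotProduct ((continuous_centred i).comp continuous_fst)
  have h' : ∀ i : Fin n, Continuous fun q : (Fin n → Fin p → ℝ) × (Fin p → ℝ) =>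
      centred q.1 i := fun i => (continuous_centred i).comp continuous_fst
  unfold sampleT
  fun_prop

theorem continuous_sampleCov_apply (a b : Fin p) :
    Continuous fun X : Fin n → Fin p → ℝ => sampleCov X a b := by
  have h := fun (i : Fin n) (a : Fin p) => continuous_centred_apply i a
  simp only [sampleCov_apply]
  fun_prop

theorem continuous_newtonMap (hG : Continuous G) (hg : Continuous (deriv G)) (κ : Fin p → Fin p → ℝ)
    (θ : ℝ) (ν lam δ : Fin p → ℝ) :
    Continuous fun q : (Fin n → Fin p → ℝ) × (Fin p → Fin p → ℝ) =>
      newtonMap G κ θ ν lam δ q.1 q.2 := by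
  have hrow : ∀ j, Continuous fun q : (Fin n → Fin p → ℝ) × (Fin p → Fin p → ℝ) =>
      (q.1, q.2 j) := fun j => by fun_prop
  have h1 : ∀ j, Continuous fun q : (Fin n → Fin p → ℝ) × (Fin p → Fin p → ℝ) =>
      sampleG G q.1 (q.2 j) := fun j => (continuous_sampleG hG).comp (hrow j)
  have h2' : ∀ j, Continuous fun q : (Fin n → Fin p → ℝ) × (Fin p → Fin p → ℝ) =>
      sampleT G q.1 (q.2 j) := fun j => by
    have := (continuous_sampleT (n := n) (p := p) hg).comp (hrow j)
    exact this
  have h2'' : ∀ l, Continuous fun q : (Fin n → Fin p → ℝ) × (Fin p → Fin p → ℝ) => q.2 l :=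
    fun l => by fun_prop
  have h2 : ∀ j l, Continuous fun q : (Fin n → Fin p → ℝ) × (Fin p → Fin p → ℝ) =>
      q.2 l ⬝ᵥ sampleT G q.1 (q.2 j) := fun j l => (h2'' l).dotProduct (h2' j)
  have h3 : ∀ a b, Continuous fun q : (Fin n → Fin p → ℝ) × (Fin p → Fin p → ℝ) =>
      sampleCov q.1 a b := fun a b => (continuous_sampleCov_apply a b).comp continuous_fst
  have h4 : ∀ j l, Continuous fun q : (Fin n → Fin p → ℝ) × (Fin p → Fin p → ℝ) =>
      covForm q.1 q.2 j l := fun j l => by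
    simp only [covForm_eq_sum]
    fun_prop
  refine continuous_pi fun j => continuous_pi fun l => ?_
  simp only [newtonMap, estEq]
  split_ifs <;> fun_prop

/-- Every iterate is a continuous function of the sample. The upper limit is measurable whether or
not the iteration converges, and it is the limit when it does. -/
theorem measurable_newtonLimit (hG : Continuous G) (hg : Continuous (deriv G))
    (κ : Fin p → Fin p → ℝ) (θ : ℝ) (ν lam δ : Fin p → ℝ) (j l : Fin p) :
    Measurable fun X : Fin n → Fin p → ℝ => newtonLimit G κ θ ν lam δ n X j l := by
  refine Measurable.limsup fun k => ?_
  have : Continuous fun X : Fin n → Fin p → ℝ =>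
      (fun Γ => Γ - newtonMap G κ θ ν lam δ X Γ)^[k] (unitRows p) := by
    induction k with
    | zero => exact continuous_const
    | succ k ih =>
      simp only [Function.iterate_succ', Function.comp_apply]
      exact ih.sub ((continuous_newtonMap hG hg κ θ ν lam δ).comp (continuous_id.prodMk ih))
  exact ((continuous_apply l).comp ((continuous_apply j).comp this)).measurable

end Equations

/-! ### Sample quantities in terms of the sources -/

section Link

variable {Ω : Type*} {p : ℕ} {z x : ℕ → Ω → Fin p → ℝ} {loc : Fin p → ℝ}

/-- The sample of the first `n` observations. -/
def obs (x : ℕ → Ω → Fin p → ℝ) (q : ℕ × Ω) : Fin q.1 → Fin p → ℝ := fun i => x i q.2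

theorem centred_obs (hx : ∀ i ω, x i ω = loc + z i ω) (q : ℕ × Ω) (i : Fin q.1) :
    centred (obs x q) i = z i q.2 - zbar z q := by
  have hq : (q.1 : ℝ) ≠ 0 := by
    have := i.pos
    positivity
  have h1 : sampleMean (obs x q) = loc + zbar z q := by
    ext a
    have : ∑ i : Fin q.1, z i q.2 a = ∑ i ∈ Finset.range q.1, z i q.2 a :=
      Fin.sum_univ_eq_sum_range (fun i => z i q.2 a) q.1
    simp only [sampleMean, obs, hx, Pi.smul_apply, Finset.sum_apply, Pi.add_apply, smul_eq_mul,
      Finset.sum_add_distrib, Finset.sum_const, Finset.card_univ, Fintype.card_fin, nsmul_eq_mul,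
      Pi.mul_apply, Pi.natCast_apply, zbar, avg, this]
    field_simp
  rw [centred, h1, obs, hx]
  abel

theorem sampleG_obs (hx : ∀ i ω, x i ω = loc + z i ω) (G : ℝ → ℝ) (q : ℕ × Ω)
    (Γ : Fin p → Fin p → ℝ) (j : Fin p) :
    sampleG G (obs x q) (Γ j) = rowAvg z G (fun _ => 1) j q Γ := by
  simp only [sampleG, rowAvg, centred_obs hx, mul_one]
  rw [Fin.sum_univ_eq_sum_range (fun i => G (Γ j ⬝ᵥ (z i q.2 - zbar z q)))]

theorem sampleT_obs (hx : ∀ i ω, x i ω = loc + z i ω) (G : ℝ → ℝ) (q : ℕ × Ω)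
    (Γ : Fin p → Fin p → ℝ) (j a : Fin p) :
    sampleT G (obs x q) (Γ j) a = rowAvg z (deriv G) (fun v => v a) j q Γ := by
  simp only [sampleT, rowAvg, centred_obs hx, Pi.smul_apply, Finset.sum_apply, smul_eq_mul]
  rw [Fin.sum_univ_eq_sum_range
    (fun i => deriv G (Γ j ⬝ᵥ (z i q.2 - zbar z q)) * (z i q.2 - zbar z q) a)]

theorem sampleCov_obs (hx : ∀ i ω, x i ω = loc + z i ω) (q : ℕ × Ω) (a b : Fin p) :
    sampleCov (obs x q) a b = avg z (fun v => v a * v b) q - zbar z q a * zbar z q b := by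
  simp only [sampleCov_apply, centred_obs hx, Pi.sub_apply]
  rw [Fin.sum_univ_eq_sum_range
    (fun i => (z i q.2 a - zbar z q a) * (z i q.2 b - zbar z q b))]
  rcases Nat.eq_zero_or_pos q.1 with h | h
  · simp [avg, zbar, h]
  have hq : (q.1 : ℝ) ≠ 0 := by positivity
  have e : ∀ a, ∑ i ∈ Finset.range q.1, z i q.2 a = q.1 * zbar z q a := fun a => by
    simp only [zbar, avg]; field_simp
  have : ∀ i, (z i q.2 a - zbar z q a) * (z i q.2 b - zbar z q b) =
      z i q.2 a * z i q.2 b - zbar z q a * z i q.2 b - z i q.2 a * zbar z q b +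
        zbar z q a * zbar z q b := fun i => by ring
  simp only [this, Finset.sum_add_distrib, Finset.sum_sub_distrib, ← Finset.mul_sum,
    ← Finset.sum_mul, e, avg, Finset.sum_const, Finset.card_range, nsmul_eq_mul]
  field_simp
  ring

end Link

/-! ### The solution of the estimating equations -/

namespace ICModel

variable {Ω : Type*} [MeasurableSpace Ω] {p : ℕ} {P : Measure Ω} {G : ℝ → ℝ}
  {z x : ℕ → Ω → Fin p → ℝ} {loc ν μ lam δ : Fin p → ℝ} [IsProbabilityMeasure P]

theorem tendsto_sampleCov (h : ICModel P G z ν μ lam δ) (hx : ∀ i ω, x i ω = loc + z i ω)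
    (a b : Fin p) :
    Tendsto (fun q => sampleCov (obs x q) a b) (probFilter P) (𝓝 (if a = b then 1 else 0)) := by
  have h1 := h.isIID.tendsto_avg (φ := fun v => v a * v b) (by fun_prop)
    (h.integrable_coord_mul_coord a b)
  rw [h.integral_coord_mul_coord] at h1
  have h2 := (tendsto_pi_nhds.mp h.tendsto_zbar a).mul (tendsto_pi_nhds.mp h.tendsto_zbar b)
  have h3 := h1.sub h2
  simp only [Pi.zero_apply, mul_zero, sub_zero] at h3
  exact h3.congr fun q => (sampleCov_obs hx q a b).symm

theorem strictDeriv_covForm (h : ICModel P G z ν μ lam δ) (hx : ∀ i ω, x i ω = loc + z i ω)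
    (j l : Fin p) :
    StrictDerivAlong (probFilter P) radius (unitRows p) (fun q Γ => covForm (obs x q) Γ j l)
      (entry j l + entry l j) (if j = l then 1 else 0) := by
  have h1 : ∀ a b, _ := fun a b =>
    (StrictDerivAlong.of_clm (l := probFilter P) (r := radius) (x₀ := unitRows p) (entry l a)).mul
      ((StrictDerivAlong.of_clm (l := probFilter P) (r := radius) (x₀ := unitRows p)
        (entry j b)).mul (StrictDerivAlong.of_const (h.tendsto_sampleCov hx a b))
        tendsto_radius radius_nonneg) tendsto_radius radius_nonneg
  have h2 := StrictDerivAlong.sum Finset.univ fun a _ =>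
    StrictDerivAlong.sum Finset.univ fun b _ => h1 a b
  simp only [entry_apply, ← covForm_eq_sum] at h2
  refine h2.congr_clm (fun y => ?_) ?_
  · simp [unitRows, Finset.sum_add_distrib]
  · simp [unitRows, eq_comm]

/-- Of the sum over coordinates a of γ_la T̂(γ_j)_a, the term a = l contributes δ_j γ_jl and the
term a = j contributes λ_j γ_lj. In all other terms both factors tend to 0 at the identity. -/
theorem strictDeriv_proj_T (h : ICModel P G z ν μ lam δ) (hx : ∀ i ω, x i ω = loc + z i ω)
    {j l : Fin p} (hjl : j ≠ l) :
    StrictDerivAlong (probFilter P) radius (unitRows p)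
      (fun q Γ => Γ l ⬝ᵥ sampleT G (obs x q) (Γ j)) (δ j • entry j l + lam j • entry l j) 0 := by
  have h1 : ∀ a, StrictDerivAlong (probFilter P) radius (unitRows p)
      (fun q Γ => Γ l a * rowAvg z (deriv G) (fun v => v a) j q Γ)
      ((if l = a then δ j else 0) • entry j a + (if a = j then lam j else 0) • entry l a) 0 := by
    intro a
    by_cases ha : a = j
    · subst ha
      refine (h.strictDeriv_mul_T_diag (Ne.symm hjl)).congr_clm (fun y => ?_) rfl
      simp [Ne.symm hjl]
    · refine ((StrictDerivAlong.of_clm (entry l a)).mul (h.strictDeriv_T ha) tendsto_radius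
        radius_nonneg).congr_clm (fun y => ?_) ?_
      · simp [ha, unitRows]
      · simp
  have h2 := StrictDerivAlong.sum Finset.univ fun a _ => h1 a
  simp only [← sampleT_obs hx] at h2
  refine h2.congr_clm (fun y => ?_) ?_
  · simp [Finset.sum_add_distrib]
  · simp

variable {κ : Fin p → Fin p → ℝ} {θ : ℝ}

theorem strictDeriv_weight (h : ICModel P G z ν μ lam δ) (hx : ∀ i ω, x i ω = loc + z i ω)
    (κ : Fin p → Fin p → ℝ) (θ : ℝ) (j l : Fin p) :
    StrictDerivAlong (probFilter P) radius (unitRows p)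
      (fun q Γ => κ j l + θ * sampleG G (obs x q) (Γ j)) (θ • lam j • entry j j)
      (limitWeight κ θ ν j l) := by
  have h1 := (StrictDerivAlong.of_const (l := probFilter P) (r := radius) (x₀ := unitRows p)
    (tendsto_const_nhds (x := κ j l))).add ((h.strictDeriv_G j).const_mul θ)
  simp only [← sampleG_obs hx, zero_add] at h1
  exact h1

/-- With A = w_jl λ_j − w_lj δ_l, the derivative of A γ_lᵀŜγ_j − E_jl has coefficient A − w_jl λ_j +
w_lj δ_l = 0 at γ_lj, and coefficient w_jl(λ_j − δ_j) + w_lj(λ_l − δ_l), the slope, at γ_jl. The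
derivative of the weights does not enter, since they multiply functionals with value 0 in the limit.
-/
theorem strictDeriv_newtonMap (h : ICModel P G z ν μ lam δ) (hx : ∀ i ω, x i ω = loc + z i ω)
    (hD : ∀ j l, j ≠ l → pairSlope κ θ ν lam δ j l ≠ 0) (j l : Fin p) :
    StrictDerivAlong (probFilter P) radius (unitRows p)
      (fun q Γ => newtonMap G κ θ ν lam δ (obs x q) Γ j l) (entry j l) 0 := by
  by_cases hjl : j = l
  · subst hjl
    have h1 := ((h.strictDeriv_covForm hx j j).sub
      (StrictDerivAlong.of_const (tendsto_const_nhds (x := (1 : ℝ))))).const_mul (1 / 2)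
    simp only [newtonMap, if_true]
    have e : (fun (q : ℕ × Ω) Γ => (covForm (obs x q) Γ j j - 1) / 2) =
        fun q Γ => 1 / 2 * (covForm (obs x q) Γ j j - 1) := by ext; ring
    rw [e]
    refine h1.congr_clm (fun y => ?_) (by simp)
    simp only [smul_apply, sub_apply, add_apply, zero_apply, entry_apply, smul_eq_mul]
    ring
  · have hE := ((h.strictDeriv_weight hx κ θ j l).mul (h.strictDeriv_proj_T hx hjl) tendsto_radius
      radius_nonneg).sub ((h.strictDeriv_weight hx κ θ l j).mul
        (h.strictDeriv_proj_T hx (Ne.symm hjl)) tendsto_radius radius_nonneg)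
    have h1 := (((h.strictDeriv_covForm hx j l).const_mul
      (limitWeight κ θ ν j l * lam j - limitWeight κ θ ν l j * δ l)).sub hE).const_mul
        (pairSlope κ θ ν lam δ j l)⁻¹
    have hs := hD j l hjl
    simp only [newtonMap, if_neg hjl, div_eq_inv_mul, estEq]
    refine h1.congr_clm (fun y => ?_) (by simp [hjl])
    simp only [smul_apply, sub_apply, add_apply, entry_apply, smul_eq_mul]
    rw [inv_mul_eq_iff_eq_mul₀ hs, pairSlope]
    ring

end ICModel

/-! ### Asymptotic expansion of the solution -/

namespace ICModel

variable {Ω : Type*} [MeasurableSpace Ω] {p : ℕ} {P : Measure Ω} {G : ℝ → ℝ}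
  {z x : ℕ → Ω → Fin p → ℝ} {loc ν μ lam δ : Fin p → ℝ}
  {κ : Fin p → Fin p → ℝ} {θ : ℝ}

theorem memLp_coord_mul (h : ICModel P G z ν μ lam δ) {j a : Fin p} (hja : j ≠ a)
    {f u : ℝ → ℝ} (hf : Measurable f) (hu : Measurable u)
    (hfi : MemLp (fun ω => f (z 0 ω j)) 2 P) (hui : MemLp (fun ω => u (z 0 ω a)) 2 P) :
    MemLp (fun ω => f (z 0 ω j) * u (z 0 ω a)) 2 P := by
  have m1 := hf.comp (h.measurable_coord j)
  have m2 := hu.comp (h.measurable_coord a)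
  have m : Measurable fun ω => f (z 0 ω j) * u (z 0 ω a) := m1.mul m2
  refine (memLp_two_iff_integrable_sq m.aestronglyMeasurable).2 ?_
  refine (h.integrable_coord_mul hja (hf.pow_const 2) (hu.pow_const 2) hfi.integrable_sq
    hui.integrable_sq).congr (ae_of_all _ fun ω => ?_)
  ring

theorem memLp_coord_sq (h : ICModel P G z ν μ lam δ) (j : Fin p) :
    MemLp (fun ω => z 0 ω j ^ 2) 2 P := by
  rw [memLp_two_iff_integrable_sq ((h.measurable_coord j).pow_const 2).aestronglyMeasurable]
  refine (h.moments j).beta.congr (ae_of_all _ fun ω => ?_)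
  ring

theorem measurable_score (h : ICModel P G z ν μ lam δ) (j : Fin p) (c : ℝ) :
    Measurable fun t => deriv G t - μ j - c * t := by
  have := h.continuous_deriv.measurable
  fun_prop

theorem measurable_influence (h : ICModel P G z ν μ lam δ) (κ : Fin p → Fin p → ℝ) (θ : ℝ)
    (j l : Fin p) : Measurable (influence G κ θ ν μ lam δ j l) := by
  have := h.continuous_deriv.measurable
  unfold influence
  split_ifs <;> fun_prop

/-- Here the perturbation depends on the sample, as do the intermediate points of the mean value
theorem. -/
theorem _root_.UniformAvg.tendsto_perturbedAvg {f : ℝ → ℝ} {m : (Fin p → ℝ) → ℝ}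
    {j : Fin p} {c : ℝ} (hU : UniformAvg P z f m j c) {d : ℕ × Ω → ℕ → ℝ}
    (hd : ∀ ρ > 0, ∀ᶠ q in probFilter P, ∀ i < q.1, |d q i| ≤ ρ) :
    Tendsto (fun q => perturbedAvg z f m j (d q) q) (probFilter P) (𝓝 c) := by
  rw [Metric.tendsto_nhds]
  intro ε hε
  obtain ⟨ρ, hρ, e1⟩ := hU (ε / 2) (half_pos hε)
  filter_upwards [e1, hd ρ hρ] with q h1 h2
  exact (h1 _ h2).trans_lt (half_lt_self hε)

variable [IsProbabilityMeasure P]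

theorem memLp_score (h : ICModel P G z ν μ lam δ) (j : Fin p) (c : ℝ) :
    MemLp (fun ω => deriv G (z 0 ω j) - μ j - c * z 0 ω j) 2 P :=
  ((h.moments j).sigma.sub (memLp_const _)).sub ((h.source.memLp j).const_mul c)

theorem integral_score (h : ICModel P G z ν μ lam δ) (j : Fin p) (c : ℝ) :
    ∫ ω, (deriv G (z 0 ω j) - μ j - c * z 0 ω j) ∂P = 0 := by
  have i1 : Integrable (fun ω => deriv G (z 0 ω j) - μ j) P :=
    (h.integrable_deriv j).sub (integrable_const _)
  rw [integral_sub i1 ((h.integrable_coord j).const_mul c), integral_sub (h.integrable_deriv j) (integrable_const _),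
    integral_const_mul, h.source.mean, h.mu_eq]
  simp

theorem memLp_influence (h : ICModel P G z ν μ lam δ) (κ : Fin p → Fin p → ℝ) (θ : ℝ)
    (j l : Fin p) : MemLp (fun ω => influence G κ θ ν μ lam δ j l (z 0 ω)) 2 P := by
  by_cases hjl : j = l
  · simp only [influence, if_pos hjl]
    have := (((h.memLp_coord_sq j).sub (memLp_const (1 : ℝ))).neg).mul_const (1 / 2)
    refine this.ae_eq (ae_of_all _ fun ω => ?_)
    simp only [Pi.neg_apply, Pi.sub_apply]
    ring
  · simp only [influence, if_neg hjl]
    have h1 := h.memLp_coord_mul hjl (h.measurable_score j (lam j)) measurable_id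
      (h.memLp_score j (lam j)) (h.source.memLp l)
    have h2 := h.memLp_coord_mul (Ne.symm hjl) (h.measurable_score l (δ l)) measurable_id
      (h.memLp_score l (δ l)) (h.source.memLp j)
    have := ((h1.const_mul (limitWeight κ θ ν j l)).sub
      (h2.const_mul (limitWeight κ θ ν l j))).mul_const (pairSlope κ θ ν lam δ j l)⁻¹
    refine this.ae_eq (ae_of_all _ fun ω => ?_)
    simp only [Pi.sub_apply, id]
    ring

theorem integral_influence (h : ICModel P G z ν μ lam δ) (κ : Fin p → Fin p → ℝ) (θ : ℝ)
    (j l : Fin p) : ∫ ω, influence G κ θ ν μ lam δ j l (z 0 ω) ∂P = 0 := by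
  by_cases hjl : j = l
  · simp only [influence, if_pos hjl]
    rw [integral_div, integral_neg, integral_sub ((h.source.memLp j).integrable_sq)
      (integrable_const _), h.source.second_moment]
    simp
  · simp only [influence, if_neg hjl]
    have i1 := h.integrable_coord_mul hjl (h.measurable_score j (lam j)) measurable_id
      ((h.memLp_score j (lam j)).integrable one_le_two) (h.integrable_coord l)
    have i2 := h.integrable_coord_mul (Ne.symm hjl) (h.measurable_score l (δ l)) measurable_id
      ((h.memLp_score l (δ l)).integrable one_le_two) (h.integrable_coord j)
    have h1 := h.integral_coord_mul hjl (h.measurable_score j (lam j)) measurable_id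
    have h2 := h.integral_coord_mul (Ne.symm hjl) (h.measurable_score l (δ l)) measurable_id
    simp only [id, h.integral_score, zero_mul] at h1 h2 i1 i2
    rw [integral_div, integral_sub (i1.const_mul _) (i2.const_mul _), integral_const_mul,
      integral_const_mul, h1, h2]
    simp

theorem bddInProb_influence (h : ICModel P G z ν μ lam δ) (κ : Fin p → Fin p → ℝ) (θ : ℝ)
    (j l : Fin p) : BddInProb P (normSum z (influence G κ θ ν μ lam δ j l)) :=
  h.isIID.bddInProb_normSum (h.measurable_influence κ θ j l) (h.memLp_influence κ θ j l)
    (h.integral_influence κ θ j l)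

theorem bddInProb_zbar (h : ICModel P G z ν μ lam δ) (a : Fin p) :
    BddInProb P (fun q => √(q.1 : ℝ) * zbar z q a) := by
  have := h.isIID.bddInProb_normSum (φ := fun v => v a) (measurable_pi_apply a)
    (h.source.memLp a) (h.source.mean a)
  refine this.congr' (Eventually.of_forall fun q => ?_)
  rw [← sqrt_mul_avg]; rfl

theorem tendsto_zbar_apply (h : ICModel P G z ν μ lam δ) (a : Fin p) :
    Tendsto (fun q => zbar z q a) (probFilter P) (𝓝 0) :=
  tendsto_pi_nhds.mp h.tendsto_zbar a

theorem tendsto_sqrt_mul_sampleCov (h : ICModel P G z ν μ lam δ)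
    (hx : ∀ i ω, x i ω = loc + z i ω) (a b : Fin p) :
    Tendsto (fun q => √(q.1 : ℝ) * sampleCov (obs x q) a b - normSum z (fun v => v a * v b) q)
      (probFilter P) (𝓝 0) := by
  have := (h.bddInProb_zbar b _ (h.tendsto_zbar_apply a)).neg
  rw [neg_zero] at this
  refine this.congr fun q => ?_
  rw [sampleCov_obs hx, ← sqrt_mul_avg]
  ring

/-- Centring by z̄_l turns g into g − μ_j, up to √n z̄_l times the negligible avg g(z_j) − μ_j.
Centring inside g costs √n z̄_j times an average that tends to E[g'(z_j)]E[z_l] = 0. -/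
theorem tendsto_sqrt_mul_T (h : ICModel P G z ν μ lam δ) {j l : Fin p} (hjl : j ≠ l) :
    Tendsto (fun q => √(q.1 : ℝ) * rowAvg z (deriv G) (fun v => v l) j q (unitRows p) -
      normSum z (fun v => (deriv G (v j) - μ j) * v l) q) (probFilter P) (𝓝 0) := by
  have e : ∀ q i, unitRows p j ⬝ᵥ (z i q.2 - zbar z q) - z i q.2 j = - zbar z q j := by
    intro q i
    simp [unitRows, dotProduct]
  choose d h1 h2 using fun q => exists_rowAvg_sub z h.hasDerivAt_deriv (fun v => v l) j q
    (fun _ => - zbar z q j) (fun i => z i q.2 j) (unitRows p) (fun i _ => e q i)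
  have hR : Tendsto (fun q => perturbedAvg z (deriv (deriv G)) (fun v => v l) j (d q) q)
      (probFilter P) (𝓝 0) := by
    refine UniformAvg.tendsto_perturbedAvg (h.uniformAvg_deriv2_coord (Ne.symm hjl)) fun ρ hρ => ?_
    filter_upwards [h.eventually_abs_projection_sub_le hρ] with q hq i hi
    exact h2 q ρ i (hq _ (Metric.mem_closedBall_self (radius_nonneg q)) i hi j)
      (by simpa using hρ.le)
  have hg : Tendsto (fun q => avg z (fun v => deriv G (v j)) q - μ j) (probFilter P) (𝓝 0) := by
    have := h.isIID.tendsto_avg (φ := fun v => deriv G (v j))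
      (by have := h.continuous_deriv.measurable; fun_prop) (h.integrable_deriv j)
    rw [h.mu_eq] at this
    simpa using this.sub_const (μ j)
  have h3 := ((h.bddInProb_zbar l _ hg).add (h.bddInProb_zbar j _ hR)).neg
  rw [add_zero, neg_zero] at h3
  refine h3.congr fun q => ?_
  rcases Nat.eq_zero_or_pos q.1 with hq0 | hq0
  · simp [hq0, normSum]
  have hq : (q.1 : ℝ) ≠ 0 := by positivity
  have h4 : rowAvg z (deriv G) (fun v => v l) j q (unitRows p) =
      avg z (fun v => (deriv G (v j) - μ j) * v l) q + μ j * zbar z q l -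
        zbar z q l * avg z (fun v => deriv G (v j)) q -
        zbar z q j * perturbedAvg z (deriv (deriv G)) (fun v => v l) j (d q) q := by
    have h5 := h1 q
    have h6 : (q.1 : ℝ)⁻¹ * ∑ i ∈ Finset.range q.1, deriv (deriv G) (z i q.2 j + d q i) *
        (-zbar z q j * (z i q.2 - zbar z q) l) =
        - (zbar z q j * perturbedAvg z (deriv (deriv G)) (fun v => v l) j (d q) q) := by
      simp only [perturbedAvg, Finset.mul_sum, ← Finset.sum_neg_distrib]
      exact Finset.sum_congr rfl fun i _ => by ring
    have h7 : (q.1 : ℝ)⁻¹ * ∑ i ∈ Finset.range q.1, deriv G (z i q.2 j) * (z i q.2 - zbar z q) l =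
        avg z (fun v => (deriv G (v j) - μ j) * v l) q + μ j * zbar z q l -
        zbar z q l * avg z (fun v => deriv G (v j)) q := by
      have : zbar z q l = (q.1 : ℝ)⁻¹ * ∑ i ∈ Finset.range q.1, z i q.2 l := rfl
      simp only [avg, Pi.sub_apply, mul_sub, sub_mul, Finset.sum_sub_distrib, ← Finset.mul_sum,
        ← Finset.sum_mul]
      rw [this]
      ring
    have h8 : rowAvg z (deriv G) (fun v => v l) j q (unitRows p) =
        (q.1 : ℝ)⁻¹ * ∑ i ∈ Finset.range q.1,
          (deriv G (unitRows p j ⬝ᵥ (z i q.2 - zbar z q)) - deriv G (z i q.2 j)) *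
            (z i q.2 - zbar z q) l +
        (q.1 : ℝ)⁻¹ * ∑ i ∈ Finset.range q.1, deriv G (z i q.2 j) * (z i q.2 - zbar z q) l := by
      rw [← mul_add, ← Finset.sum_add_distrib, rowAvg]
      congr 1
      exact Finset.sum_congr rfl fun i _ => by ring
    rw [h8, h5, h6, h7]
    ring
  rw [h4, ← sqrt_mul_avg]
  ring

theorem unitRows_dotProduct (j : Fin p) (v : Fin p → ℝ) : unitRows p j ⬝ᵥ v = v j := by
  simp [unitRows, dotProduct]

theorem covForm_unitRows {n : ℕ} (X : Fin n → Fin p → ℝ) (j l : Fin p) :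
    covForm X (unitRows p) j l = sampleCov X l j := by
  rw [covForm, unitRows_dotProduct, Matrix.mulVec, dotProduct_comm, unitRows_dotProduct]

/-- The random weight may be replaced by its limit, since it multiplies √n times a quantity that is
bounded in probability after this scaling. -/
theorem tendsto_sqrt_mul_weighted_T (h : ICModel P G z ν μ lam δ)
    (hx : ∀ i ω, x i ω = loc + z i ω) (κ : Fin p → Fin p → ℝ) (θ : ℝ) {j l : Fin p}
    (hjl : j ≠ l) :
    Tendsto (fun q => √(q.1 : ℝ) * ((κ j l + θ * sampleG G (obs x q) (unitRows p j)) *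
        (unitRows p l ⬝ᵥ sampleT G (obs x q) (unitRows p j))) -
      limitWeight κ θ ν j l * normSum z (fun v => (deriv G (v j) - μ j) * v l) q)
      (probFilter P) (𝓝 0) := by
  have h1 := h.tendsto_sqrt_mul_T hjl
  have h2 := (h.strictDeriv_weight hx κ θ j l).tendsto
  have h3 : Tendsto (fun q => κ j l + θ * sampleG G (obs x q) (unitRows p j) -
      limitWeight κ θ ν j l) (probFilter P) (𝓝 0) := by
    simpa using h2.sub_const (limitWeight κ θ ν j l)
  have hB : BddInProb P (normSum z (fun v => (deriv G (v j) - μ j) * v l)) := by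
    have h0 := h.integral_score j 0
    simp only [zero_mul, sub_zero] at h0
    have hs := h.memLp_coord_mul hjl (h.measurable_score j 0) measurable_id (h.memLp_score j 0)
      (h.source.memLp l)
    have hi := h.integral_coord_mul hjl (h.measurable_score j 0) measurable_id
    have hm := h.measurable_score j 0
    simp only [zero_mul, id, sub_zero, h0] at hs hi hm
    exact h.isIID.bddInProb_normSum (by fun_prop) hs hi
  have h4 := (h2.mul h1).add (hB _ h3)
  simp only [mul_zero, add_zero] at h4
  refine h4.congr fun q => ?_
  rw [unitRows_dotProduct, sampleT_obs hx]
  ring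

theorem tendsto_sqrt_mul_newtonMap (h : ICModel P G z ν μ lam δ)
    (hx : ∀ i ω, x i ω = loc + z i ω) (κ : Fin p → Fin p → ℝ) (θ : ℝ) (j l : Fin p) :
    Tendsto (fun q => √(q.1 : ℝ) * newtonMap G κ θ ν lam δ (obs x q) (unitRows p) j l +
      normSum z (influence G κ θ ν μ lam δ j l) q) (probFilter P) (𝓝 0) := by
  by_cases hjl : j = l
  · subst hjl
    have h1 := (h.tendsto_sqrt_mul_sampleCov hx j j).div_const 2
    rw [zero_div] at h1
    refine h1.congr' ?_
    filter_upwards [tendsto_fst_probFilter.eventually_gt_atTop 0] with q hq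
    have h2 : normSum z (influence G κ θ ν μ lam δ j j) q =
        -(normSum z (fun v => v j * v j) q - √(q.1 : ℝ)) / 2 := by
      have e : influence G κ θ ν μ lam δ j j = fun v => (1 / 2) * (1 - v j * v j) := by
        ext v
        simp only [influence, if_true]
        ring
      rw [e, ← sqrt_mul_avg, ← sqrt_mul_avg, avg_const_mul, avg_sub, avg_const _ hq]
      ring
    rw [newtonMap, if_pos rfl, h2, covForm_unitRows]
    ring
  · have h1 := h.tendsto_sqrt_mul_weighted_T hx κ θ hjl
    have h2 := h.tendsto_sqrt_mul_weighted_T hx κ θ (Ne.symm hjl)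
    have h3 := (h.tendsto_sqrt_mul_sampleCov hx l j).const_mul
      (limitWeight κ θ ν j l * lam j - limitWeight κ θ ν l j * δ l)
    have h4 := (h3.sub (h1.sub h2)).div_const (pairSlope κ θ ν lam δ j l)
    simp only [mul_zero, sub_zero, zero_div] at h4
    refine h4.congr fun q => ?_
    have e : normSum z (influence G κ θ ν μ lam δ j l) q =
        (limitWeight κ θ ν j l * normSum z (fun v => (deriv G (v j) - μ j) * v l) q -
        limitWeight κ θ ν l j * normSum z (fun v => (deriv G (v l) - μ l) * v j) q -
        (limitWeight κ θ ν j l * lam j - limitWeight κ θ ν l j * δ l) *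
          normSum z (fun v => v l * v j) q) / pairSlope κ θ ν lam δ j l := by
      simp only [normSum, Finset.mul_sum, ← Finset.sum_sub_distrib, Finset.sum_div]
      refine Finset.sum_congr rfl fun i _ => ?_
      simp only [influence, if_neg hjl]
      ring
    rw [newtonMap, if_neg hjl, e, covForm_unitRows, estEq]
    ring

theorem bddInProb_sqrt_mul_norm_newtonMap (h : ICModel P G z ν μ lam δ)
    (hx : ∀ i ω, x i ω = loc + z i ω) (κ : Fin p → Fin p → ℝ) (θ : ℝ) :
    BddInProb P (fun q => √(q.1 : ℝ) *
      ‖newtonMap G κ θ ν lam δ (obs x q) (unitRows p)‖) := by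
  have h1 : ∀ j l, BddInProb P (fun q => √(q.1 : ℝ) *
      newtonMap G κ θ ν lam δ (obs x q) (unitRows p) j l) := fun j l => by
    have := (BddInProb.of_tendsto (h.tendsto_sqrt_mul_newtonMap hx κ θ j l)).sub
      (h.bddInProb_influence κ θ j l)
    exact this.congr' (Eventually.of_forall fun q => by ring)
  have h2 : BddInProb P (fun q => ∑ j, ∑ l, |√(q.1 : ℝ) *
      newtonMap G κ θ ν lam δ (obs x q) (unitRows p) j l|) :=
    BddInProb.sum _ fun j _ => BddInProb.sum _ fun l _ => (h1 j l).abs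
  refine h2.mono (Eventually.of_forall fun q => ?_)
  rw [abs_of_nonneg (by positivity), abs_of_nonneg (by positivity)]
  simp only [abs_mul, abs_of_nonneg (Real.sqrt_nonneg (q.1 : ℝ)), ← Finset.mul_sum]
  gcongr
  rw [pi_norm_le_iff_of_nonneg (by positivity)]
  intro j
  rw [pi_norm_le_iff_of_nonneg (by positivity)]
  intro l
  exact (Finset.single_le_sum (f := fun l =>
    |newtonMap G κ θ ν lam δ (obs x q) (unitRows p) j l|) (fun _ _ => abs_nonneg _)
    (Finset.mem_univ l)).trans (Finset.single_le_sum (f := fun j => ∑ l,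
    |newtonMap G κ θ ν lam δ (obs x q) (unitRows p) j l|) (fun _ _ => by positivity)
    (Finset.mem_univ j))

/-- The left side is O_P(n^(-1/2)), of smaller order than the radius n^(-3/8). -/
theorem eventually_norm_newtonMap_le (h : ICModel P G z ν μ lam δ)
    (hx : ∀ i ω, x i ω = loc + z i ω) (κ : Fin p → Fin p → ℝ) (θ : ℝ) :
    ∀ᶠ q in probFilter P,
      ‖newtonMap G κ θ ν lam δ (obs x q) (unitRows p)‖ ≤ radius q / 2 := by
  have h1 := h.bddInProb_sqrt_mul_norm_newtonMap hx κ θ _ tendsto_inv_scale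
  filter_upwards [h1.eventually (gt_mem_nhds (by norm_num : (0 : ℝ) < 1 / 2)),
    eventually_one_le_scale (P := P)] with q h2 h3
  have hs : 0 < scale q.1 := by linarith
  rw [sqrt_eq_scale_pow] at h2
  rw [radius, inv_eq_one_div, div_div, le_div_iff₀ (by positivity)]
  have h4 : (scale q.1)⁻¹ * (scale q.1 ^ 4 *
      ‖newtonMap G κ θ ν lam δ (obs x q) (unitRows p)‖) =
      scale q.1 ^ 3 * ‖newtonMap G κ θ ν lam δ (obs x q) (unitRows p)‖ := by
    field_simp
  rw [h4] at h2
  linarith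

theorem eventually_newtonMap_approx (h : ICModel P G z ν μ lam δ)
    (hx : ∀ i ω, x i ω = loc + z i ω) (hD : ∀ j l, j ≠ l → pairSlope κ θ ν lam δ j l ≠ 0)
    {η : ℝ} (hη : 0 < η) :
    ∀ᶠ q in probFilter P, ∀ y ∈ Metric.closedBall (unitRows p) (radius q),
      ∀ y' ∈ Metric.closedBall (unitRows p) (radius q),
      ‖newtonMap G κ θ ν lam δ (obs x q) y - newtonMap G κ θ ν lam δ (obs x q) y' - (y - y')‖ ≤
        η * ‖y - y'‖ := by
  have e1 := eventually_all.mpr fun j => eventually_all.mpr fun l =>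
    (h.strictDeriv_newtonMap hx hD j l).approx η hη
  filter_upwards [e1] with q h1 y hy y' hy'
  rw [pi_norm_le_iff_of_nonneg (by positivity)]
  intro j
  rw [pi_norm_le_iff_of_nonneg (by positivity)]
  intro l
  exact h1 j l y hy y' hy'

theorem eventually_newtonLimit (h : ICModel P G z ν μ lam δ)
    (hx : ∀ i ω, x i ω = loc + z i ω) (hD : ∀ j l, j ≠ l → pairSlope κ θ ν lam δ j l ≠ 0)
    {η : ℝ} (hη : 0 < η) (hη' : η ≤ 1 / 2) :
    ∀ᶠ q in probFilter P,
      newtonLimit G κ θ ν lam δ q.1 (obs x q) ∈ Metric.closedBall (unitRows p) (radius q) ∧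
      newtonMap G κ θ ν lam δ (obs x q) (newtonLimit G κ θ ν lam δ q.1 (obs x q)) = 0 ∧
      ‖newtonLimit G κ θ ν lam δ q.1 (obs x q) - unitRows p +
        newtonMap G κ θ ν lam δ (obs x q) (unitRows p)‖ ≤
        2 * η * ‖newtonMap G κ θ ν lam δ (obs x q) (unitRows p)‖ := by
  filter_upwards [h.eventually_newtonMap_approx hx hD hη, h.eventually_norm_newtonMap_le hx κ θ]
    with q h1 h2
  obtain ⟨y, hy, hy0, hlim, hy1⟩ := exists_limit_newton hη hη' (radius_nonneg q) h1 h2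
  have : newtonLimit G κ θ ν lam δ q.1 (obs x q) = y := by
    ext j l
    exact (tendsto_pi_nhds.mp (tendsto_pi_nhds.mp hlim j) l).limsup_eq
  rw [this]
  exact ⟨hy, hy0, hy1⟩

/-- The solution is asymptotically linear in the influence functions. -/
theorem tendsto_sqrt_mul_newtonLimit (h : ICModel P G z ν μ lam δ)
    (hx : ∀ i ω, x i ω = loc + z i ω) (hD : ∀ j l, j ≠ l → pairSlope κ θ ν lam δ j l ≠ 0)
    (j l : Fin p) :
    Tendsto (fun q => √(q.1 : ℝ) *
        (newtonLimit G κ θ ν lam δ q.1 (obs x q) j l - unitRows p j l) -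
      normSum z (influence G κ θ ν μ lam δ j l) q) (probFilter P) (𝓝 0) := by
  have h1 : Tendsto (fun q => √(q.1 : ℝ) *
      (newtonLimit G κ θ ν lam δ q.1 (obs x q) - unitRows p +
        newtonMap G κ θ ν lam δ (obs x q) (unitRows p)) j l) (probFilter P) (𝓝 0) := by
    -- The remainder of the iteration is at most 2η‖Φ(I)‖ for each η with probability tending to
    -- one, and √n‖Φ(I)‖ is bounded in probability.
    refine (h.bddInProb_sqrt_mul_norm_newtonMap hx κ θ).tendsto_of_forall_le fun η hη => ?_
    have hη2 : 0 < min (η / 2) (1 / 2) := by positivity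
    filter_upwards [h.eventually_newtonLimit hx hD hη2 (min_le_right _ _)] with q hq
    rw [abs_mul, abs_mul, abs_norm, mul_left_comm]
    gcongr
    refine (abs_entry_le _ j l).trans (hq.2.2.trans ?_)
    gcongr
    linarith [min_le_left (η / 2) (1 / 2 : ℝ)]
  have h2 := h1.sub (h.tendsto_sqrt_mul_newtonMap hx κ θ j l)
  rw [sub_zero] at h2
  refine h2.congr fun q => ?_
  simp only [Pi.add_apply, Pi.sub_apply]
  ring

theorem tendsto_newtonLimit (h : ICModel P G z ν μ lam δ)
    (hx : ∀ i ω, x i ω = loc + z i ω) (hD : ∀ j l, j ≠ l → pairSlope κ θ ν lam δ j l ≠ 0)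
    (j l : Fin p) :
    Tendsto (fun q => newtonLimit G κ θ ν lam δ q.1 (obs x q) j l) (probFilter P)
      (𝓝 (unitRows p j l)) := by
  rw [Metric.tendsto_nhds]
  intro ε hε
  filter_upwards [h.eventually_newtonLimit hx hD (by norm_num : (0 : ℝ) < 1 / 2) le_rfl,
    tendsto_radius.eventually (gt_mem_nhds hε)] with q h1 h2
  rw [Real.dist_eq]
  have h3 : ‖newtonLimit G κ θ ν lam δ q.1 (obs x q) - unitRows p‖ ≤ radius q := by
    simpa [dist_eq_norm] using h1.1
  exact ((abs_entry_le _ j l).trans h3).trans_lt h2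

/-- Asymptotic expansion of the sample version of `E[G(γᵀ(x - E x))]` at a row of the solution. -/
theorem tendsto_sqrt_mul_sampleG (h : ICModel P G z ν μ lam δ)
    (hx : ∀ i ω, x i ω = loc + z i ω) (hD : ∀ j l, j ≠ l → pairSlope κ θ ν lam δ j l ≠ 0)
    (j : Fin p) :
    Tendsto (fun q => √(q.1 : ℝ) *
        (sampleG G (obs x q) (newtonLimit G κ θ ν lam δ q.1 (obs x q) j) - ν j) -
      normSum z (fun v => G (v j) - ν j - μ j * v j - lam j * (v j ^ 2 - 1) / 2) q)
      (probFilter P) (𝓝 0) := by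
  set Y : ℕ × Ω → Fin p → Fin p → ℝ := fun q => newtonLimit G κ θ ν lam δ q.1 (obs x q) with hY
  have hball : ∀ᶠ q in probFilter P, Y q ∈ Metric.closedBall (unitRows p) (radius q) :=
    (h.eventually_newtonLimit hx hD (by norm_num : (0 : ℝ) < 1 / 2) le_rfl).mono fun q hq => hq.1
  have hBdd : ∀ a, BddInProb P (fun q => √(q.1 : ℝ) * (Y q j a - unitRows p j a)) := fun a => by
    have := (BddInProb.of_tendsto (h.tendsto_sqrt_mul_newtonLimit hx hD j a)).add
      (h.bddInProb_influence κ θ j a)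
    exact this.congr' (Eventually.of_forall fun q => by simp only [hY]; ring)
  -- increments from the unit row
  choose d1 a1 a2 using fun q => exists_rowAvg_sub_rowAvg z h.hasDerivAt (fun _ => 1) j q (Y q)
    (unitRows p)
  have e : ∀ q i, unitRows p j ⬝ᵥ (z i q.2 - zbar z q) - z i q.2 j = - zbar z q j := by
    intro q i
    rw [unitRows_dotProduct]; simp
  choose d2 b1 b2 using fun q => exists_rowAvg_sub z h.hasDerivAt (fun _ => 1) j q
    (fun _ => - zbar z q j) (fun i => z i q.2 j) (unitRows p) (fun i _ => e q i)
  have hR1 : ∀ b, Tendsto (fun q => perturbedAvg z (deriv G) (fun v => 1 * v b) j (d1 q) q)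
      (probFilter P) (𝓝 (if b = j then lam j else 0)) := fun b => by
    simp only [one_mul]
    refine UniformAvg.tendsto_perturbedAvg (h.uniformAvg_deriv_coord j b) fun ρ hρ => ?_
    filter_upwards [h.eventually_abs_projection_sub_le hρ, hball] with q hq hqb i hi
    exact a2 q ρ i (hq _ hqb i hi j) (hq _ (Metric.mem_closedBall_self (radius_nonneg q)) i hi j)
  have hR2 : Tendsto (fun q => perturbedAvg z (deriv G) (fun _ => 1) j (d2 q) q)
      (probFilter P) (𝓝 (μ j)) := by
    refine UniformAvg.tendsto_perturbedAvg (h.uniformAvg_deriv j) fun ρ hρ => ?_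
    filter_upwards [h.eventually_abs_projection_sub_le hρ] with q hq i hi
    exact b2 q ρ i (hq _ (Metric.mem_closedBall_self (radius_nonneg q)) i hi j)
      (by simpa using hρ.le)
  -- Row increments of order n^(-1/2) multiply averages that tend to λ_j for b = j and to 0
  -- otherwise. To first order only the diagonal entry of the estimate matters, hence the result
  -- does not depend on the weights.
  have hS1 : Tendsto (fun q => ∑ b, (perturbedAvg z (deriv G) (fun v => 1 * v b) j (d1 q) q -
      if b = j then lam j else 0) * (√(q.1 : ℝ) * (Y q j b - unitRows p j b)))
      (probFilter P) (𝓝 0) := by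
    have : ∀ b, Tendsto (fun q => (perturbedAvg z (deriv G) (fun v => 1 * v b) j (d1 q) q -
      if b = j then lam j else 0) * (√(q.1 : ℝ) * (Y q j b - unitRows p j b)))
      (probFilter P) (𝓝 0) := fun b => hBdd b _ (by
      have := (hR1 b).sub_const (if b = j then lam j else 0)
      rwa [sub_self] at this)
    simpa using tendsto_finsetSum Finset.univ fun b _ => this b
  have hS2 : Tendsto (fun q => (perturbedAvg z (deriv G) (fun _ => 1) j (d2 q) q - μ j) *
      (√(q.1 : ℝ) * zbar z q j)) (probFilter P) (𝓝 0) :=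
    h.bddInProb_zbar j _ (by
      have := hR2.sub_const (μ j)
      rwa [sub_self] at this)
  have hS3 := (h.tendsto_sqrt_mul_newtonLimit hx hD j j).const_mul (lam j)
  have hS := (hS1.sub hS2).add hS3
  simp only [sub_zero, mul_zero, add_zero] at hS
  refine hS.congr' ?_
  filter_upwards [tendsto_fst_probFilter.eventually_gt_atTop 0] with q hq0
  have hq : (q.1 : ℝ) ≠ 0 := by positivity
  have c1 : sampleG G (obs x q) (Y q j) = avg z (fun v => G (v j)) q +
      (∑ b, (Y q j b - unitRows p j b) *
        perturbedAvg z (deriv G) (fun v => 1 * v b) j (d1 q) q) -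
      zbar z q j * perturbedAvg z (deriv G) (fun _ => 1) j (d2 q) q := by
    have k1 := a1 q
    have k2 := b1 q
    have k3 : (q.1 : ℝ)⁻¹ * ∑ i ∈ Finset.range q.1, deriv G (z i q.2 j + d2 q i) *
        (-zbar z q j * 1) = - (zbar z q j * perturbedAvg z (deriv G) (fun _ => 1) j (d2 q) q) := by
      simp only [perturbedAvg, Finset.mul_sum, ← Finset.sum_neg_distrib]
      exact Finset.sum_congr rfl fun i _ => by ring
    have k4 : (q.1 : ℝ)⁻¹ * ∑ i ∈ Finset.range q.1,
        (G (unitRows p j ⬝ᵥ (z i q.2 - zbar z q)) - G (z i q.2 j)) * 1 =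
        rowAvg z G (fun _ => 1) j q (unitRows p) - avg z (fun v => G (v j)) q := by
      simp only [rowAvg, avg, ← mul_sub, ← Finset.sum_sub_distrib, mul_one]
    rw [sampleG_obs hx]
    rw [k3, k4] at k2
    simp only [Pi.sub_apply] at k1
    linarith
  -- The diagonal influence function −(z_j² − 1)/2, multiplied by λ_j, is the scale correction in
  -- the expansion; centring by the sample mean accounts for the term in μ_j.
  have c2 : normSum z (influence G κ θ ν μ lam δ j j) q =
      - (normSum z (fun v => v j ^ 2 - 1) q) / 2 := by
    simp only [normSum, influence, if_true, Finset.mul_sum, ← Finset.sum_neg_distrib,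
      Finset.sum_div]
    exact Finset.sum_congr rfl fun i _ => by ring
  have c3 : normSum z (fun v => G (v j) - ν j - μ j * v j - lam j * (v j ^ 2 - 1) / 2) q =
      √(q.1 : ℝ) * (avg z (fun v => G (v j)) q - ν j) - μ j * (√(q.1 : ℝ) * zbar z q j) -
        lam j * normSum z (fun v => v j ^ 2 - 1) q / 2 := by
    have k : ∀ v : Fin p → ℝ, G (v j) - ν j - μ j * v j - lam j * (v j ^ 2 - 1) / 2 =
        G (v j) - ν j - μ j * v j - (lam j / 2) * (v j ^ 2 - 1) := fun v => by ring
    simp only [k]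
    rw [← sqrt_mul_avg, ← sqrt_mul_avg, avg_sub, avg_sub, avg_sub, avg_const_mul, avg_const_mul,
      avg_const _ hq0, zbar]
    ring
  have c4 : ∑ b, (perturbedAvg z (deriv G) (fun v => 1 * v b) j (d1 q) q -
      if b = j then lam j else 0) * (√(q.1 : ℝ) * (Y q j b - unitRows p j b)) =
      √(q.1 : ℝ) * ∑ b, (Y q j b - unitRows p j b) *
        perturbedAvg z (deriv G) (fun v => 1 * v b) j (d1 q) q -
      lam j * (√(q.1 : ℝ) * (Y q j j - unitRows p j j)) := by
    have t : ∀ b, (perturbedAvg z (deriv G) (fun v => 1 * v b) j (d1 q) q -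
        if b = j then lam j else 0) * (√(q.1 : ℝ) * (Y q j b - unitRows p j b)) =
        √(q.1 : ℝ) * ((Y q j b - unitRows p j b) *
          perturbedAvg z (deriv G) (fun v => 1 * v b) j (d1 q) q) -
        if b = j then lam j * (√(q.1 : ℝ) * (Y q j b - unitRows p j b)) else 0 := fun b => by
      split_ifs <;> ring
    simp only [t, Finset.sum_sub_distrib, Finset.sum_ite_eq', Finset.mem_univ, if_true,
      ← Finset.mul_sum]
  change _ = √(q.1 : ℝ) * (sampleG G (obs x q) (Y q j) - ν j) - _
  rw [c1, c3, c4, c2]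
  ring

theorem tendsto_sampleG_newtonLimit (h : ICModel P G z ν μ lam δ)
    (hx : ∀ i ω, x i ω = loc + z i ω) (hD : ∀ j l, j ≠ l → pairSlope κ θ ν lam δ j l ≠ 0)
    (j : Fin p) :
    Tendsto (fun q => sampleG G (obs x q) (newtonLimit G κ θ ν lam δ q.1 (obs x q) j))
      (probFilter P) (𝓝 (ν j)) := by
  rw [Metric.tendsto_nhds]
  intro ε hε
  filter_upwards [h.eventually_newtonLimit hx hD (by norm_num : (0 : ℝ) < 1 / 2) le_rfl,
    h.eventually_rowAvg_le (h.uniformAvg_G j) (half_pos hε)] with q h1 h2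
  rw [sampleG_obs hx]
  exact (h2 _ h1.1).trans_lt (half_lt_self hε)

end ICModel

/-! ### Second moments of the influence functions -/

namespace ICModel

variable {Ω : Type*} [MeasurableSpace Ω] {p : ℕ} {P : Measure Ω} {G : ℝ → ℝ}
  {z : ℕ → Ω → Fin p → ℝ} {ν μ lam δ : Fin p → ℝ} [IsProbabilityMeasure P]
  {κ : Fin p → Fin p → ℝ} {θ : ℝ}

theorem influence_of_ne {j l : Fin p} (hjl : j ≠ l) (v : Fin p → ℝ) :
    influence G κ θ ν μ lam δ j l v =
      limitWeight κ θ ν j l / pairSlope κ θ ν lam δ j l * ((deriv G (v j) - μ j - lam j * v j) * v l) -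
      limitWeight κ θ ν l j / pairSlope κ θ ν lam δ j l *
        ((deriv G (v l) - μ l - δ l * v l) * v j) := by
  rw [influence, if_neg hjl]
  ring

theorem integral_score_mul_self (h : ICModel P G z ν μ lam δ) (j : Fin p) (c : ℝ) :
    ∫ ω, (deriv G (z 0 ω j) - μ j - c * z 0 ω j) * z 0 ω j ∂P = lam j - c := by
  have i1 := (h.moments j).lam
  have i2 := (h.integrable_coord j).const_mul (μ j)
  have i3 := ((h.source.memLp j).integrable_sq).const_mul c
  have e : ∀ ω, (deriv G (z 0 ω j) - μ j - c * z 0 ω j) * z 0 ω j =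
      deriv G (z 0 ω j) * z 0 ω j - μ j * z 0 ω j - c * z 0 ω j ^ 2 := fun ω => by ring
  simp_rw [e]
  have i12 : Integrable (fun ω => deriv G (z 0 ω j) * z 0 ω j - μ j * z 0 ω j) P := i1.sub i2
  rw [integral_sub i12 i3, integral_sub i1 i2, integral_const_mul, integral_const_mul,
    h.source.mean, h.source.second_moment, h.lam_eq]
  ring

theorem integral_score_sq (h : ICModel P G z ν μ lam δ) (j : Fin p) (c : ℝ) :
    ∫ ω, (deriv G (z 0 ω j) - μ j - c * z 0 ω j) ^ 2 ∂P =
      icSigmaSq G P (fun ω => z 0 ω j) - 2 * c * lam j + c ^ 2 := by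
  have hv : icSigmaSq G P (fun ω => z 0 ω j) = ∫ ω, (deriv G (z 0 ω j) - μ j) ^ 2 ∂P := by
    rw [icSigmaSq, variance_eq_integral (h.moments j).sigma.1.aemeasurable, h.mu_eq]
  have i0 := h.memLp_score j 0
  simp only [zero_mul, sub_zero] at i0
  have i1 := i0.integrable_sq
  have i2 := (i0.integrable_mul (h.source.memLp j)).const_mul (2 * c)
  have i3 := ((h.source.memLp j).integrable_sq).const_mul (c ^ 2)
  have e : ∀ ω, (deriv G (z 0 ω j) - μ j - c * z 0 ω j) ^ 2 = (deriv G (z 0 ω j) - μ j) ^ 2 -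
      2 * c * ((deriv G (z 0 ω j) - μ j) * z 0 ω j) + c ^ 2 * z 0 ω j ^ 2 := fun ω => by ring
  simp only [Pi.mul_apply] at i2
  have i12 : Integrable (fun ω => (deriv G (z 0 ω j) - μ j) ^ 2 -
      2 * c * ((deriv G (z 0 ω j) - μ j) * z 0 ω j)) P := i1.sub i2
  have h0 := h.integral_score_mul_self j 0
  simp only [zero_mul, sub_zero] at h0
  simp_rw [e]
  rw [integral_add i12 i3, integral_sub i1 i2, integral_const_mul, integral_const_mul,
    h.source.second_moment, h0, hv]
  ring

/-- The off-diagonal influence functions are uncorrelated with functions of either component. -/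
theorem integral_coord_mul_influence (h : ICModel P G z ν μ lam δ) {j l : Fin p} (hjl : j ≠ l)
    {f : ℝ → ℝ} (hf : Measurable f) {a : Fin p} (hfL : MemLp (fun ω => f (z 0 ω a)) 2 P) :
    ∫ ω, f (z 0 ω a) * influence G κ θ ν μ lam δ j l (z 0 ω) ∂P = 0 := by
  have m1 := h.measurable_score j (lam j)
  have m2 := h.measurable_score l (δ l)
  have L1 := h.memLp_score j (lam j)
  have L2 := h.memLp_score l (δ l)
  have P1 := h.memLp_coord_mul hjl m1 measurable_id L1 (h.source.memLp l)
  have P2 := h.memLp_coord_mul hjl.symm m2 measurable_id L2 (h.source.memLp j)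
  have I1 := hfL.integrable_mul P1
  have I2 := hfL.integrable_mul P2
  simp only [id, Pi.mul_def] at I1 I2
  have e : ∀ ω, f (z 0 ω a) * influence G κ θ ν μ lam δ j l (z 0 ω) =
      limitWeight κ θ ν j l / pairSlope κ θ ν lam δ j l *
        (f (z 0 ω a) * ((deriv G (z 0 ω j) - μ j - lam j * z 0 ω j) * z 0 ω l)) -
      limitWeight κ θ ν l j / pairSlope κ θ ν lam δ j l *
        (f (z 0 ω a) * ((deriv G (z 0 ω l) - μ l - δ l * z 0 ω l) * z 0 ω j)) := fun ω => by
    rw [influence_of_ne hjl]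
    ring
  simp_rw [e]
  rw [integral_sub (I1.const_mul _) (I2.const_mul _), integral_const_mul, integral_const_mul]
  suffices h0 : (∫ ω, f (z 0 ω a) * ((deriv G (z 0 ω j) - μ j - lam j * z 0 ω j) * z 0 ω l) ∂P = 0) ∧
      ∫ ω, f (z 0 ω a) * ((deriv G (z 0 ω l) - μ l - δ l * z 0 ω l) * z 0 ω j) ∂P = 0 by
    rw [h0.1, h0.2]; ring
  -- In every case each product contains a centred factor, a score or a coordinate, whose component
  -- occurs nowhere else in the product.
  by_cases haj : a = j
  · subst haj
    have h1 := h.integral_coord_mul hjl (hf.mul m1) measurable_id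
    have h2 := h.integral_coord_mul hjl (hf.mul measurable_id) m2
    simp only [Pi.mul_apply, id, h.source.mean, h.integral_score, mul_zero] at h1 h2
    constructor
    · rw [← h1]; exact integral_congr_ae (ae_of_all _ fun ω => by ring)
    · rw [← h2]; exact integral_congr_ae (ae_of_all _ fun ω => by ring)
  by_cases hal : a = l
  · subst hal
    have h1 := h.integral_coord_mul hjl m1 (hf.mul measurable_id)
    have h2 := h.integral_coord_mul hjl measurable_id (hf.mul m2)
    simp only [Pi.mul_apply, id, h.source.mean, h.integral_score, zero_mul] at h1 h2
    constructor
    · rw [← h1]; exact integral_congr_ae (ae_of_all _ fun ω => by ring)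
    · rw [← h2]; exact integral_congr_ae (ae_of_all _ fun ω => by ring)
  have h1 := h.integral_coord_mul_pair (j := a) haj hal hf
    ((m1.comp measurable_fst).mul measurable_snd)
  have h2 := h.integral_coord_mul_pair (j := a) haj hal hf
    ((m2.comp measurable_snd).mul measurable_fst)
  have h3 := h.integral_coord_mul hjl m1 measurable_id
  have h4 := h.integral_coord_mul hjl.symm m2 measurable_id
  simp only [Pi.mul_apply, Function.comp, id, h.source.mean, mul_zero] at h1 h2 h3 h4
  rw [h1, h2, h3, h4]
  simp

/-- If j, l, k are distinct, the influence function of (j, k) is linear in z_k and the score of z_k,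
both centred and independent of the pair (z_j, z_l). If one index equals j, its influence function
depends on z_j alone. -/
theorem integral_influence_mul_of_ne (h : ICModel P G z ν μ lam δ) {j l k : Fin p} (hlk : l ≠ k) :
    ∫ ω, influence G κ θ ν μ lam δ j l (z 0 ω) * influence G κ θ ν μ lam δ j k (z 0 ω) ∂P = 0 := by
  have hd : ∀ k, j ≠ k → ∫ ω, influence G κ θ ν μ lam δ j j (z 0 ω) *
      influence G κ θ ν μ lam δ j k (z 0 ω) ∂P = 0 := fun k hk => by
    have L := h.memLp_influence κ θ j j
    simp only [influence, if_true] at L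
    have := h.integral_coord_mul_influence (κ := κ) (θ := θ) hk
      (f := fun t => -(t ^ 2 - 1) / 2) (by fun_prop) (a := j) L
    rw [← this]
    simp only [influence, if_true]
  by_cases hjl : j = l
  · subst hjl; exact hd k hlk
  by_cases hjk : j = k
  · subst hjk
    rw [← hd l hjl]
    exact integral_congr_ae (ae_of_all _ fun ω => mul_comm _ _)
  have m0 := h.continuous_deriv.measurable
  have mz := h.measurable_coord
  have m1 := h.measurable_score j (lam j)
  have m2 := h.measurable_score k (δ k)
  set K : ℝ × ℝ → ℝ := fun y =>
    limitWeight κ θ ν j l / pairSlope κ θ ν lam δ j l * ((deriv G y.1 - μ j - lam j * y.1) * y.2) -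
      limitWeight κ θ ν l j / pairSlope κ θ ν lam δ j l * ((deriv G y.2 - μ l - δ l * y.2) * y.1)
    with hK
  have hKi : ∀ ω, influence G κ θ ν μ lam δ j l (z 0 ω) = K (z 0 ω j, z 0 ω l) := fun ω =>
    influence_of_ne hjl _
  have mK : Measurable K := by fun_prop
  have LK : MemLp (fun ω => K (z 0 ω j, z 0 ω l)) 2 P := by
    have := h.memLp_influence κ θ j l
    simpa only [hKi] using this
  have u1 : Measurable fun y : ℝ × ℝ => K y * (deriv G y.1 - μ j - lam j * y.1) := by fun_prop
  have u2 : Measurable fun y : ℝ × ℝ => K y * y.1 := by fun_prop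
  have e1 := h.integral_coord_mul_pair (Ne.symm hjk) (Ne.symm hlk) measurable_id u1
  have e2 := h.integral_coord_mul_pair (Ne.symm hjk) (Ne.symm hlk) m2 u2
  have i1 := h.integrable_coord_mul_pair (Ne.symm hjk) (Ne.symm hlk) measurable_id u1
    (h.integrable_coord k) (LK.integrable_mul (h.memLp_score j (lam j)))
  have i2 := h.integrable_coord_mul_pair (Ne.symm hjk) (Ne.symm hlk) m2 u2
    ((h.memLp_score k (δ k)).integrable one_le_two) (LK.integrable_mul (h.source.memLp j))
  simp only [id, h.source.mean, h.integral_score, zero_mul] at e1 e2 i1 i2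
  have e : ∀ ω, influence G κ θ ν μ lam δ j l (z 0 ω) * influence G κ θ ν μ lam δ j k (z 0 ω) =
      limitWeight κ θ ν j k / pairSlope κ θ ν lam δ j k * (z 0 ω k * (K (z 0 ω j, z 0 ω l) *
        (deriv G (z 0 ω j) - μ j - lam j * z 0 ω j))) -
      limitWeight κ θ ν k j / pairSlope κ θ ν lam δ j k *
        ((deriv G (z 0 ω k) - μ k - δ k * z 0 ω k) * (K (z 0 ω j, z 0 ω l) * z 0 ω j)) := by
    intro ω
    rw [influence_of_ne hjk, hKi]
    ring
  simp_rw [e]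
  rw [integral_sub (i1.const_mul _) (i2.const_mul _), integral_const_mul, integral_const_mul, e1, e2]
  ring

/-- The asymptotic variances of the solution. -/
noncomputable def asymptoticVariance (κ : Fin p → Fin p → ℝ) (θ : ℝ) (ν lam δ β σsq : Fin p → ℝ)
    (j l : Fin p) : ℝ :=
  if l = j then (β j - 1) / 4
  else (limitWeight κ θ ν j l ^ 2 * (σsq j - lam j ^ 2) +
    limitWeight κ θ ν l j ^ 2 * (σsq l + δ l * (δ l - 2 * lam l))) / pairSlope κ θ ν lam δ j l ^ 2

/-- The cross term contains E[(g(z_j) − μ_j − λ_j z_j) z_j] = λ_j − λ_j = 0. The two squares give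
σ_j² − λ_j² and σ_l² − 2δ_lλ_l + δ_l², because the score of j subtracts λ_j z_j and that of l
subtracts δ_l z_l. -/
theorem integral_influence_sq (h : ICModel P G z ν μ lam δ) {β σsq : Fin p → ℝ}
    (hβ : ∀ j, β j = icBeta P (fun ω => z 0 ω j))
    (hσsq : ∀ j, σsq j = icSigmaSq G P (fun ω => z 0 ω j)) (j l : Fin p) :
    ∫ ω, influence G κ θ ν μ lam δ j l (z 0 ω) ^ 2 ∂P =
      asymptoticVariance κ θ ν lam δ β σsq j l := by
  by_cases hjl : j = l
  · subst hjl
    have e : ∀ ω, influence G κ θ ν μ lam δ j j (z 0 ω) ^ 2 =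
        (1 / 4) * z 0 ω j ^ 4 - (1 / 2) * z 0 ω j ^ 2 + 1 / 4 := fun ω => by
      simp only [influence, if_true]
      ring
    have i1 := (h.moments j).beta.const_mul (1 / 4)
    have i2 := ((h.source.memLp j).integrable_sq).const_mul (1 / 2)
    have i12 : Integrable (fun ω => (1 / 4) * z 0 ω j ^ 4 - (1 / 2) * z 0 ω j ^ 2) P := i1.sub i2
    simp_rw [e]
    rw [integral_add i12 (integrable_const _), integral_sub i1 i2, integral_const_mul,
      integral_const_mul, h.source.second_moment, asymptoticVariance, if_pos rfl, hβ, icBeta]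
    simp
    ring
  · have m0 := h.continuous_deriv.measurable
    have m1 := h.measurable_score j (lam j)
    have m2 := h.measurable_score l (δ l)
    have L1 := h.memLp_score j (lam j)
    have L2 := h.memLp_score l (δ l)
    have Lz := h.source.memLp
    have e1 := h.integral_coord_mul hjl (m1.pow_const 2) (measurable_id.pow_const 2)
    have e2 := h.integral_coord_mul hjl (m1.mul measurable_id) (m2.mul measurable_id)
    have e3 := h.integral_coord_mul (Ne.symm hjl) (m2.pow_const 2) (measurable_id.pow_const 2)
    have i1 := h.integrable_coord_mul hjl (m1.pow_const 2) (measurable_id.pow_const 2)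
      L1.integrable_sq (Lz l).integrable_sq
    have i2 := h.integrable_coord_mul hjl (m1.mul measurable_id) (m2.mul measurable_id)
      (L1.integrable_mul (Lz j)) (L2.integrable_mul (Lz l))
    have i3 := h.integrable_coord_mul (Ne.symm hjl) (m2.pow_const 2) (measurable_id.pow_const 2)
      L2.integrable_sq (Lz j).integrable_sq
    simp only [id, Pi.mul_apply, h.source.second_moment, h.integral_score_sq,
      h.integral_score_mul_self, sub_self, zero_mul, mul_one] at e1 e2 e3 i1 i2 i3
    set D := pairSlope κ θ ν lam δ j l with hD
    set a := limitWeight κ θ ν j l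
    set b := limitWeight κ θ ν l j
    have e : ∀ ω, influence G κ θ ν μ lam δ j l (z 0 ω) ^ 2 =
        (a / D) ^ 2 * ((deriv G (z 0 ω j) - μ j - lam j * z 0 ω j) ^ 2 * z 0 ω l ^ 2) -
        2 * (a / D) * (b / D) * ((deriv G (z 0 ω j) - μ j - lam j * z 0 ω j) * z 0 ω j *
          ((deriv G (z 0 ω l) - μ l - δ l * z 0 ω l) * z 0 ω l)) +
        (b / D) ^ 2 * ((deriv G (z 0 ω l) - μ l - δ l * z 0 ω l) ^ 2 * z 0 ω j ^ 2) := fun ω => by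
      rw [influence_of_ne hjl]
      ring
    simp_rw [e]
    have i12 := (i1.const_mul ((a / D) ^ 2)).sub (i2.const_mul (2 * (a / D) * (b / D)))
    simp only [Pi.sub_def] at i12
    rw [integral_add i12 (i3.const_mul _), integral_sub (i1.const_mul _) (i2.const_mul _),
      integral_const_mul, integral_const_mul, integral_const_mul, e1, e2, e3, asymptoticVariance,
      if_neg (Ne.symm hjl), hσsq, hσsq]
    ring

theorem diagonal_asymptoticVariance (h : ICModel P G z ν μ lam δ) {β σsq : Fin p → ℝ}
    (hβ : ∀ j, β j = icBeta P (fun ω => z 0 ω j))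
    (hσsq : ∀ j, σsq j = icSigmaSq G P (fun ω => z 0 ω j)) (j a b : Fin p) :
    Matrix.diagonal (asymptoticVariance κ θ ν lam δ β σsq j) a b =
      ∫ ω, influence G κ θ ν μ lam δ j a (z 0 ω) * influence G κ θ ν μ lam δ j b (z 0 ω) ∂P := by
  by_cases hab : a = b
  · subst hab
    rw [Matrix.diagonal_apply_eq, ← h.integral_influence_sq hβ hσsq]
    exact integral_congr_ae (ae_of_all _ fun ω => by ring)
  · rw [Matrix.diagonal_apply_ne _ hab, h.integral_influence_mul_of_ne hab]

end ICModel

/-! ### Estimators that are asymptotically linear -/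

section Slutsky

variable {Ω : Type*} [MeasurableSpace Ω] {p : ℕ} {P : Measure Ω} [IsProbabilityMeasure P]

/-- Slutsky's theorem, with the negligible difference given coordinate by coordinate. -/
theorem HasASV.of_tendsto {θ' : ℕ → Ω → Fin p → ℝ} {t : Fin p → ℝ} {V : Matrix (Fin p) (Fin p) ℝ}
    (hV : V.PosSemidef) {Y : ℕ × Ω → Fin p → ℝ}
    (hY : TendstoInDistribution (fun (n : ℕ) ω => WithLp.toLp 2 (Y (n, ω))) atTop
      (id : EuclideanSpace ℝ (Fin p) → EuclideanSpace ℝ (Fin p)) (fun _ => P)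
      (multivariateGaussian 0 V))
    (hm : ∀ n l, Measurable fun ω => θ' n ω l)
    (h : ∀ l, Tendsto (fun q => √(q.1 : ℝ) * (θ' q.1 q.2 l - t l) - Y q l) (probFilter P) (𝓝 0)) :
    HasASV P θ' t V := by
  refine ⟨hV, tendstoInDistribution_of_tendstoInMeasure_sub _ _ hY ?_ fun n => ?_⟩
  · rw [tendstoInMeasure_iff_norm]
    intro ε hε
    have h1 : Tendsto (fun q : ℕ × Ω => WithLp.toLp 2 fun l =>
        √(q.1 : ℝ) * (θ' q.1 q.2 l - t l) - Y q l) (probFilter P)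
        (𝓝 (0 : EuclideanSpace ℝ (Fin p))) :=
      ((PiLp.continuous_toLp 2 fun _ : Fin p => ℝ).tendsto 0).comp (tendsto_pi_nhds.2 h)
    have h2 := (Metric.tendsto_nhds.1 h1 ε hε)
    rw [eventually_probFilter] at h2
    refine h2.congr fun n => ?_
    congr 1
    ext ω
    simp only [dist_zero_right, not_lt, Pi.sub_apply, Pi.zero_apply, sub_zero]
    rfl
  · refine Measurable.aemeasurable ((WithLp.measurable_toLp 2 _).comp
      (measurable_pi_lambda _ fun l => ?_))
    exact ((hm n l).sub_const _).const_mul _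

end Slutsky

namespace ICModel

variable {Ω : Type*} [MeasurableSpace Ω] {p : ℕ} {P : Measure Ω} {G : ℝ → ℝ}
  {z x : ℕ → Ω → Fin p → ℝ} {loc ν μ lam δ β σsq : Fin p → ℝ}
  {κ : Fin p → Fin p → ℝ} {θ : ℝ}

theorem measurable_obs (h : ICModel P G z ν μ lam δ) (hx : ∀ i ω, x i ω = loc + z i ω) (n : ℕ) :
    Measurable fun ω => (fun i : Fin n => x i ω) := by
  refine measurable_pi_lambda _ fun i => ?_
  simp only [hx]
  exact (h.source.measurable _).const_add _

variable [IsProbabilityMeasure P]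

theorem posSemidef_asymptoticVariance (h : ICModel P G z ν μ lam δ)
    (hβ : ∀ j, β j = icBeta P (fun ω => z 0 ω j))
    (hσsq : ∀ j, σsq j = icSigmaSq G P (fun ω => z 0 ω j)) (j : Fin p) :
    (Matrix.diagonal (asymptoticVariance κ θ ν lam δ β σsq j)).PosSemidef :=
  posSemidef_of_integral (fun l => h.memLp_influence κ θ j l)
    (h.diagonal_asymptoticVariance hβ hσsq j)

theorem eventually_constraints (h : ICModel P G z ν μ lam δ)
    (hx : ∀ i ω, x i ω = loc + z i ω) (hD : ∀ j l, j ≠ l → pairSlope κ θ ν lam δ j l ≠ 0) :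
    ∀ᶠ q in probFilter P,
      (∀ j l, covForm (obs x q) (newtonLimit G κ θ ν lam δ q.1 (obs x q)) j l =
        if l = j then 1 else 0) ∧
      ∀ j l, j ≠ l → estEq G κ θ (obs x q) (newtonLimit G κ θ ν lam δ q.1 (obs x q)) j l = 0 :=
  (h.eventually_newtonLimit hx hD (by norm_num : (0 : ℝ) < 1 / 2) le_rfl).mono fun _ hq =>
    of_newtonMap_eq_zero hD hq.2.1

theorem hasSolutionsWithASV (h : ICModel P G z ν μ lam δ)
    (hx : ∀ i ω, x i ω = loc + z i ω) (hD : ∀ j l, j ≠ l → pairSlope κ θ ν lam δ j l ≠ 0)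
    (hβ : ∀ j, β j = icBeta P (fun ω => z 0 ω j))
    (hσsq : ∀ j, σsq j = icSigmaSq G P (fun ω => z 0 ω j))
    {Sol : ∀ n : ℕ, (Fin n → Fin p → ℝ) → Matrix (Fin p) (Fin p) ℝ → Prop}
    (hSol : ∀ᶠ q in probFilter P, Sol q.1 (obs x q) (newtonLimit G κ θ ν lam δ q.1 (obs x q))) :
    HasSolutionsWithASV P x Sol (asymptoticVariance κ θ ν lam δ β σsq) := by
  refine ⟨fun n X => newtonLimit G κ θ ν lam δ n X, fun _ => measurable_newtonLimit h.continuous h.continuous_deriv κ θ ν lam δ,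
    tendsto_measure_of_eventually hSol, fun j l => ?_, fun j => ?_⟩
  · rw [tendstoInMeasure_iff_probFilter]
    exact h.tendsto_newtonLimit hx hD j l
  · refine HasASV.of_tendsto
      (Y := fun q l => normSum z (influence G κ θ ν μ lam δ j l) q) (h.posSemidef_asymptoticVariance hβ hσsq j)
      (h.isIID.tendstoInDistribution_normSum (ψ := fun l => influence G κ θ ν μ lam δ j l)
        (h.measurable_influence κ θ j) (h.memLp_influence κ θ j) (h.integral_influence κ θ j)
        (h.diagonal_asymptoticVariance hβ hσsq j)) (fun n l => ?_) fun l => ?_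
    · exact (measurable_newtonLimit h.continuous h.continuous_deriv κ θ ν lam δ j l).comp (h.measurable_obs hx n)
    · exact h.tendsto_sqrt_mul_newtonLimit hx hD j l

end ICModel

/-! ### The estimating equations of the three methods -/

section Equations

variable {n p : ℕ} {G : ℝ → ℝ} {X : Fin n → Fin p → ℝ} {Γ : Matrix (Fin p) (Fin p) ℝ}

/-- The constraints say ΓŜΓᵀ = I, hence ŜΓᵀΓ = I, so the equation holds with the sum over all l in
place of l ≤ j. The extra terms contain γ_lᵀT̂(γ_j) with l > j and vanish. -/
theorem isDeflationSolution_of_dotProduct_eq_zero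
    (hC : ∀ j l, covForm X Γ j l = if l = j then 1 else 0)
    (hT : ∀ j l, j < l → Γ l ⬝ᵥ sampleT G X (Γ j) = 0) : IsDeflationSolution G X Γ := by
  refine ⟨fun j => ?_, hC⟩
  have h1 : Γ * (sampleCov X * Γ.transpose) = 1 := by
    ext l k
    rw [Matrix.one_apply, ← hC k l]
    rfl
  have h2 : sampleCov X * Γ.transpose * Γ = 1 := mul_eq_one_comm.mp (by rw [← h1])
  have h3 : (∑ l ∈ Finset.Iic j, Matrix.vecMulVec (Γ l) (Γ l)).mulVec (sampleT G X (Γ j)) =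
      (Γ.transpose * Γ).mulVec (sampleT G X (Γ j)) := by
    have h4 : Γ.transpose * Γ = ∑ l, Matrix.vecMulVec (Γ l) (Γ l) := by
      ext a b
      simp [Matrix.mul_apply, Matrix.sum_apply, Matrix.vecMulVec_apply]
    rw [h4, Matrix.sum_mulVec, Matrix.sum_mulVec]
    refine Finset.sum_subset (Finset.subset_univ _) fun l _ hl => ?_
    rw [Matrix.vecMulVec_mulVec, hT j l (by simpa using hl)]
    simp
  rw [← Matrix.mulVec_mulVec, h3, Matrix.mulVec_mulVec, ← Matrix.mul_assoc, h2, Matrix.one_mulVec]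

theorem isSymmetricSolution_of_estEq {c : Fin p → ℝ}
    (hC : ∀ j l, covForm X Γ j l = if l = j then 1 else 0)
    (hE : ∀ j l, j ≠ l → estEq G (fun j _ => c j) 0 X Γ j l = 0)
    (hc : ∀ j, Real.sign (sampleG G X (Γ j)) = c j) : IsSymmetricSolution G X Γ := by
  refine ⟨fun j l => ?_, hC⟩
  by_cases hjl : j = l
  · rw [hjl]
  have := hE j l hjl
  simp only [estEq, zero_mul, add_zero] at this
  rw [hc, hc]
  linarith

theorem isSquaredSymmetricSolution_of_estEq
    (hC : ∀ j l, covForm X Γ j l = if l = j then 1 else 0)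
    (hE : ∀ j l, j ≠ l → estEq G (fun _ _ => 0) 1 X Γ j l = 0) :
    IsSquaredSymmetricSolution G X Γ := by
  refine ⟨fun j l => ?_, hC⟩
  by_cases hjl : j = l
  · rw [hjl]
  have := hE j l hjl
  simp only [estEq, one_mul, zero_add] at this
  rw [sampleT2, sampleT2, dotProduct_smul, dotProduct_smul, smul_eq_mul, smul_eq_mul]
  linarith

end Equations

/-! ### Differentiable functions of a standard Gaussian variable -/

section Gaussian

local notation "q₀" => gaussianPDFReal 0 1

theorem integrable_gaussianReal_iff {f : ℝ → ℝ} :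
    Integrable f (gaussianReal 0 1) ↔ Integrable fun x => q₀ x * f x := by
  rw [gaussianReal_of_var_ne_zero 0 one_ne_zero, integrable_withDensity_iff_integrable_smul'
    (measurable_gaussianPDF 0 1) (ae_of_all _ fun _ => gaussianPDF_lt_top)]
  simp only [toReal_gaussianPDF, smul_eq_mul]

theorem hasDerivAt_gaussianPDFReal (x : ℝ) : HasDerivAt q₀ (-x * q₀ x) x := by
  have h : q₀ = fun x => (√(2 * Real.pi))⁻¹ * Real.exp (-x ^ 2 / 2) := by
    ext x
    simp [gaussianPDFReal]
  have h1 : HasDerivAt (fun x : ℝ => -x ^ 2 / 2) (-x) x := by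
    refine (((hasDerivAt_pow 2 x).neg).div_const 2).congr_deriv ?_
    push_cast
    ring
  rw [h]
  refine ((h1.exp).const_mul (√(2 * Real.pi))⁻¹).congr_deriv ?_
  ring

theorem continuous_gaussianPDFReal : Continuous q₀ :=
  continuous_iff_continuousAt.2 fun x => (hasDerivAt_gaussianPDFReal x).continuousAt

/-- **Stein's identity.** -/
theorem integral_mul_self_gaussianReal {f f' : ℝ → ℝ} (hf : ∀ x, HasDerivAt f (f' x) x)
    (h0 : Integrable f (gaussianReal 0 1)) (h1 : Integrable (fun x => f x * x) (gaussianReal 0 1))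
    (h2 : Integrable f' (gaussianReal 0 1)) :
    ∫ x, f x * x ∂(gaussianReal 0 1) = ∫ x, f' x ∂(gaussianReal 0 1) := by
  rw [integrable_gaussianReal_iff] at h0 h1 h2
  have hd : ∀ x, HasDerivAt (fun x => q₀ x * f x) (q₀ x * f' x - q₀ x * (f x * x)) x := fun x => by
    refine ((hasDerivAt_gaussianPDFReal x).mul (hf x)).congr_deriv ?_
    ring
  have := integral_eq_zero_of_hasDerivAt_of_integrable hd (h2.sub h1) h0
  rw [integral_sub h2 h1, sub_eq_zero] at this
  rw [integral_gaussianReal_eq_integral_smul one_ne_zero,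
    integral_gaussianReal_eq_integral_smul one_ne_zero]
  exact this.symm

/-- A function with square integrable derivative is square integrable with respect to the Gaussian
law. -/
theorem integrable_sq_gaussianReal_of_deriv {f f' : ℝ → ℝ} (hf : ∀ x, HasDerivAt f (f' x) x)
    (hf' : Integrable (fun x => f' x ^ 2) (gaussianReal 0 1)) :
    Integrable (fun x => f x ^ 2) (gaussianReal 0 1) := by
  rw [integrable_gaussianReal_iff] at hf' ⊢
  have hc : Continuous f := continuous_iff_continuousAt.2 fun x => (hf x).continuousAt
  have hq := continuous_gaussianPDFReal
  obtain ⟨B, hB⟩ := (isCompact_Icc (a := (-2 : ℝ)) (b := 2)).exists_bound_of_continuousOn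
    (hc.pow 2).continuousOn
  have hB0 : 0 ≤ B := (norm_nonneg _).trans (hB 0 (by norm_num))
  -- Let q be the density and B a bound of f² on [−2, 2]. The aim is q f² − r ≤ (−x q f²)', where r
  -- is integrable; the boundary terms of the right side on [−n, n] are nonpositive.
  set r : ℝ → ℝ := fun x => 2 * B * q₀ x + 2 * (q₀ x * f' x ^ 2) with hr
  have hri : Integrable r := ((integrable_gaussianPDFReal 0 1).const_mul _).add (hf'.const_mul 2)
  have q0 : ∀ x, 0 ≤ q₀ x := gaussianPDFReal_nonneg 0 1
  have hr0 : ∀ x, 0 ≤ r x := fun x => by have := q0 x; positivity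
  have hL : ∀ R : ℝ, IntegrableOn (fun x => q₀ x * f x ^ 2) (Set.Icc (-R) R) := fun R =>
    (hq.mul (hc.pow 2)).continuousOn.integrableOn_compact isCompact_Icc
  have hd : ∀ x, HasDerivAt (fun x => -(x * (q₀ x * f x ^ 2)))
      (-(q₀ x * f x ^ 2 - x ^ 2 * (q₀ x * f x ^ 2) + 2 * x * (q₀ x * (f x * f' x)))) x := fun x => by
    refine (((hasDerivAt_id x).mul
      ((hasDerivAt_gaussianPDFReal x).mul ((hf x).pow 2))).neg).congr_deriv ?_
    simp only [id, Pi.pow_apply, Pi.mul_apply]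
    push_cast
    ring
  have hle : ∀ x, q₀ x * f x ^ 2 - r x ≤
      -(q₀ x * f x ^ 2 - x ^ 2 * (q₀ x * f x ^ 2) + 2 * x * (q₀ x * (f x * f' x))) := by
    intro x
    -- Estimating 2x f f' by x²f²/2 + 2f'² reduces the inequality to this one. The left side is
    -- nonpositive for |x| ≥ 2, and B takes care of the rest.
    have h1 : f x ^ 2 * (2 - x ^ 2 / 2) ≤ 2 * B := by
      by_cases hx : x ∈ Set.Icc (-2 : ℝ) 2
      · have := (le_abs_self _).trans (hB x hx)
        simp only [Pi.pow_apply] at this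
        nlinarith [mul_nonneg (sq_nonneg (f x)) (sq_nonneg x)]
      · have : 4 ≤ x ^ 2 := by
          rw [Set.mem_Icc, ← abs_le, not_le] at hx
          nlinarith [sq_abs x]
        nlinarith [sq_nonneg (f x)]
    have h3 : 0 ≤ (x * f x - 2 * f' x) ^ 2 := sq_nonneg _
    have h4 := mul_nonneg (q0 x) (sub_nonneg.2 h1)
    have h5 := mul_nonneg (q0 x) h3
    simp only [hr]
    nlinarith
  refine integrable_of_intervalIntegral_norm_bounded (∫ x, r x) (a := fun n : ℕ => -(n : ℝ))
    (b := fun n : ℕ => (n : ℝ)) (l := atTop)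
    (fun n => (hL n).mono_set Set.Ioc_subset_Icc_self)
    (tendsto_neg_atTop_atBot.comp tendsto_natCast_atTop_atTop) tendsto_natCast_atTop_atTop
    (Eventually.of_forall fun n => ?_)
  have hn : -(n : ℝ) ≤ n := by linarith [(n.cast_nonneg : (0 : ℝ) ≤ n)]
  have h1 := intervalIntegral.integral_le_sub_of_hasDeriv_right_of_le (g := fun x =>
    -(x * (q₀ x * f x ^ 2))) hn (by fun_prop) (fun x _ => (hd x).hasDerivWithinAt)
    ((hL n).sub hri.integrableOn) (fun x _ => hle x)
  have i1 : IntervalIntegrable (fun x => q₀ x * f x ^ 2) volume (-(n : ℝ)) n :=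
    (hq.mul (hc.pow 2)).intervalIntegrable _ _
  have e1 : ∫ x in -(n : ℝ)..n, (q₀ x * f x ^ 2 - r x) =
      (∫ x in -(n : ℝ)..n, q₀ x * f x ^ 2) - ∫ x in -(n : ℝ)..n, r x :=
    intervalIntegral.integral_sub i1 hri.intervalIntegrable
  have h2 : ∫ x in -(n : ℝ)..n, r x ≤ ∫ x, r x := by
    rw [intervalIntegral.integral_of_le hn]
    exact setIntegral_le_integral hri (ae_of_all _ hr0)
  have h3 : ∀ x, ‖q₀ x * f x ^ 2‖ = q₀ x * f x ^ 2 := fun x => by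
    rw [Real.norm_of_nonneg (mul_nonneg (q0 x) (sq_nonneg _))]
  simp_rw [h3]
  have h4 : 0 ≤ (n : ℝ) * (q₀ n * f n ^ 2) := by have := q0 n; positivity
  have h5 : 0 ≤ (n : ℝ) * (q₀ (-n) * f (-n) ^ 2) := by have := q0 (-n); positivity
  simp only [Pi.sub_apply] at h1
  change ∫ x in -(n : ℝ)..n, (q₀ x * f x ^ 2 - r x) ≤ _ at h1
  rw [e1] at h1
  linarith

/-- The Gaussian law has the same null sets as Lebesgue measure, so a continuous function vanishing
almost everywhere is zero. -/
theorem eq_zero_of_integral_sq_gaussianReal {f : ℝ → ℝ} (hf : Continuous f)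
    (hi : Integrable (fun x => f x ^ 2) (gaussianReal 0 1))
    (h : ∫ x, f x ^ 2 ∂(gaussianReal 0 1) = 0) : f = 0 := by
  rw [integral_eq_zero_iff_of_nonneg (fun _ => sq_nonneg _) hi] at h
  have h1 := (gaussianReal_absolutelyContinuous' 0 one_ne_zero).ae_eq h
  have h2 := (Continuous.ae_eq_iff_eq volume (hf.pow 2) continuous_zero).1 h1
  ext x
  simpa using congrFun h2 x

end Gaussian

/-! ### Random selection between two vectors of normalized sums -/

namespace IsIID

variable {Ω : Type*} [MeasurableSpace Ω] {E : Type*} [MeasurableSpace E]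
  {P : Measure Ω} [IsProbabilityMeasure P] {z : ℕ → Ω → E}

/-- Switching between two vectors of normalized sums according to the sign of a further normalized
sum does not change the limit law, if the two have the same covariance matrix and the same
covariances with the further sum. -/
theorem tendstoInDistribution_switch (hz : IsIID P z) {ι : Type*} [Fintype ι] [DecidableEq ι]
    {φ : E → ℝ} {ψ ψ' : ι → E → ℝ} (hφ : Measurable φ) (hψ : ∀ a, Measurable (ψ a))
    (hψ' : ∀ a, Measurable (ψ' a)) (hφ2 : MemLp (fun ω => φ (z 0 ω)) 2 P)
    (hψ2 : ∀ a, MemLp (fun ω => ψ a (z 0 ω)) 2 P) (hψ2' : ∀ a, MemLp (fun ω => ψ' a (z 0 ω)) 2 P)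
    (hφ0 : ∫ ω, φ (z 0 ω) ∂P = 0) (hψ0 : ∀ a, ∫ ω, ψ a (z 0 ω) ∂P = 0)
    (hψ0' : ∀ a, ∫ ω, ψ' a (z 0 ω) ∂P = 0) (hpos : 0 < ∫ ω, φ (z 0 ω) ^ 2 ∂P)
    {V : Matrix ι ι ℝ} (hV : ∀ a b, V a b = ∫ ω, ψ a (z 0 ω) * ψ b (z 0 ω) ∂P)
    (hV' : ∀ a b, V a b = ∫ ω, ψ' a (z 0 ω) * ψ' b (z 0 ω) ∂P)
    (hφψ : ∀ a, ∫ ω, φ (z 0 ω) * ψ' a (z 0 ω) ∂P = ∫ ω, φ (z 0 ω) * ψ a (z 0 ω) ∂P) :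
    TendstoInDistribution (fun (n : ℕ) ω => WithLp.toLp 2 fun a =>
        if 0 < normSum z φ (n, ω) then normSum z (ψ a) (n, ω) else normSum z (ψ' a) (n, ω)) atTop
      (id : EuclideanSpace ℝ ι → EuclideanSpace ℝ ι) (fun _ => P) (multivariateGaussian 0 V) := by
  have hm : ∀ n : ℕ, Measurable fun ω => (WithLp.toLp 2 fun a =>
      if 0 < normSum z φ (n, ω) then normSum z (ψ a) (n, ω) else normSum z (ψ' a) (n, ω) :
        EuclideanSpace ℝ ι) := fun n =>
    (WithLp.measurable_toLp 2 _).comp (measurable_pi_lambda _ fun a =>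
      Measurable.ite (measurableSet_lt measurable_const (hz.measurable_normSum hφ n))
        (hz.measurable_normSum (hψ a) n) (hz.measurable_normSum (hψ' a) n))
  refine ⟨fun n => (hm n).aemeasurable, aemeasurable_id, ?_⟩
  refine ProbabilityMeasure.tendsto_iff_tendsto_charFun.2 fun u => ?_
  have meas : ∀ {ψ : ι → E → ℝ}, (∀ a, Measurable (ψ a)) → Measurable fun v => ∑ a, u a * ψ a v :=
    fun hψ => Finset.measurable_sum _ fun a _ => (hψ a).const_mul _
  have lp : ∀ {ψ : ι → E → ℝ}, (∀ a, MemLp (fun ω => ψ a (z 0 ω)) 2 P) →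
      MemLp (fun ω => ∑ a, u a * ψ a (z 0 ω)) 2 P := fun hψ2 =>
    memLp_finsetSum _ fun a _ => (hψ2 a).const_mul _
  have mean : ∀ {ψ : ι → E → ℝ}, (∀ a, MemLp (fun ω => ψ a (z 0 ω)) 2 P) →
      (∀ a, ∫ ω, ψ a (z 0 ω) ∂P = 0) → ∫ ω, ∑ a, u a * ψ a (z 0 ω) ∂P = 0 := fun hψ2 hψ0 => by
    rw [integral_finsetSum _ fun a _ => ((hψ2 a).const_mul _).integrable one_le_two]
    simp [integral_const_mul, hψ0]
  have cov : ∀ {ψ : ι → E → ℝ}, (∀ a, MemLp (fun ω => ψ a (z 0 ω)) 2 P) →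
      ∫ ω, φ (z 0 ω) * ∑ a, u a * ψ a (z 0 ω) ∂P =
        ∑ a, u a * ∫ ω, φ (z 0 ω) * ψ a (z 0 ω) ∂P := fun {ψ} hψ2 => by
    simp only [Finset.mul_sum, mul_left_comm (φ _)]
    have hi : ∀ a, Integrable (fun ω => φ (z 0 ω) * ψ a (z 0 ω)) P := fun a =>
      hφ2.integrable_mul (hψ2 a)
    rw [integral_finsetSum _ fun a _ => (hi a).const_mul _]
    simp [integral_const_mul]
  have h := hz.tendsto_charFun_switch hφ (meas hψ) (meas hψ') hφ2 (lp hψ2) (lp hψ2') hφ0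
    (mean hψ2 hψ0) (mean hψ2' hψ0') hpos
    (by rw [integral_sum_mul_sq hψ2 hV, integral_sum_mul_sq hψ2' hV'])
    (by rw [cov hψ2, cov hψ2']; simp only [hφψ])
  rw [integral_sum_mul_sq hψ2 hV] at h
  simp only [ProbabilityMeasure.coe_mk, Measure.map_id]
  rw [charFun_multivariateGaussian (posSemidef_of_integral hψ2 hV)]
  convert h using 1
  · ext n
    rw [charFun_apply, integral_map (hm n).aemeasurable (by fun_prop)]
    refine integral_congr_ae (ae_of_all _ fun ω => ?_)
    simp only [PiLp.inner_apply]
    rw [normSum_finset_sum, normSum_finset_sum]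
    split_ifs <;> simp [normSum_const_mul]
  · simp [neg_div]

end IsIID

/-! ### A Gaussian component in symmetric FastICA -/

namespace ICModel

variable {Ω : Type*} [MeasurableSpace Ω] {p : ℕ} {P : Measure Ω} {G : ℝ → ℝ}
  {z x : ℕ → Ω → Fin p → ℝ} {loc ν μ lam δ β σsq s : Fin p → ℝ}
  {κ : Fin p → Fin p → ℝ} {θ : ℝ}

theorem integrable_gaussianReal_of_coord (h : ICModel P G z ν μ lam δ) {j : Fin p}
    (hj : P.map (fun ω => z 0 ω j) = gaussianReal 0 1) {f : ℝ → ℝ} (hf : Continuous f)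
    (hi : Integrable (fun ω => f (z 0 ω j)) P) : Integrable f (gaussianReal 0 1) := by
  rw [← hj]
  exact (integrable_map_measure hf.aestronglyMeasurable (h.measurable_coord j).aemeasurable).2 hi

theorem integrable_coord_of_gaussianReal (h : ICModel P G z ν μ lam δ) {j : Fin p}
    (hj : P.map (fun ω => z 0 ω j) = gaussianReal 0 1) {f : ℝ → ℝ} (hf : Continuous f)
    (hi : Integrable f (gaussianReal 0 1)) : Integrable (fun ω => f (z 0 ω j)) P := by
  rw [← hj] at hi
  exact (integrable_map_measure hf.aestronglyMeasurable (h.measurable_coord j).aemeasurable).1 hi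

theorem integral_coord_eq_gaussianReal (h : ICModel P G z ν μ lam δ) {j : Fin p}
    (hj : P.map (fun ω => z 0 ω j) = gaussianReal 0 1) {f : ℝ → ℝ} (hf : Continuous f) :
    ∫ ω, f (z 0 ω j) ∂P = ∫ t, f t ∂(gaussianReal 0 1) := by
  rw [← hj, integral_map (h.measurable_coord j).aemeasurable hf.aestronglyMeasurable]

/-- Only integrability of G(z_j) is assumed, but the sign argument needs a central limit theorem for
it. The second moment comes from that of g(z_j). -/
theorem memLp_G_of_gaussian (h : ICModel P G z ν μ lam δ) {j : Fin p}
    (hj : P.map (fun ω => z 0 ω j) = gaussianReal 0 1) : MemLp (fun ω => G (z 0 ω j)) 2 P := by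
  have m : Measurable fun ω => G (z 0 ω j) := h.continuous.measurable.comp (h.measurable_coord j)
  refine (memLp_two_iff_integrable_sq m.aestronglyMeasurable).2 ?_
  exact h.integrable_coord_of_gaussianReal hj (h.continuous.pow 2)
    (integrable_sq_gaussianReal_of_deriv h.hasDerivAt (h.integrable_gaussianReal_of_coord hj
      (h.continuous_deriv.pow 2) (h.moments j).sigma.integrable_sq))

variable [IsProbabilityMeasure P]

theorem lam_eq_delta_of_gaussian (h : ICModel P G z ν μ lam δ) {j : Fin p}
    (hj : P.map (fun ω => z 0 ω j) = gaussianReal 0 1) : lam j = δ j := by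
  have c1 := h.continuous_deriv
  have c2 := h.continuous_deriv2
  have c3 : Continuous fun t => deriv G t * t := c1.mul continuous_id
  rw [← h.lam_eq, ← h.delta_eq, h.integral_coord_eq_gaussianReal hj c3,
    h.integral_coord_eq_gaussianReal hj c2]
  exact integral_mul_self_gaussianReal h.hasDerivAt_deriv
    (h.integrable_gaussianReal_of_coord hj c1 (h.integrable_deriv j))
    (h.integrable_gaussianReal_of_coord hj c3 (h.moments j).lam)
    (h.integrable_gaussianReal_of_coord hj c2 (h.moments j).delta)

theorem memLp_residual_of_gaussian (h : ICModel P G z ν μ lam δ) {j : Fin p}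
    (hj : P.map (fun ω => z 0 ω j) = gaussianReal 0 1) :
    MemLp (fun ω => G (z 0 ω j) - ν j - μ j * z 0 ω j - lam j * (z 0 ω j ^ 2 - 1) / 2) 2 P := by
  have h1 := (((h.memLp_coord_sq j).sub (memLp_const (1 : ℝ))).const_mul (lam j / 2))
  have := (((h.memLp_G_of_gaussian hj).sub (memLp_const (ν j))).sub
    ((h.source.memLp j).const_mul (μ j))).sub h1
  refine this.ae_eq (ae_of_all _ fun ω => ?_)
  simp only [Pi.sub_apply]
  ring

theorem integral_residual (h : ICModel P G z ν μ lam δ) (j : Fin p) :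
    ∫ ω, (G (z 0 ω j) - ν j - μ j * z 0 ω j - lam j * (z 0 ω j ^ 2 - 1) / 2) ∂P = 0 := by
  have i1 : Integrable (fun ω => G (z 0 ω j) - ν j) P := (h.moments j).nu.sub (integrable_const _)
  have i2 := (h.integrable_coord j).const_mul (μ j)
  have i3 : Integrable (fun ω => lam j * (z 0 ω j ^ 2 - 1) / 2) P :=
    (((h.source.memLp j).integrable_sq.sub (integrable_const _)).const_mul _).div_const _
  have i12 : Integrable (fun ω => G (z 0 ω j) - ν j - μ j * z 0 ω j) P := i1.sub i2
  rw [integral_sub i12 i3, integral_sub i1 i2, integral_sub (h.moments j).nu (integrable_const _),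
    integral_const_mul, integral_div, integral_const_mul,
    integral_sub (h.source.memLp j).integrable_sq (integrable_const _), h.source.mean,
    h.source.second_moment, h.nu_eq]
  simp

/-- If the residual of G had second moment zero it would vanish identically, and G would be a
polynomial of degree at most two. -/
theorem integral_residual_sq_pos (h : ICModel P G z ν μ lam δ) {j : Fin p}
    (hj : P.map (fun ω => z 0 ω j) = gaussianReal 0 1)
    (hG : ¬ ∃ a b c : ℝ, ∀ x, G x = a * x ^ 2 + b * x + c) :
    0 < ∫ ω, (G (z 0 ω j) - ν j - μ j * z 0 ω j - lam j * (z 0 ω j ^ 2 - 1) / 2) ^ 2 ∂P := by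
  refine lt_of_le_of_ne (integral_nonneg fun _ => sq_nonneg _) fun h0 => hG ?_
  have hc : Continuous fun t => G t - ν j - μ j * t - lam j * (t ^ 2 - 1) / 2 := by
    have := h.continuous
    fun_prop
  have hi := h.integrable_gaussianReal_of_coord hj (hc.pow 2)
    (h.memLp_residual_of_gaussian hj).integrable_sq
  have h1 := h.integral_coord_eq_gaussianReal hj (hc.pow 2)
  simp only [Pi.pow_apply] at h1
  rw [← h0] at h1
  have h2 := eq_zero_of_integral_sq_gaussianReal hc hi h1.symm
  refine ⟨lam j / 2, μ j, ν j - lam j / 2, fun t => ?_⟩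
  have := congrFun h2 t
  simp only [Pi.zero_apply] at this
  linarith

/-- The signs enter the numerator only through their squares, and the denominator only through their
products with λ_j − δ_j. So a sign may be altered wherever λ_j = δ_j. -/
theorem asymptoticVariance_of_sq_eq_one {c : Fin p → ℝ} (hc : ∀ j, c j ^ 2 = 1)
    (hcs : ∀ j, (lam j - δ j) * c j = (lam j - δ j) * s j) (j l : Fin p) :
    asymptoticVariance (fun j _ => c j) 0 ν lam δ β σsq j l =
      if l = j then (β j - 1) / 4
      else (σsq j + σsq l - lam j ^ 2 + δ l * (δ l - 2 * lam l)) /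
        ((lam j - δ j) * s j + (lam l - δ l) * s l) ^ 2 := by
  rw [asymptoticVariance]
  split_ifs with hjl
  · rfl
  · rw [pairSlope, limitWeight, limitWeight, zero_mul, zero_mul, add_zero, add_zero, hc, hc,
      ← hcs, ← hcs]
    congr 1 <;> ring

/-- The slope is a sum of two nonnegative terms, of which at most one vanishes. -/
theorem pairSlope_ne_zero_of_sign {c : Fin p → ℝ} (h0 : ∀ j, 0 ≤ (lam j - δ j) * c j)
    (h1 : ∀ j l, (lam j - δ j) * c j = 0 → (lam l - δ l) * c l = 0 → j = l) (j l : Fin p)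
    (hjl : j ≠ l) : pairSlope (fun j _ => c j) 0 ν lam δ j l ≠ 0 := by
  intro hD
  have e : (lam j - δ j) * c j + (lam l - δ l) * c l = 0 := by
    rw [← hD, pairSlope, limitWeight, limitWeight]
    ring
  refine hjl (h1 j l ?_ ?_) <;> linarith [h0 j, h0 l]

theorem eventually_sign_sampleG (h : ICModel P G z ν μ lam δ)
    (hx : ∀ i ω, x i ω = loc + z i ω) (hD : ∀ j l, j ≠ l → pairSlope κ θ ν lam δ j l ≠ 0)
    {j : Fin p} (hj : ν j ≠ 0) :
    ∀ᶠ q in probFilter P,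
      Real.sign (sampleG G (obs x q) (newtonLimit G κ θ ν lam δ q.1 (obs x q) j)) =
        Real.sign (ν j) := by
  have ht := h.tendsto_sampleG_newtonLimit hx hD j
  rcases lt_or_gt_of_ne hj with h0 | h0
  · filter_upwards [ht.eventually (gt_mem_nhds h0)] with q hq
    rw [Real.sign_of_neg hq, Real.sign_of_neg h0]
  · filter_upwards [ht.eventually (lt_mem_nhds h0)] with q hq
    rw [Real.sign_of_pos hq, Real.sign_of_pos h0]

/-- At a Gaussian component with `E[G(z)] = 0`, the sign of the sample version of `E[G(γᵀx)]` is
asymptotically the sign of a normalized sum that does not depend on the weights. -/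
theorem eventually_sign_sampleG_of_gaussian (h : ICModel P G z ν μ lam δ)
    (hG : ¬ ∃ a b c : ℝ, ∀ x, G x = a * x ^ 2 + b * x + c)
    (hx : ∀ i ω, x i ω = loc + z i ω) (hD : ∀ j l, j ≠ l → pairSlope κ θ ν lam δ j l ≠ 0)
    {j : Fin p} (hj : P.map (fun ω => z 0 ω j) = gaussianReal 0 1) (hν : ν j = 0) :
    ∀ᶠ q in probFilter P,
      Real.sign (sampleG G (obs x q) (newtonLimit G κ θ ν lam δ q.1 (obs x q) j)) =
        if 0 < normSum z (fun v => G (v j) - ν j - μ j * v j - lam j * (v j ^ 2 - 1) / 2) q then 1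
        else -1 := by
  have hm : Measurable fun v : Fin p → ℝ =>
      G (v j) - ν j - μ j * v j - lam j * (v j ^ 2 - 1) / 2 := by
    have := h.continuous.measurable
    fun_prop
  filter_upwards [h.isIID.eventually_abs_lt_abs_normSum hm (h.memLp_residual_of_gaussian hj)
    (h.integral_residual j) (h.integral_residual_sq_pos hj hG) (h.tendsto_sqrt_mul_sampleG hx hD j)]
    with q hq
  set S := normSum z (fun v => G (v j) - ν j - μ j * v j - lam j * (v j ^ 2 - 1) / 2) q
  set g := sampleG G (obs x q) (newtonLimit G κ θ ν lam δ q.1 (obs x q) j)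
  have h0 := Real.sqrt_nonneg (q.1 : ℝ)
  -- With ν_j = 0, √n times the sample mean of G differs from S by less than |S|, so both have the
  -- same strict sign; in particular S ≠ 0.
  rw [hν, sub_zero] at hq
  split_ifs with hS
  · rw [abs_of_pos hS] at hq
    have := (abs_lt.mp hq).1
    exact Real.sign_of_pos (by by_contra hg; push Not at hg; nlinarith)
  · push Not at hS
    rw [abs_of_nonpos hS] at hq
    have := (abs_lt.mp hq).2
    exact Real.sign_of_neg (by by_contra hg; push Not at hg; nlinarith)

/-- Two solutions with the same asymptotic covariance matrices, one of which is chosen according to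
the sign of a normalized sum. -/
theorem hasSolutionsWithASV_of_switch (h : ICModel P G z ν μ lam δ)
    (hx : ∀ i ω, x i ω = loc + z i ω) {κ' : Fin p → Fin p → ℝ}
    (hD : ∀ j l, j ≠ l → pairSlope κ θ ν lam δ j l ≠ 0)
    (hD' : ∀ j l, j ≠ l → pairSlope κ' θ ν lam δ j l ≠ 0)
    (hβ : ∀ j, β j = icBeta P (fun ω => z 0 ω j))
    (hσsq : ∀ j, σsq j = icSigmaSq G P (fun ω => z 0 ω j))
    {φ : (Fin p → ℝ) → ℝ} (hφ : Measurable φ) (hφ2 : MemLp (fun ω => φ (z 0 ω)) 2 P)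
    (hφ0 : ∫ ω, φ (z 0 ω) ∂P = 0) (hpos : 0 < ∫ ω, φ (z 0 ω) ^ 2 ∂P)
    (hV : asymptoticVariance κ' θ ν lam δ β σsq = asymptoticVariance κ θ ν lam δ β σsq)
    (hφψ : ∀ j l, ∫ ω, φ (z 0 ω) * influence G κ' θ ν μ lam δ j l (z 0 ω) ∂P =
      ∫ ω, φ (z 0 ω) * influence G κ θ ν μ lam δ j l (z 0 ω) ∂P)
    {A : ∀ n : ℕ, (Fin n → Fin p → ℝ) → Prop} (hA : ∀ n, MeasurableSet {X | A n X})
    (hAφ : ∀ᶠ q in probFilter P, (A q.1 (obs x q) ↔ 0 < normSum z φ q))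
    {Sol : ∀ n : ℕ, (Fin n → Fin p → ℝ) → Matrix (Fin p) (Fin p) ℝ → Prop}
    (hSol : ∀ᶠ q in probFilter P, 0 < normSum z φ q →
      Sol q.1 (obs x q) (newtonLimit G κ θ ν lam δ q.1 (obs x q)))
    (hSol' : ∀ᶠ q in probFilter P, ¬ 0 < normSum z φ q →
      Sol q.1 (obs x q) (newtonLimit G κ' θ ν lam δ q.1 (obs x q))) :
    HasSolutionsWithASV P x Sol (asymptoticVariance κ θ ν lam δ β σsq) := by
  classical
  have hm : ∀ n j l, Measurable fun X : Fin n → Fin p → ℝ =>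
      if A n X then newtonLimit G κ θ ν lam δ n X j l else newtonLimit G κ' θ ν lam δ n X j l :=
    fun n j l => Measurable.ite (hA n)
      (measurable_newtonLimit h.continuous h.continuous_deriv κ θ ν lam δ j l)
      (measurable_newtonLimit h.continuous h.continuous_deriv κ' θ ν lam δ j l)
  refine ⟨fun n X j l => if A n X then newtonLimit G κ θ ν lam δ n X j l
    else newtonLimit G κ' θ ν lam δ n X j l, hm, ?_, fun j l => ?_, fun j => ?_⟩
  · refine tendsto_measure_of_eventually (p := fun q => Sol q.1 (obs x q) (fun j l =>
      if A q.1 (obs x q) then newtonLimit G κ θ ν lam δ q.1 (obs x q) j l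
      else newtonLimit G κ' θ ν lam δ q.1 (obs x q) j l)) ?_
    filter_upwards [hSol, hSol', hAφ] with q h1 h2 h3
    by_cases h4 : A q.1 (obs x q)
    · simp only [if_pos h4]
      exact h1 (h3.1 h4)
    · simp only [if_neg h4]
      exact h2 fun h5 => h4 (h3.2 h5)
  · rw [tendstoInMeasure_iff_probFilter]
    have t1 := h.tendsto_newtonLimit hx hD j l
    have t2 := h.tendsto_newtonLimit hx hD' j l
    have := Tendsto.if' (p := fun q : ℕ × Ω => A q.1 (obs x q)) t1 t2
    exact this
  · refine HasASV.of_tendsto (Y := fun q l => if 0 < normSum z φ q then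
        normSum z (influence G κ θ ν μ lam δ j l) q
        else normSum z (influence G κ' θ ν μ lam δ j l) q)
      (h.posSemidef_asymptoticVariance hβ hσsq j)
      (h.isIID.tendstoInDistribution_switch (ψ := fun l => influence G κ θ ν μ lam δ j l)
        (ψ' := fun l => influence G κ' θ ν μ lam δ j l) hφ (h.measurable_influence κ θ j)
        (h.measurable_influence κ' θ j) hφ2 (h.memLp_influence κ θ j) (h.memLp_influence κ' θ j)
        hφ0 (h.integral_influence κ θ j) (h.integral_influence κ' θ j) hpos
        (h.diagonal_asymptoticVariance hβ hσsq j)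
        (by rw [← hV]; exact h.diagonal_asymptoticVariance hβ hσsq j) (hφψ j))
      (fun n l => (hm n j l).comp (h.measurable_obs hx n)) fun l => ?_
    refine ((h.tendsto_sqrt_mul_newtonLimit hx hD j l).if'
      (h.tendsto_sqrt_mul_newtonLimit hx hD' j l) (p := fun q => 0 < normSum z φ q)).congr' ?_
    -- The estimator can only switch on an event A of the sample, whereas the limit law was computed
    -- for switching on the sign of the normalized sum. The two agree with probability tending to
    -- one.
    filter_upwards [hAφ] with q hq
    have e : (fun i : Fin q.1 => x i q.2) = obs x q := rfl
    simp only [e, hq]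
    split_ifs <;> rfl

set_option maxHeartbeats 1000000 in
/-- The symmetric method if there is a Gaussian component with `E[G(z)] = 0`. -/
theorem hasSolutionsWithASV_symmetric_of_gaussian (h : ICModel P G z ν μ lam δ)
    (hG : ¬ ∃ a b c : ℝ, ∀ x, G x = a * x ^ 2 + b * x + c) (hx : ∀ i ω, x i ω = loc + z i ω)
    (hβ : ∀ j, β j = icBeta P (fun ω => z 0 ω j))
    (hσsq : ∀ j, σsq j = icSigmaSq G P (fun ω => z 0 ω j)) {k : Fin p}
    (hk : P.map (fun ω => z 0 ω k) = gaussianReal 0 1) (hνk : ν k = 0)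
    (hν : ∀ j, j ≠ k → ν j ≠ 0) (hpos : ∀ j, j ≠ k → 0 < ν j * (lam j - δ j)) :
    HasSolutionsWithASV P x (fun _ X Γ => IsSymmetricSolution G X Γ)
      (fun j l => if l = j then (β j - 1) / 4
        else (σsq j + σsq l - lam j ^ 2 + δ l * (δ l - 2 * lam l)) /
          ((lam j - δ j) * Real.sign (ν j) + (lam l - δ l) * Real.sign (ν l)) ^ 2) := by
  -- The candidates are t = 1 and t = −1: the equations with s_k replaced by the constant t and the
  -- other signs by their limits.
  set c : ℝ → Fin p → ℝ := fun t j => if j = k then t else Real.sign (ν j) with hc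
  have hlk : lam k - δ k = 0 := sub_eq_zero.2 (h.lam_eq_delta_of_gaussian hk)
  have hcs : ∀ t j, (lam j - δ j) * c t j = (lam j - δ j) * Real.sign (ν j) := fun t j => by
    by_cases hj : j = k
    · rw [hj, hlk, zero_mul, zero_mul]
    · simp only [hc, if_neg hj]
  have hc1 : ∀ t, t ^ 2 = 1 → ∀ j, c t j ^ 2 = 1 := fun t ht j => by
    by_cases hj : j = k
    · simpa only [hc, if_pos hj] using ht
    · simp only [hc, if_neg hj]
      rcases Real.sign_apply_eq_of_ne_zero _ (hν j hj) with h1 | h1 <;> rw [h1] <;> norm_num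
  have hsgn : ∀ j, j ≠ k → 0 < (lam j - δ j) * Real.sign (ν j) := fun j hj => by
    have h1 := hpos j hj
    rcases lt_or_gt_of_ne (hν j hj) with h2 | h2
    · rw [Real.sign_of_neg h2]; nlinarith
    · rw [Real.sign_of_pos h2]; nlinarith
  have hD : ∀ t j l, j ≠ l → pairSlope (fun j _ => c t j) 0 ν lam δ j l ≠ 0 := fun t =>
    pairSlope_ne_zero_of_sign (fun j => by
      rw [hcs]
      by_cases hj : j = k
      · rw [hj, hlk, zero_mul]
      · exact (hsgn j hj).le) fun j l hj hl => by
      rw [hcs] at hj hl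
      have hj' : j = k := by_contra fun hne => (hsgn j hne).ne' hj
      have hl' : l = k := by_contra fun hne => (hsgn l hne).ne' hl
      rw [hj', hl']
  have hV : ∀ t, t ^ 2 = 1 → asymptoticVariance (fun j _ => c t j) 0 ν lam δ β σsq = _ :=
    fun t ht => funext fun j => funext fun l => asymptoticVariance_of_sq_eq_one (hc1 t ht) (hcs t) j l
  rw [← hV 1 (one_pow 2)]
  have hV' := (hV (-1) (by norm_num)).trans (hV 1 (one_pow 2)).symm
  set φ : (Fin p → ℝ) → ℝ := fun v => G (v k) - ν k - μ k * v k - lam k * (v k ^ 2 - 1) / 2 with hφ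
  have mφ : Measurable φ := by
    have := h.continuous.measurable
    fun_prop
  set Y : ℝ → ∀ n : ℕ, (Fin n → Fin p → ℝ) → Fin p → Fin p → ℝ := fun t n X =>
    newtonLimit G (fun j _ => c t j) 0 ν lam δ n X with hY
  have mY : ∀ t n j l, Measurable fun X => Y t n X j l := fun t n j l =>
    measurable_newtonLimit h.continuous h.continuous_deriv _ 0 ν lam δ j l
  have sgnk : ∀ t, ∀ᶠ q in probFilter P, Real.sign (sampleG G (obs x q) (Y t q.1 (obs x q) k)) =
      if 0 < normSum z φ q then 1 else -1 := fun t =>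
    h.eventually_sign_sampleG_of_gaussian hG hx (hD t) hk hνk
  have sgn : ∀ t, ∀ᶠ q in probFilter P, ∀ j, j ≠ k →
      Real.sign (sampleG G (obs x q) (Y t q.1 (obs x q) j)) = Real.sign (ν j) := fun t => by
    refine eventually_all.2 fun j => ?_
    by_cases hj : j = k
    · exact Eventually.of_forall fun q hq => absurd hj hq
    · filter_upwards [h.eventually_sign_sampleG hx (hD t) (hν j hj)] with q hq _ using hq
  -- The sums of the sources are not observable. The sign of Ĝ at row k of the candidate t = 1 is a
  -- function of the sample and agrees eventually with that of the normalized sum of φ.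
  have hswitch : ∀ᶠ q in probFilter P,
      (0 < sampleG G (obs x q) (Y 1 q.1 (obs x q) k) ↔ 0 < normSum z φ q) := by
    filter_upwards [sgnk 1] with q hq
    split_ifs at hq with h1
    · refine iff_of_true ?_ h1
      by_contra h2
      rcases (not_lt.1 h2).lt_or_eq with h3 | h3
      · rw [Real.sign_of_neg h3] at hq; norm_num at hq
      · rw [h3, Real.sign_zero] at hq; norm_num at hq
    · refine iff_of_false (fun h2 => ?_) h1
      rw [Real.sign_of_pos h2] at hq; norm_num at hq
  -- A candidate solves the true equations if the actual sign at row k is the t put in. That sign is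
  -- eventually the sign of the same normalized sum for both candidates, so one of them is always
  -- right.
  have hsol : ∀ t, ∀ᶠ q in probFilter P, (if 0 < normSum z φ q then (1 : ℝ) else -1) = t →
      IsSymmetricSolution G (obs x q) (Y t q.1 (obs x q)) := fun t => by
    filter_upwards [sgnk t, sgn t, h.eventually_constraints hx (hD t)] with q h1 h2 h3 ht
    refine isSymmetricSolution_of_estEq h3.1 h3.2 fun j => ?_
    by_cases hj : j = k
    · simp only [hc, if_pos hj]
      rw [hj]
      exact h1.trans ht
    · simp only [hc, if_neg hj]
      exact h2 j hj
  have m1 : ∀ n : ℕ, Measurable fun X : Fin n → Fin p → ℝ => sampleG G X (Y 1 n X k) := fun n =>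
    (continuous_sampleG (n := n) (p := p) h.continuous).measurable.comp
      (measurable_id.prodMk (measurable_pi_lambda _ fun l => mY 1 n k l))
  refine h.hasSolutionsWithASV_of_switch hx (hD 1) (hD (-1)) hβ hσsq mφ
    (h.memLp_residual_of_gaussian hk) (h.integral_residual k) (h.integral_residual_sq_pos hk hG) hV'
    (fun j l => ?_) (A := fun n X => 0 < sampleG G X (Y 1 n X k))
    (fun n => measurableSet_lt measurable_const (m1 n)) hswitch ?_ ?_
  -- The diagonal influence functions do not involve the weights; the off-diagonal ones are
  -- uncorrelated with φ, a function of one component, whatever t is.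
  · by_cases hjl : j = l
    · subst hjl
      simp only [influence, if_true]
    · have hr : Measurable fun t => G t - ν k - μ k * t - lam k * (t ^ 2 - 1) / 2 := by
        have := h.continuous.measurable
        fun_prop
      have h1 := fun t => h.integral_coord_mul_influence (κ := fun j _ => c t j) (θ := 0) hjl hr
        (h.memLp_residual_of_gaussian hk)
      exact (h1 (-1)).trans (h1 1).symm
  · filter_upwards [hsol 1] with q hq hq' using hq (if_pos hq')
  · filter_upwards [hsol (-1)] with q hq hq' using hq (if_neg hq')

end ICModel

/-! ### The three methods as special cases -/

theorem corollary2 {Ω : Type*} [MeasurableSpace Ω] (P : Measure Ω) [IsProbabilityMeasure P]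
    (p : ℕ) (G : ℝ → ℝ) (hG : IsFastICAFunction G)
    (z x : ℕ → Ω → Fin p → ℝ) (loc : Fin p → ℝ)
    (hx : ∀ i ω, x i ω = loc + z i ω)
    (hz : IsICSourceSample P z)
    (hmom : ∀ j, HasICMoments G P (fun ω => z 0 ω j))
    (henv : ∀ j, HasLocalEnvelope G P (fun ω => z 0 ω j))
    (β ν σsq lam δ s : Fin p → ℝ)
    (hβ : ∀ j, β j = icBeta P (fun ω => z 0 ω j))
    (hν : ∀ j, ν j = icNu G P (fun ω => z 0 ω j))
    (hσsq : ∀ j, σsq j = icSigmaSq G P (fun ω => z 0 ω j))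
    (hlam : ∀ j, lam j = icLambda G P (fun ω => z 0 ω j))
    (hδ : ∀ j, δ j = icDelta G P (fun ω => z 0 ω j))
    (hs : ∀ j, s j = Real.sign (ν j))
    (hnonneg : ∀ j, 0 ≤ ν j * (lam j - δ j))
    (hzero : ∀ j k, ν j * (lam j - δ j) = 0 → ν k * (lam k - δ k) = 0 → j = k) :
    -- (i) deflation-based; only the last component may have `lam j = δ j`
    ((∀ j : Fin p, (j : ℕ) + 1 < p → lam j ≠ δ j) →
      HasSolutionsWithASV P x (fun _ X Γ => IsDeflationSolution G X Γ)
        (fun j l =>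
          if l < j then (σsq l - lam l ^ 2) / (lam l - δ l) ^ 2 + 1
          else if l = j then (β j - 1) / 4
          else (σsq j - lam j ^ 2) / (lam j - δ j) ^ 2)) ∧
    -- (ii) symmetric; only a Gaussian component may have `ν j = 0`
    ((∀ j : Fin p, ν j = 0 → P.map (fun ω => z 0 ω j) = gaussianReal 0 1) →
      HasSolutionsWithASV P x (fun _ X Γ => IsSymmetricSolution G X Γ)
        (fun j l =>
          if l = j then (β j - 1) / 4
          else (σsq j + σsq l - lam j ^ 2 + δ l * (δ l - 2 * lam l)) /
            ((lam j - δ j) * s j + (lam l - δ l) * s l) ^ 2)) ∧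
    -- (iii) squared symmetric
    HasSolutionsWithASV P x (fun _ X Γ => IsSquaredSymmetricSolution G X Γ)
      (fun j l =>
        if l = j then (β j - 1) / 4
        else (ν j ^ 2 * (σsq j - lam j ^ 2) + ν l ^ 2 * (σsq l + δ l * (δ l - 2 * lam l))) /
          (ν j * (lam j - δ j) + ν l * (lam l - δ l)) ^ 2) := by
  have h : ICModel P G z ν (fun j => ∫ ω, deriv G (z 0 ω j) ∂P) lam δ :=
    { contDiff := hG.contDiff
      source := hz
      moments := hmom
      envelope := henv
      nu_eq := fun j => (hν j).symm
      mu_eq := fun _ => rfl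
      lam_eq := fun j => (hlam j).symm
      delta_eq := fun j => (hδ j).symm }
  refine ⟨fun hne => ?_, fun hgauss => ?_, ?_⟩
  · -- deflation
    set κ : Fin p → Fin p → ℝ := fun j l => if j < l then 1 else 0 with hκ
    have hV : ICModel.asymptoticVariance κ 0 ν lam δ β σsq = fun j l =>
        if l < j then (σsq l - lam l ^ 2) / (lam l - δ l) ^ 2 + 1
        else if l = j then (β j - 1) / 4
        else (σsq j - lam j ^ 2) / (lam j - δ j) ^ 2 := by
      ext j l
      simp only [ICModel.asymptoticVariance, pairSlope, limitWeight, hκ, zero_mul, add_zero]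
      rcases lt_trichotomy l j with hlj | hlj | hlj
      · have hl := sub_ne_zero.2 (hne l (by have := Fin.lt_def.1 hlj; have := j.isLt; omega))
        simp only [if_neg hlj.ne, if_pos hlj, if_neg hlj.not_gt]
        -- The summand 1 arises from σ² + δ(δ − 2λ) = (σ² − λ²) + (λ − δ)².
        rw [zero_pow two_ne_zero, zero_mul, zero_mul, one_pow, one_mul, one_mul, zero_add, zero_add,
          div_add_one (pow_ne_zero 2 hl)]
        congr 1
        ring
      · simp [hlj]
      · simp only [if_neg hlj.ne', if_pos hlj, if_neg hlj.not_gt]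
        ring
    have hD : ∀ j l, j ≠ l → pairSlope κ 0 ν lam δ j l ≠ 0 := fun j l hjl => by
      simp only [pairSlope, limitWeight, hκ, zero_mul, add_zero]
      -- The slope of a pair is λ − δ at its smaller index, which is never the last one.
      rcases lt_or_gt_of_ne hjl with hlt | hlt
      · simpa [hlt, hlt.not_gt] using
          sub_ne_zero.2 (hne j (by have := Fin.lt_def.1 hlt; have := l.isLt; omega))
      · simpa [hlt, hlt.not_gt] using
          sub_ne_zero.2 (hne l (by have := Fin.lt_def.1 hlt; have := j.isLt; omega))
    rw [← hV]
    refine h.hasSolutionsWithASV hx hD (fun j => hβ j) hσsq ?_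
    filter_upwards [h.eventually_constraints hx hD] with q hq
    refine isDeflationSolution_of_dotProduct_eq_zero hq.1 fun j l hjl => ?_
    have := hq.2 j l hjl.ne
    simpa [estEq, hκ, hjl, hjl.not_gt] using this
  · -- symmetric
    simp only [hs]
    by_cases h0 : ∃ k, ν k = 0
    · obtain ⟨k, hk⟩ := h0
      have hk0 : ν k * (lam k - δ k) = 0 := by rw [hk, zero_mul]
      -- The component k already uses up the single permitted equality in ν_j(λ_j − δ_j) ≥ 0, so all
      -- other components have a strict inequality and ν_j ≠ 0.
      have hne : ∀ j, j ≠ k → ν j * (lam j - δ j) ≠ 0 := fun j hj hj0 => hj (hzero j k hj0 hk0)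
      exact h.hasSolutionsWithASV_symmetric_of_gaussian hG.not_quadratic hx hβ hσsq (hgauss k hk) hk
        (fun j hj => left_ne_zero_of_mul (hne j hj))
        fun j hj => lt_of_le_of_ne (hnonneg j) (hne j hj).symm
    · push Not at h0
      have hsign : ∀ j, 0 < ν j * Real.sign (ν j) := fun j => by
        rcases lt_or_gt_of_ne (h0 j) with h1 | h1
        · rw [Real.sign_of_neg h1]; linarith
        · rw [Real.sign_of_pos h1]; linarith
      have hsq : ∀ j, Real.sign (ν j) ^ 2 = 1 := fun j => by
        rcases Real.sign_apply_eq_of_ne_zero _ (h0 j) with h1 | h1 <;> rw [h1] <;> norm_num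
      -- Since ν_j s_j = |ν_j| > 0, the hypotheses on ν_j(λ_j − δ_j) carry over to (λ_j − δ_j)s_j.
      have hprod : ∀ j, ν j * (lam j - δ j) =
          ν j * Real.sign (ν j) * ((lam j - δ j) * Real.sign (ν j)) := fun j => by
        linear_combination (- ν j * (lam j - δ j)) * hsq j
      have hD : ∀ j l, j ≠ l →
          pairSlope (fun j _ => Real.sign (ν j)) 0 ν lam δ j l ≠ 0 :=
        ICModel.pairSlope_ne_zero_of_sign (fun j => by
          have := hnonneg j
          rw [hprod] at this
          exact nonneg_of_mul_nonneg_right this (hsign j))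
          fun j l hj hl => hzero j l (by rw [hprod, hj, mul_zero]) (by rw [hprod, hl, mul_zero])
      have hV : ICModel.asymptoticVariance (fun j _ => Real.sign (ν j)) 0 ν lam δ β σsq = _ :=
        funext fun j => funext fun l =>
          ICModel.asymptoticVariance_of_sq_eq_one (s := fun j => Real.sign (ν j)) hsq
            (fun _ => rfl) j l
      rw [← hV]
      refine h.hasSolutionsWithASV hx hD hβ hσsq ?_
      filter_upwards [h.eventually_constraints hx hD,
        eventually_all.2 fun j => h.eventually_sign_sampleG hx hD (h0 j)] with q hq hq'
      exact isSymmetricSolution_of_estEq hq.1 hq.2 hq'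
  · -- squared symmetric
    have hV : ICModel.asymptoticVariance (fun _ _ => 0) 1 ν lam δ β σsq = fun j l =>
        if l = j then (β j - 1) / 4
        else (ν j ^ 2 * (σsq j - lam j ^ 2) + ν l ^ 2 * (σsq l + δ l * (δ l - 2 * lam l))) /
          (ν j * (lam j - δ j) + ν l * (lam l - δ l)) ^ 2 := by
      ext j l
      simp only [ICModel.asymptoticVariance, pairSlope, limitWeight, one_mul, zero_add]
    have hD : ∀ j l, j ≠ l → pairSlope (fun _ _ => 0) 1 ν lam δ j l ≠ 0 := fun j l hjl hD => by
      simp only [pairSlope, limitWeight, one_mul, zero_add] at hD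
      refine hjl (hzero j l ?_ ?_) <;> linarith [hnonneg j, hnonneg l]
    rw [← hV]
    refine h.hasSolutionsWithASV hx hD hβ hσsq ?_
    filter_upwards [h.eventually_constraints hx hD] with q hq
    exact isSquaredSymmetricSolution_of_estEq hq.1 hq.2
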